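/- Let $(R,\mathfrak m,k)$ be a commutative Noetherian local ring with $d=\dim R$, and let $M$ and $N$ be finitely generated $R$-modules. Write $\mu(X)$ for the minimal number of generators of $X$; $\lambda(X)$ for the length of $X$; $e(M)=\lim_{n\to\infty} r!\,\lambda(M/\mathfrak m^nM)/n^r$, where $r=\dim M$, for the multiplicity of $M$; $\beta_n(N)=\mu(\operatorname{Ext}^n_R(N,k))$ and $\mu^n(N)=\mu(\operatorname{Ext}^n_R(k,N))$ for the Betti and Bass numbers of $N$; and $\operatorname{type}(M)=\mu^{t}(M)$, where $t=\operatorname{depth} M$. The zero module counts as Cohen--Macaulay (CM). (1) Assume that $M$ is CM and $e(M)<2\mu(M)$. (a) If there exists $j\ge 0$ such that $\operatorname{Tor}_n^R(M,N)=0$ for all $n=j-\dim M+1,\ldots,j+\beta_j(N)$, then $\operatorname{pd}_R N<\infty$. In particular, if $\operatorname{Tor}_n^R(M,N)=0$ for all $n\gg 0$, then $\operatorname{pd}_R N<\infty$. (b) Suppose that $R$ or $N$ is CM. If there exists $j\ge \dim M+d$ such that $\operatorname{Ext}^n_R(M,N)=0$ for all $n=j-\dim M+1,\ldots,j+d+\sum_{i=0}^d\binom{d}{i}\mu^{j+i}(N)$,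 then $\operatorname{id}_R N<\infty$. In particular, if $\operatorname{Ext}^n_R(M,N)=0$ for all $n\gg 0$, then $\operatorname{id}_R N<\infty$. (c) Suppose that $N$ is CM of dimension $s$. If there exists $j\ge 0$ such that $\operatorname{Ext}^n_R(M,N)=0$ for all $n=j-\dim M+1,\ldots,j+s+\sum_{i=0}^s\binom{s}{i}\mu^{j+i}(N)$, then $\operatorname{id}_R N<\infty$. (2) Assume that $M$ is nonzero, CM, and $e(M)<2\operatorname{type}(M)$. If there exists $j\ge 0$ such that $\operatorname{Ext}^n_R(N,M)=0$ for all $n=j+1,\ldots,j+\beta_j(N)+\dim M$, then $\operatorname{pd}_R N<\infty$. In particular, if $\operatorname{Ext}^n_R(N,M)=0$ for all $n\gg 0$, then $\operatorname{pd}_R N<\infty$. -/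

import Mathlib

universe u

namespace LocalModule

noncomputable section

open CategoryTheory Abelian IsLocalRing Filter
open scoped Nat

variable (R : Type u) [CommRing R] (M N : Type u) [AddCommGroup M] [Module R M]
  [AddCommGroup N] [Module R N]

/-- The Krull dimension of `R` as a natural number (it is finite if `R` is Noetherian local). -/
def ringDim : ℕ := ((ringKrullDim R).unbotD 0).toNat

/-- The Krull dimension of (the support of) `M` as a natural number. It is finite for a finitely
generated module over a Noetherian local ring; the zero module is given the value `0`. -/
def dim : ℕ := ((Module.supportDim R M).unbotD 0).toNat

/-- The minimal number of generators `μ(M)` of a finitely generated module. -/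
def mu : ℕ := (⊤ : Submodule R M).spanFinrank

/-- `Ext^n_R(M, N) = 0`. -/
def ExtVanishes (n : ℕ) : Prop :=
  Subsingleton (Ext (ModuleCat.of R M) (ModuleCat.of R N) n)

/-- `Tor_n^R(M, N) = 0`. -/
def TorVanishes (n : ℕ) : Prop :=
  Limits.IsZero (((Tor (ModuleCat.{u} R) n).obj (ModuleCat.of R M)).obj (ModuleCat.of R N))

/-- `M` has finite projective dimension. -/
def FinitePd : Prop := projectiveDimension (ModuleCat.of R M) < ⊤

/-- `M` has finite injective dimension. -/
def FiniteId : Prop := injectiveDimension (ModuleCat.of R M) < ⊤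

variable [IsLocalRing R]

/-- The `n`th Betti number `β_n(M) = μ(Ext^n(M, k))`, where `k` is the residue field. -/
def betti (n : ℕ) : ℕ :=
  mu R (Ext (ModuleCat.of R M) (ModuleCat.of R (ResidueField R)) n)

/-- The `n`th Bass number `μ^n(M) = μ(Ext^n(k, M))`, where `k` is the residue field. -/
def bass (n : ℕ) : ℕ :=
  mu R (Ext (ModuleCat.of R (ResidueField R)) (ModuleCat.of R M) n)

/-- The depth of `M`: the supremum of the lengths of the `M`-regular sequences in the maximal
ideal. -/
def depth : ℕ∞ :=
  ⨆ (rs : List R) (_ : (∀ x ∈ rs, x ∈ maximalIdeal R) ∧ RingTheory.Sequence.IsRegular M rs),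
    (rs.length : ℕ∞)

/-- `M` is Cohen-Macaulay: it is zero, or its depth equals its dimension. -/
def IsCM : Prop := Subsingleton M ∨ ((depth R M : ℕ∞) : WithBot ℕ∞) = Module.supportDim R M

/-- The type of `M`: the Bass number `μ^t(M)` with `t = depth M`. -/
def type : ℕ := bass R M (depth R M).toNat

/-- The Hilbert-Samuel multiplicity `e(M) = lim_n r! λ(M / 𝔪ⁿ M) / nʳ` with `r = dim M`
(the limit exists for every finitely generated module over a Noetherian local ring). -/
def mult : ℝ :=
  limUnder atTop fun n : ℕ =>
    ((dim R M)! : ℝ) *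
      ((Module.length R (M ⧸ ((maximalIdeal R) ^ n • (⊤ : Submodule R M)))).toNat : ℝ) /
        (n : ℝ) ^ dim R M

/-- The sum `∑_{i=0}^s (s choose i) μ^{j+i}(M)`. -/
def bassSum (s j : ℕ) : ℕ := ∑ i ∈ Finset.range (s + 1), s.choose i * bass R M (j + i)

end

end LocalModule

open LocalModule

/-! Suppose first that `M = L` has finite length, and let `b n` be the Betti numbers of `N`. If
`Tor_{n+1}(L, N) = 0`, then `L ⊗ K` embeds in `L ⊗ F`, where `K` is the `(n+1)`-st syzygy of `N` in
the minimal free module `F` of rank `b n`. By minimality the image lies in `(𝔪L)^{b n}`, while `L ⊗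
K` needs `μ(L) b (n+1)` generators, so `μ(L) b (n+1) ≤ (λ(L) - μ(L)) b n`. When `λ(L) < 2 μ(L)` the
sequence `b` decreases strictly until it vanishes, which takes at most `b j` steps from `j`; this is
the length of the window. The same count with Bass numbers is `mu_mul_bass_succ_le`, and the one
with the socle of `L` in place of `L/𝔪L` is `bass_mul_betti_succ_le`.

For a Cohen-Macaulay `M` one would like to divide by a superficial sequence, which may not exist
over a finite residue field. The substitute stays over `R`. A polynomial `f` whose coefficients
generate `𝔪` acts on `M[X]/gM[X] ≅ M^D` for `g` monic of degree `D`, and for a suitable `g` it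
behaves like a superficial element (`exists_superficial_endomorphism`): McCoy's theorem gives this
on `M[X]`, and `g` is chosen prime to the torsion of the `𝔪`-adic filtration of `M[X]/fM[X]`. The
cokernel has as many generators as `M^D`, dimension lower by at least one, Bass numbers shifted by
one, and a Hilbert function that is the difference of that of `M^D`. After `dim M` such steps
(`exists_isReduction`) there is an `L` of finite length with `λ(L) = D e(M)`, `μ(L) = D μ(M)` and
socle dimension `D type(M)`, for some `D > 0`. The hypothesis on `e(M)` therefore passes to `L`, and
each cokernel costs one degree of vanishing.

One zero Betti number bounds the projective dimension. One zero Bass number does not suffice in the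
same way. If `N` is Cohen-Macaulay, divide it by a maximal regular sequence: over a target of finite
length, one zero Bass number kills the whole functor `Ext^n(-, N)` on finitely generated modules
(`extVanishes_of_bass_eq_zero`), and the division turns Bass numbers into binomial sums. If `R` is
Cohen-Macaulay, `R` modulo a maximal regular sequence is a nonzero module of finite length with
`Ext^n` into `N` zero for `n > d`, and it propagates the zero to all later Bass numbers. -/

namespace LocalModule
section

open IsLocalRing Polynomial

/-! ### Consequences of the Artin-Rees lemma for adic filtrations. -/

section Filtrations

variable {R : Type*} [CommRing R] {M : Type*} [AddCommGroup M] [Module R M]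

lemma smul_top_pi {ι : Type*} [Finite ι] (I : Ideal R) (x : ι → M) :
    x ∈ (I • ⊤ : Submodule R (ι → M)) ↔ ∀ i, x i ∈ (I • ⊤ : Submodule R M) := by
  classical
  cases nonempty_fintype ι
  constructor
  · intro hx i
    have := Submodule.mem_map_of_mem (f := LinearMap.proj (R := R) (φ := fun _ : ι => M) i) hx
    rw [Submodule.map_smul''] at this
    exact Submodule.smul_mono le_rfl le_top this
  · intro h
    rw [← Finset.univ_sum_single x]
    refine Submodule.sum_mem _ fun i _ => ?_
    have := Submodule.mem_map_of_mem (f := LinearMap.single R (fun _ : ι => M) i) (h i)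
    rw [Submodule.map_smul''] at this
    exact Submodule.smul_mono le_rfl le_top this

/-- Elements multiplied by `I` into `I ^ (n + 1) M` lie in `I ^ n M` for large `n`, if no nonzero
element is killed by `I`. -/
lemma exists_forall_mem_pow_smul_of_smul_mem [IsNoetherianRing R] [Module.Finite R M]
    (I : Ideal R) (hI : ∀ u : M, (∀ a ∈ I, a • u = 0) → u = 0) :
    ∃ c, ∀ n ≥ c, ∀ u : M, (∀ a ∈ I, a • u ∈ (I ^ (n + 1) • ⊤ : Submodule R M)) →
      u ∈ (I ^ n • ⊤ : Submodule R M) := by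
  obtain ⟨s, hs⟩ := (isNoetherianRing_iff_ideal_fg R).1 ‹_› I
  let ι : M →ₗ[R] (s → M) := LinearMap.pi fun a => a.1 • LinearMap.id
  have hι : ∀ u n, (∀ a ∈ I, a • u ∈ (I ^ n • ⊤ : Submodule R M)) ↔
      ι u ∈ (I ^ n • ⊤ : Submodule R (s → M)) := by
    intro u n
    rw [smul_top_pi]
    constructor
    · intro h a
      exact h a (hs ▸ Submodule.subset_span a.2)
    · intro h
      have : I ≤ (I ^ n • ⊤ : Submodule R M).comap (LinearMap.toSpanSingleton R M u) := by
        refine hs.symm.le.trans (Submodule.span_le.2 fun a ha => ?_)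
        exact h ⟨a, ha⟩
      exact fun a ha => by simpa using this ha
  have hinj : Function.Injective ι := by
    rw [← LinearMap.ker_eq_bot, LinearMap.ker_eq_bot']
    intro u hu
    refine hI u fun a ha => ?_
    have : I ≤ LinearMap.ker (LinearMap.toSpanSingleton R M u) := by
      rw [← hs]
      refine Submodule.span_le.2 fun a ha => ?_
      exact congr_fun hu ⟨a, ha⟩
    simpa using this ha
  -- `ι` embeds `M` in a power of itself through the generators of `I`. The trace of the `I`-adic
  -- filtration on `ι M` is stable by Artin-Rees, so for large `n` its `(n+1)`-st term is `I • K n`,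
  -- and `I • K n ≤ I ^ n M` by the definition of `K`.
  let K : ℕ → Submodule R M := fun n => (I ^ n • ⊤ : Submodule R (s → M)).comap ι
  let F : I.Filtration (s → M) :=
    { N := fun n => (K n).map ι
      mono := fun n => Submodule.map_mono (Submodule.comap_mono
        (Submodule.smul_mono_left (Ideal.pow_le_pow_right n.le_succ)))
      smul_le := fun n => by
        rw [← Submodule.map_smul'']
        refine Submodule.map_mono (Submodule.smul_le.2 fun r hr x hx => ?_)
        simp only [K, Submodule.mem_comap, map_smul] at hx ⊢
        rw [pow_succ', mul_smul]
        exact Submodule.smul_mem_smul hr hx }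
  have hF : F ≤ I.stableFiltration ⊤ := by
    intro n
    exact Submodule.map_comap_le _ _
  obtain ⟨c, hc⟩ := (Ideal.stableFiltration_stable I (⊤ : Submodule R (s → M))).of_le hF
  refine ⟨c, fun n hn u hu => ?_⟩
  have h1 : ι u ∈ F.N (n + 1) := Submodule.mem_map_of_mem ((hι _ _).1 hu)
  rw [← hc n hn] at h1
  change ι u ∈ I • (K n).map ι at h1
  rw [← Submodule.map_smul'', Submodule.mem_map] at h1
  obtain ⟨v, hv, hvu⟩ := h1
  rw [← hinj hvu]
  have : I • K n ≤ I ^ n • ⊤ := Submodule.smul_le.2 fun r hr x hx => (hι x n).2 hx r hr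
  exact this hv

/-- A prime filtration statement: one element outside the prime `I` controls the torsion of all
the quotients `I ^ n Q / I ^ (n + 1) Q`. -/
lemma exists_notMem_forall_smul_mem [IsNoetherianRing R] [Module.Finite R M]
    (I : Ideal R) [hI : I.IsPrime] :
    ∃ h ∉ I, ∀ g ∉ I, ∀ n, ∀ w ∈ (I ^ n • ⊤ : Submodule R M),
      g • w ∈ (I ^ (n + 1) • ⊤ : Submodule R M) → h • w ∈ (I ^ (n + 1) • ⊤ : Submodule R M) := by
  -- `T n` is the part of `I ^ n M` that is torsion modulo `I ^ (n + 1) M`, with respect to the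
  -- complement of the prime. It is again an `I`-filtration, hence stable.
  let T : ℕ → Submodule R M := fun n =>
    { carrier := {w | w ∈ (I ^ n • ⊤ : Submodule R M) ∧ ∃ g ∉ I,
        g • w ∈ (I ^ (n + 1) • ⊤ : Submodule R M)}
      zero_mem' := ⟨zero_mem _, 1, hI.one_notMem, by simp⟩
      add_mem' := by
        rintro a b ⟨ha, g, hg, hga⟩ ⟨hb, g', hg', hgb⟩
        refine ⟨add_mem ha hb, g * g', hI.mul_notMem hg hg', ?_⟩
        rw [smul_add, mul_smul g g' b, mul_comm, mul_smul]
        exact add_mem (Submodule.smul_mem _ _ hga) (Submodule.smul_mem _ _ hgb)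
      smul_mem' := by
        rintro r a ⟨ha, g, hg, hga⟩
        exact ⟨Submodule.smul_mem _ _ ha, g, hg, by
          rw [smul_comm]; exact Submodule.smul_mem _ _ hga⟩ }
  let F : I.Filtration M :=
    { N := T
      mono := by
        rintro n w ⟨hw, g, hg, hgw⟩
        exact ⟨Submodule.smul_mono_left (Ideal.pow_le_pow_right n.le_succ) hw, 1, hI.one_notMem, by
          simpa using hw⟩
      smul_le := by
        intro n
        refine Submodule.smul_le.2 ?_
        rintro r hr w ⟨hw, g, hg, hgw⟩
        refine ⟨?_, g, hg, ?_⟩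
        · rw [pow_succ', mul_smul]
          exact Submodule.smul_mem_smul hr hw
        · rw [smul_comm, pow_succ', mul_smul]
          exact Submodule.smul_mem_smul hr hgw }
  have hF : F ≤ I.stableFiltration ⊤ := fun n w hw => hw.1
  obtain ⟨c, hc⟩ := (Ideal.stableFiltration_stable I (⊤ : Submodule R M)).of_le hF
  classical
  have key : ∀ n, ∃ h ∉ I, ∀ w ∈ T n, h • w ∈ (I ^ (n + 1) • ⊤ : Submodule R M) := by
    intro n
    obtain ⟨s, hs⟩ := IsNoetherian.noetherian (T n)
    have : ∀ w : s, ∃ g ∉ I, g • w.1 ∈ (I ^ (n + 1) • ⊤ : Submodule R M) := fun w =>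
      (show w.1 ∈ T n from hs ▸ Submodule.subset_span w.2).2
    choose g hg hgw using this
    refine ⟨∏ w, g w, fun hmem => ?_, fun w hw => ?_⟩
    · obtain ⟨w, -, hw⟩ := (hI.prod_mem_iff).1 hmem
      exact hg w hw
    · have : T n ≤ (I ^ (n + 1) • ⊤ : Submodule R M).comap (LinearMap.lsmul R M (∏ w, g w)) := by
        rw [← hs]
        refine Submodule.span_le.2 fun a ha => ?_
        simp only [SetLike.mem_coe, Submodule.mem_comap, LinearMap.lsmul_apply]
        rw [← Finset.prod_erase_mul _ _ (Finset.mem_univ ⟨a, ha⟩), mul_smul]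
        exact Submodule.smul_mem _ _ (hgw ⟨a, ha⟩)
      exact this hw
  choose h hh hhw using key
  -- From `c` on, `T (n + 1) = I • T n`, so an element that annihilates the torsion in degree `c`
  -- does so in all later degrees. The product over `i ≤ c` also covers the earlier ones.
  have hle : ∀ n, ∀ w ∈ T (c + n), (∏ i ∈ Finset.range (c + 1), h i) • w ∈
      (I ^ (c + n + 1) • ⊤ : Submodule R M) := by
    intro n
    induction n with
    | zero =>
      intro w hw
      rw [Finset.prod_range_succ, mul_smul]
      exact Submodule.smul_mem _ _ (hhw c w hw)
    | succ n ih =>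
      intro w hw
      have : I • T (c + n) = T (c + n + 1) := hc (c + n) (Nat.le_add_right _ _)
      rw [← add_assoc, ← this] at hw
      refine Submodule.smul_induction_on hw (fun r hr x hx => ?_) fun x y hx hy => ?_
      · rw [smul_comm, ← add_assoc, pow_succ' _ (c + n + 1), mul_smul]
        exact Submodule.smul_mem_smul hr (ih x hx)
      · rw [smul_add]; exact add_mem hx hy
  refine ⟨∏ i ∈ Finset.range (c + 1), h i, fun hmem => ?_, fun g hg n w hw hgw => ?_⟩
  · obtain ⟨i, -, hi⟩ := (hI.prod_mem_iff).1 hmem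
    exact hh i hi
  · rcases le_total n c with hn | hn
    · rw [← Finset.prod_erase_mul _ _ (Finset.mem_range.2 (Nat.lt_succ_of_le hn)), mul_smul]
      exact Submodule.smul_mem _ _ (hhw n w ⟨hw, g, hg, hgw⟩)
    · obtain ⟨k, rfl⟩ := Nat.exists_eq_add_of_le hn
      exact hle k w ⟨hw, g, hg, hgw⟩

/-- An element generating the unit ideal together with a torsion bound, modulo the prime, is a
nonzerodivisor on every `Q / I ^ n Q`. -/
lemma mem_pow_smul_of_smul_mem {I : Ideal R} {h g α β : R}
    (hh : ∀ n, ∀ w ∈ (I ^ n • ⊤ : Submodule R M),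
      g • w ∈ (I ^ (n + 1) • ⊤ : Submodule R M) → h • w ∈ (I ^ (n + 1) • ⊤ : Submodule R M))
    (hgh : α * g + β * h - 1 ∈ I) (n : ℕ) (w : M) (hw : g • w ∈ (I ^ n • ⊤ : Submodule R M)) :
    w ∈ (I ^ n • ⊤ : Submodule R M) := by
  -- `w` climbs the filtration one step at a time: if it is in `I ^ k M`, then `g w` and hence `h w`
  -- are in the next step, and `g`, `h` are comaximal modulo `I`.
  suffices ∀ k ≤ n, w ∈ (I ^ k • ⊤ : Submodule R M) from this n le_rfl
  intro k
  induction k with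
  | zero => simp
  | succ k ih =>
    intro hk
    have hwk := ih (Nat.le_of_succ_le hk)
    have hgw : g • w ∈ (I ^ (k + 1) • ⊤ : Submodule R M) :=
      Submodule.smul_mono_left (Ideal.pow_le_pow_right hk) hw
    have hhw := hh k w hwk hgw
    have h1 : (α * g + β * h - 1) • w ∈ (I ^ (k + 1) • ⊤ : Submodule R M) := by
      rw [pow_succ', mul_smul]
      exact Submodule.smul_mem_smul hgh hwk
    have : w = α • g • w + β • h • w - (α * g + β * h - 1) • w := by
      simp only [sub_smul, add_smul, mul_smul, one_smul]; abel
    rw [this]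
    exact sub_mem (add_mem (Submodule.smul_mem _ _ hgw) (Submodule.smul_mem _ _ hhw)) h1

end Filtrations

/-! ### McCoy's theorem for the adic filtration of `M[X]`. -/

section McCoy

variable {R : Type*} [CommRing R] {M : Type*} [AddCommGroup M] [Module R M]

lemma mem_map_C_smul_top_iff (J : Ideal R) (x : PolynomialModule R M) :
    x ∈ (J.map C • ⊤ : Submodule R[X] (PolynomialModule R M)) ↔
      ∀ i, x.coeff i ∈ (J • ⊤ : Submodule R M) := by
  constructor
  · intro hx
    refine Submodule.smul_induction_on hx (fun r hr y _ i => ?_) fun y z hy hz i => ?_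
    · rw [PolynomialModule.smul_apply]
      exact Submodule.sum_mem _ fun p _ =>
        Submodule.smul_mem_smul (Ideal.mem_map_C_iff.1 hr _) trivial
    · exact add_mem (hy i) (hz i)
  · intro h
    have hx : x = ∑ i ∈ x.coeff.support, PolynomialModule.single R i (x.coeff i) := by
      apply PolynomialModule.coeff_injective
      rw [PolynomialModule.coeff_sum]
      exact (Finsupp.sum_single x.coeff).symm
    rw [hx]
    refine Submodule.sum_mem _ fun i _ => ?_
    refine Submodule.smul_induction_on (h i) (fun r hr y _ => ?_) fun y z hy hz => ?_
    · have : PolynomialModule.single R i (r • y) = (C r : R[X]) • PolynomialModule.single R i y := by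
        rw [← monomial_zero_left, PolynomialModule.monomial_smul_single, zero_add]
      rw [this]
      exact Submodule.smul_mem_smul (Ideal.mem_map_of_mem _ hr) trivial
    · rw [PolynomialModule.single_add]; exact add_mem hy hz

/-- A graded form of McCoy's theorem: a polynomial whose coefficients generate `I` raises the
`I`-adic order of every polynomial over `M` by exactly one, in large orders. -/
lemma mem_pow_smul_of_poly_smul_mem {I : Ideal R} {c : ℕ}
    (hc : ∀ n ≥ c, ∀ u : M, (∀ a ∈ I, a • u ∈ (I ^ (n + 1) • ⊤ : Submodule R M)) →
      u ∈ (I ^ n • ⊤ : Submodule R M))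
    {f : R[X]} (hf : Ideal.span (Set.range f.coeff) = I) {n : ℕ} (hn : c ≤ n)
    (u : PolynomialModule R M)
    (hu : f • u ∈ ((I ^ (n + 1)).map C • ⊤ : Submodule R[X] (PolynomialModule R M))) :
    u ∈ ((I ^ n).map C • ⊤ : Submodule R[X] (PolynomialModule R M)) := by
  have hfI : ∀ i, f.coeff i ∈ I := fun i => hf ▸ Ideal.subset_span ⟨i, rfl⟩
  suffices H : ∀ N n, c ≤ n → ∀ u : PolynomialModule R M, (∀ j ≥ N, u.coeff j = 0) →
      f • u ∈ ((I ^ (n + 1)).map C • ⊤ : Submodule R[X] (PolynomialModule R M)) →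
      u ∈ ((I ^ n).map C • ⊤ : Submodule R[X] (PolynomialModule R M)) by
    refine H (u.coeff.support.sup id + 1) n hn u (fun j hj => ?_) hu
    by_contra hne
    have := Finset.le_sup (f := id) (Finsupp.mem_support_iff.2 hne)
    simp only [id] at this
    omega
  -- Induction on a degree bound for `u`, with `n` free: the inductive hypothesis is applied one
  -- adic order higher.
  intro N
  induction N with
  | zero =>
    intro n _ u hu _
    have : u = 0 := PolynomialModule.coeff_injective (Finsupp.ext fun j => hu j (Nat.zero_le _))
    rw [this]; exact zero_mem _
  | succ N ih =>
    intro n hn u hu hfu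
    have hfu' := (mem_map_C_smul_top_iff _ _).1 hfu
    -- All products `f.coeff i • u.coeff j` lie in `I ^ (n + 1) M`. The inner induction descends on
    -- `i` from above the degree of `f`; `k` measures the descent.
    have key : ∀ k i, f.natDegree < i + k → ∀ j,
        f.coeff i • u.coeff j ∈ (I ^ (n + 1) • ⊤ : Submodule R M) := by
      intro k
      induction k with
      | zero =>
        intro i hi j
        rw [coeff_eq_zero_of_natDegree_lt (by simpa using hi), zero_smul]
        exact zero_mem _
      | succ k ihk =>
        intro i hi
        -- In the coefficient of `f • u` at `i + N`, terms with first index below `i` meet a zero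
        -- coefficient of `u`, and those above `i` are covered by `ihk`.
        have htop : f.coeff i • u.coeff N ∈ (I ^ (n + 1) • ⊤ : Submodule R M) := by
          have h1 := hfu' (i + N)
          rw [PolynomialModule.smul_apply, ← Finset.add_sum_erase _ _
            (show (i, N) ∈ Finset.HasAntidiagonal.antidiagonal (i + N) from
              Finset.HasAntidiagonal.mem_antidiagonal.2 rfl)] at h1
          refine (Submodule.add_mem_iff_left _ (Submodule.sum_mem _ fun p hp => ?_)).1 h1
          rw [Finset.mem_erase, Finset.HasAntidiagonal.mem_antidiagonal] at hp
          rcases lt_trichotomy p.1 i with h | h | h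
          · rw [hu p.2 (by omega), smul_zero]; exact zero_mem _
          · exact absurd (Prod.ext h (by have := hp.2; simp only; omega)) hp.1
          · exact ihk p.1 (by omega) p.2
        -- Remove the top term of `u` and multiply by `f.coeff i`: the degree bound drops, and `f`
        -- times the result lies in `I ^ (n + 2)`, since `f.coeff i` and the coefficients of `f`
        -- each supply one more factor from `I`.
        have h2 : (C (f.coeff i) : R[X]) • (u - PolynomialModule.single R N (u.coeff N)) ∈
            ((I ^ (n + 1)).map C • ⊤ : Submodule R[X] (PolynomialModule R M)) := by
          refine ih (n + 1) (hn.trans n.le_succ) _ (fun j hj => ?_) ?_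
          · rw [← monomial_zero_left, PolynomialModule.monomial_smul_apply]
            simp only [zero_le, if_true, Nat.sub_zero]
            rcases hj.lt_or_eq with h | h
            · have : (u - PolynomialModule.single R N (u.coeff N)).coeff j =
                u.coeff j - (Finsupp.single N (u.coeff N)) j := rfl
              rw [this, hu j h, Finsupp.single_eq_of_ne (by omega)]; simp
            · have : (u - PolynomialModule.single R N (u.coeff N)).coeff j =
                u.coeff j - (Finsupp.single N (u.coeff N)) j := rfl
              rw [this, ← h]; simp
          · have e : f • (C (f.coeff i) : R[X]) • (u - PolynomialModule.single R N (u.coeff N)) =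
                (C (f.coeff i) : R[X]) • f • u -
                  f • PolynomialModule.single R N (f.coeff i • u.coeff N) := by
              have : PolynomialModule.single R N (f.coeff i • u.coeff N) =
                  (C (f.coeff i) : R[X]) • PolynomialModule.single R N (u.coeff N) := by
                rw [← monomial_zero_left, PolynomialModule.monomial_smul_single, zero_add]
              rw [this, smul_comm f, smul_sub, smul_sub, smul_comm f (C (f.coeff i))
                (PolynomialModule.single R N (u.coeff N))]
            rw [e, mem_map_C_smul_top_iff]
            intro j
            refine sub_mem (?_ : ((C (f.coeff i) : R[X]) • f • u).coeff j ∈ _)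
              (?_ : (f • PolynomialModule.single R N (f.coeff i • u.coeff N)).coeff j ∈ _)
            · rw [← monomial_zero_left, PolynomialModule.monomial_smul_apply]
              simp only [zero_le, if_true, Nat.sub_zero]
              rw [pow_succ', mul_smul]
              exact Submodule.smul_mem_smul (hfI i) (hfu' j)
            · rw [PolynomialModule.smul_single_apply]
              split_ifs
              · rw [pow_succ', mul_smul]
                exact Submodule.smul_mem_smul (hfI _) htop
              · exact zero_mem _
        intro j
        by_cases hj : j = N
        · rw [hj]; exact htop
        · have h3 := (mem_map_C_smul_top_iff _ _).1 h2 j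
          rw [← monomial_zero_left, PolynomialModule.monomial_smul_apply] at h3
          simp only [zero_le, if_true, Nat.sub_zero] at h3
          have : (u - PolynomialModule.single R N (u.coeff N)).coeff j =
                u.coeff j - (Finsupp.single N (u.coeff N)) j := rfl
          rw [this, Finsupp.single_eq_of_ne hj, sub_zero] at h3
          exact h3
    rw [mem_map_C_smul_top_iff]
    intro j
    refine hc n hn _ fun a ha => ?_
    have : I ≤ (I ^ (n + 1) • ⊤ : Submodule R M).comap
        (LinearMap.toSpanSingleton R M (u.coeff j)) := by
      refine hf.symm.le.trans (Ideal.span_le.2 ?_)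
      rintro _ ⟨i, rfl⟩
      exact key (f.natDegree + 1) i (by omega) j
    exact this ha

end McCoy

end
end LocalModule

namespace LocalModule
section

open IsLocalRing Polynomial TensorProduct

/-! ### Superficial endomorphisms of powers of `M`. -/

section Step

variable {R : Type*} [CommRing R] {M : Type*} [AddCommGroup M] [Module R M]

lemma mk_mem_smul_top_iff {S P : Type*} [CommRing S] [AddCommGroup P] [Module S P] (J : Ideal S)
    (W : Submodule S P) (x : P) :
    W.mkQ x ∈ (J • ⊤ : Submodule S (P ⧸ W)) ↔ ∃ z ∈ (J • ⊤ : Submodule S P), x - z ∈ W := by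
  have : (J • ⊤ : Submodule S (P ⧸ W)) = (J • ⊤ : Submodule S P).map W.mkQ := by
    rw [Submodule.map_smul'', Submodule.map_top, Submodule.range_mkQ]
  rw [this]
  constructor
  · rintro ⟨z, hz, hzx⟩
    exact ⟨z, hz, (Submodule.Quotient.eq W).1 hzx.symm⟩
  · rintro ⟨z, hz, hzx⟩
    exact ⟨z, hz, ((Submodule.Quotient.eq W).2 hzx).symm⟩

lemma exists_poly_span_range_coeff {I : Ideal R} (hI : I.FG) :
    ∃ f : R[X], Ideal.span (Set.range f.coeff) = I := by
  obtain ⟨n, s, hs⟩ := Submodule.fg_iff_exists_fin_generating_family.1 hI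
  have hco : ∀ j, (∑ i : Fin n, monomial (i : ℕ) (s i)).coeff j =
      if h : j < n then s ⟨j, h⟩ else 0 := by
    intro j
    rw [finsetSum_coeff]
    simp only [coeff_monomial]
    split_ifs with h
    · rw [Finset.sum_eq_single ⟨j, h⟩]
      · simp
      · intro b _ hb
        rw [if_neg]
        rintro rfl
        exact hb rfl
      · simp
    · refine Finset.sum_eq_zero fun i _ => if_neg ?_
      have := i.2
      omega
  refine ⟨∑ i : Fin n, monomial (i : ℕ) (s i), le_antisymm (Ideal.span_le.2 ?_) ?_⟩
  · rintro _ ⟨j, rfl⟩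
    rw [hco]
    split_ifs
    · exact hs ▸ Submodule.subset_span ⟨_, rfl⟩
    · exact zero_mem _
  · rw [← hs]
    refine Submodule.span_le.2 ?_
    rintro _ ⟨i, rfl⟩
    refine Ideal.subset_span ⟨i, ?_⟩
    rw [hco, dif_pos i.2]

lemma map_C_pow (I : Ideal R) (n : ℕ) : (I.map (C : R →+* R[X])) ^ n = (I ^ n).map C :=
  (Ideal.map_pow C I n).symm

/-- A monic polynomial of positive degree comaximal with a given polynomial modulo `I`. -/
lemma exists_monic_comaximal {I : Ideal R} [hI : I.IsMaximal] {h : R[X]}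
    (hh : h ∉ I.map (C : R →+* R[X])) :
    ∃ g : R[X], g.Monic ∧ 0 < g.natDegree ∧ g ∉ I.map (C : R →+* R[X]) ∧
      ∃ α β : R[X], α * g + β * h - 1 ∈ I.map (C : R →+* R[X]) := by
  let k := R ⧸ I
  let _ : Field k := Ideal.Quotient.field I
  let q : R →+* k := Ideal.Quotient.mk I
  have hmem : ∀ p : R[X], p ∈ I.map (C : R →+* R[X]) ↔ p.map q = 0 := by
    intro p
    rw [Ideal.mem_map_C_iff, Polynomial.ext_iff]
    simp only [coeff_map, coeff_zero, q]
    exact forall_congr' fun n => Ideal.Quotient.eq_zero_iff_mem.symm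
  have hne : h.map q ≠ 0 := fun h0 => hh ((hmem h).2 h0)
  obtain ⟨c, hc⟩ := Ideal.Quotient.mk_surjective (I := I) (h.map q).leadingCoeff⁻¹
  have hlc : (h.map q).leadingCoeff ≠ 0 := leadingCoeff_ne_zero.2 hne
  have hmonic : (C (h.map q).leadingCoeff⁻¹ * h.map q).Monic := by
    rw [Monic, leadingCoeff_mul, leadingCoeff_C, inv_mul_cancel₀ hlc]
  have hm2 : (X * (C (h.map q).leadingCoeff⁻¹ * h.map q)).Monic := monic_X.mul hmonic
  have hdeg : 0 < (X * (C (h.map q).leadingCoeff⁻¹ * h.map q)).natDegree := by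
    rw [monic_X.natDegree_mul hmonic, natDegree_X]; omega
  -- One plus a multiple of `h` is comaximal with `h`. The factor `X` makes the degree positive even
  -- when `h` is constant modulo `I`, so the power `D` in `M^D` will be nonzero.
  have hm3 : (X * (C (h.map q).leadingCoeff⁻¹ * h.map q) + 1).Monic := by
    refine hm2.add_of_left ?_
    rw [degree_one]
    exact natDegree_pos_iff_degree_pos.1 hdeg
  have hdeg3 : 0 < (X * (C (h.map q).leadingCoeff⁻¹ * h.map q) + 1).natDegree := by
    rw [← C_1, natDegree_add_C]; exact hdeg
  obtain ⟨g, hg, hgd, hgm⟩ := lifts_and_natDegree_eq_and_monic (f := q)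
    ((mem_lifts _).2 (map_surjective q Ideal.Quotient.mk_surjective _)) hm3
  refine ⟨g, hgm, hgd ▸ hdeg3, fun hmem' => ?_, 1, - X * C c, ?_⟩
  · rw [hmem, hg] at hmem'
    exact hm3.ne_zero hmem'
  · rw [hmem]
    simp only [Polynomial.map_sub, Polynomial.map_add, Polynomial.map_mul, Polynomial.map_one, hg,
      Polynomial.map_neg, map_X, map_C]
    rw [show q c = (h.map q).leadingCoeff⁻¹ from hc]
    ring

/-- `M[X] / g M[X]` is a direct sum of copies of `M`, for `g` monic. -/
lemma nonempty_equiv_polynomialModule_quotient (M : Type*) [AddCommGroup M] [Module R M] {g : R[X]}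
    (hg : g.Monic) :
    Nonempty ((PolynomialModule R M ⧸
      (Ideal.span {g} • ⊤ : Submodule R[X] (PolynomialModule R M))) ≃ₗ[R]
        (Fin g.natDegree → M)) := by
  let e1 : (PolynomialModule R M ⧸ (Ideal.span {g} • ⊤ : Submodule R[X] (PolynomialModule R M)))
      ≃ₗ[R[X]] (R[X] ⧸ Ideal.span {g}) ⊗[R[X]] PolynomialModule R M :=
    (TensorProduct.quotTensorEquivQuotSMul (PolynomialModule R M) (Ideal.span {g})).symm
  let e2 : (R[X] ⧸ Ideal.span {g}) ⊗[R[X]] PolynomialModule R M ≃ₗ[R[X]]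
      (R[X] ⧸ Ideal.span {g}) ⊗[R[X]] (R[X] ⊗[R] M) :=
    TensorProduct.congr (LinearEquiv.refl _ _)
      (PolynomialModule.polynomialTensorProductLEquivPolynomialModule R M).symm
  let e3 : (R[X] ⧸ Ideal.span {g}) ⊗[R[X]] (R[X] ⊗[R] M) ≃ₗ[R[X]]
      (R[X] ⧸ Ideal.span {g}) ⊗[R] M :=
    TensorProduct.AlgebraTensorModule.cancelBaseChange R R[X] R[X] (R[X] ⧸ Ideal.span {g}) M
  let b : AdjoinRoot g ≃ₗ[R] (Fin g.natDegree → R) := (AdjoinRoot.powerBasis' hg).basis.equivFun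
  let e4 : (R[X] ⧸ Ideal.span {g}) ⊗[R] M ≃ₗ[R] (Fin g.natDegree → R) ⊗[R] M :=
    TensorProduct.congr b (LinearEquiv.refl _ _)
  let e5 : (Fin g.natDegree → R) ⊗[R] M ≃ₗ[R] (Fin g.natDegree → M) :=
    TensorProduct.comm _ _ _ ≪≫ₗ TensorProduct.piScalarRight R R M (Fin g.natDegree)
  exact ⟨((e1 ≪≫ₗ e2 ≪≫ₗ e3).restrictScalars R) ≪≫ₗ e4 ≪≫ₗ e5⟩

/-- Transport multiplication by `f` along `e`. An element of the kernel lies in every `I ^ n M` by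
`key`, so it vanishes by the intersection hypothesis; membership in `I • End` comes from `f` being
in the extension of `I`. -/
lemma superficial_endomorphism_of_equiv {S P : Type*} [CommRing S] [Algebra R S] [AddCommGroup P]
    [Module R P] [Module S P] [IsScalarTower R S P] (e : P ≃ₗ[R] M) {I : Ideal R} {c : ℕ}
    {f : S} (hf : f ∈ I.map (algebraMap R S)) (hkr : (⨅ n, I ^ n • ⊤ : Submodule R M) = ⊥)
    (key : ∀ n ≥ c, ∀ u : P, f • u ∈ ((I ^ (n + 1)).map (algebraMap R S) • ⊤ : Submodule S P) →
      u ∈ ((I ^ n).map (algebraMap R S) • ⊤ : Submodule S P)) :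
    ∃ φ : M →ₗ[R] M, Function.Injective φ ∧ φ ∈ (I • ⊤ : Submodule R (M →ₗ[R] M)) ∧
      ∃ c, ∀ n ≥ c, ∀ u, φ u ∈ (I ^ (n + 1) • ⊤ : Submodule R M) →
        u ∈ (I ^ n • ⊤ : Submodule R M) := by
  have hemem : ∀ n (u : P), e u ∈ (I ^ n • ⊤ : Submodule R M) ↔
      u ∈ ((I ^ n).map (algebraMap R S) • ⊤ : Submodule S P) := by
    intro n u
    have h1 : (I ^ n • ⊤ : Submodule R M) = (I ^ n • ⊤ : Submodule R P).map e.toLinearMap := by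
      rw [Submodule.map_smul'', Submodule.map_top, LinearEquiv.range]
    have h2 := Ideal.smul_restrictScalars (S := S) (I ^ n) (⊤ : Submodule S P)
    rw [Submodule.restrictScalars_top] at h2
    rw [h1, ← h2]
    exact ⟨fun ⟨v, hv, hvu⟩ => e.injective hvu ▸ hv, fun hu => ⟨u, hu, rfl⟩⟩
  let ψ : S →ₗ[R] (P →ₗ[R] P) := (Algebra.lsmul R R P).toLinearMap
  have hkey : ∀ n ≥ c, ∀ u, e.conj (ψ f) u ∈ (I ^ (n + 1) • ⊤ : Submodule R M) →
        u ∈ (I ^ n • ⊤ : Submodule R M) := by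
    intro n hn u hu
    rw [LinearEquiv.conj_apply_apply, hemem] at hu
    have := (hemem n _).2 (key n hn _ hu)
    rwa [LinearEquiv.apply_symm_apply] at this
  refine ⟨e.conj (ψ f), ?_, ?_, c, hkey⟩
  · rw [← LinearMap.ker_eq_bot, LinearMap.ker_eq_bot']
    intro u hu
    have : u ∈ (⨅ n, I ^ n • ⊤ : Submodule R M) := by
      rw [Submodule.mem_iInf]
      intro n
      refine Submodule.smul_mono_left (Ideal.pow_le_pow_right (le_max_left n c))
        (hkey (max n c) (le_max_right _ _) u ?_)
      rw [hu]; exact zero_mem _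
    rwa [hkr] at this
  · have hf' : f ∈ (I • ⊤ : Submodule R S) := by rw [Ideal.smul_top_eq_map]; exact hf
    have := Submodule.mem_map_of_mem (f := e.conj.toLinearMap ∘ₗ ψ) hf'
    rw [Submodule.map_smul''] at this
    exact Submodule.smul_mono le_rfl le_top this

/-- An injective endomorphism of a direct sum of copies of `M` behaving like a superficial
element. -/
lemma exists_superficial_endomorphism [IsNoetherianRing R] [Module.Finite R M]
    (I : Ideal R) [I.IsMaximal] (hkr : ∀ D : ℕ, (⨅ n, I ^ n • ⊤ : Submodule R (Fin D → M)) = ⊥)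
    (hM : ∀ u : M, (∀ a ∈ I, a • u = 0) → u = 0) :
    ∃ D > 0, ∃ φ : (Fin D → M) →ₗ[R] (Fin D → M), Function.Injective φ ∧
      φ ∈ (I • ⊤ : Submodule R ((Fin D → M) →ₗ[R] (Fin D → M))) ∧
      ∃ c, ∀ n ≥ c, ∀ u, φ u ∈ (I ^ (n + 1) • ⊤ : Submodule R (Fin D → M)) →
        u ∈ (I ^ n • ⊤ : Submodule R (Fin D → M)) := by
  obtain ⟨f, hf⟩ := exists_poly_span_range_coeff ((isNoetherianRing_iff_ideal_fg R).1 ‹_› I)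
  obtain ⟨c, hc⟩ := exists_forall_mem_pow_smul_of_smul_mem (M := M) I hM
  have hmc := fun n (hn : c ≤ n) => mem_pow_smul_of_poly_smul_mem hc hf hn
  have : Module.Finite R[X] (PolynomialModule R M) :=
    Module.Finite.equiv (PolynomialModule.polynomialTensorProductLEquivPolynomialModule R M)
  have hprime : (I.map (C : R →+* R[X])).IsPrime :=
    Ideal.isPrime_map_C_of_isPrime
  let Q := PolynomialModule R M ⧸ (Ideal.span {f} • ⊤ : Submodule R[X] (PolynomialModule R M))
  -- The obstruction `h` depends only on `f` and `M`, so `g` can be chosen afterwards, comaximal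
  -- with `h` modulo `I`. Then `g` is a nonzerodivisor on every `Q / I ^ n Q`.
  obtain ⟨h, hhI, hh⟩ := exists_notMem_forall_smul_mem (M := Q) (I.map (C : R →+* R[X]))
  obtain ⟨g, hgm, hgd, hgI, α, β, hαβ⟩ := exists_monic_comaximal hhI
  have hgQ := mem_pow_smul_of_smul_mem (M := Q) (hh g hgI) hαβ
  let P := PolynomialModule R M ⧸ (Ideal.span {g} • ⊤ : Submodule R[X] (PolynomialModule R M))
  have mem_span : ∀ (p : R[X]) (x : PolynomialModule R M),
      x ∈ (Ideal.span {p} • ⊤ : Submodule R[X] (PolynomialModule R M)) ↔ ∃ y, p • y = x := by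
    intro p x
    rw [Submodule.ideal_span_singleton_smul, Submodule.mem_smul_pointwise_iff_exists]
    simp
  -- Write `f u = z + g w` with `z` of order `n + 1`. Then `g w` has order `n + 1` in `Q`, hence so
  -- has `w`, say `w = z' + f w'`. Now `f (u - g w')` has order `n + 1` in `M[X]`, and McCoy applies
  -- to `u - g w'`, which represents the class of `u`.
  have key : ∀ n ≥ c, ∀ u : P, f • u ∈ ((I ^ (n + 1)).map C • ⊤ : Submodule R[X] P) →
      u ∈ ((I ^ n).map C • ⊤ : Submodule R[X] P) := by
    intro n hn u hu
    obtain ⟨u, rfl⟩ := Submodule.mkQ_surjective _ u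
    rw [← map_smul, mk_mem_smul_top_iff] at hu
    obtain ⟨z, hz, hzu⟩ := hu
    obtain ⟨w, hw⟩ := (mem_span _ _).1 hzu
    have h1 : g • (Submodule.mkQ (Ideal.span {f} • ⊤) w : Q) ∈
        ((I.map (C : R →+* R[X])) ^ (n + 1) • ⊤ : Submodule R[X] Q) := by
      rw [← map_smul, map_C_pow, mk_mem_smul_top_iff]
      refine ⟨-z, neg_mem hz, (mem_span _ _).2 ⟨u, ?_⟩⟩
      rw [hw]; abel
    have h2 := hgQ (n + 1) _ h1
    rw [map_C_pow, mk_mem_smul_top_iff] at h2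
    obtain ⟨z', hz', hzw⟩ := h2
    obtain ⟨w', hw'⟩ := (mem_span _ _).1 hzw
    have h3 := hmc n hn (u - g • w') (by
      have : f • (u - g • w') = z + g • z' := by
        rw [smul_sub, smul_comm f g, hw', smul_sub, hw]; abel
      rw [this]
      exact add_mem hz (Submodule.smul_mem _ _ hz'))
    rw [mk_mem_smul_top_iff]
    exact ⟨_, h3, (mem_span _ _).2 ⟨w', by abel⟩⟩
  obtain ⟨e⟩ := nonempty_equiv_polynomialModule_quotient M hgm
  exact ⟨g.natDegree, hgd, superficial_endomorphism_of_equiv e (f := f)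
    (by rw [algebraMap_eq, Ideal.mem_map_C_iff]; exact fun i => hf ▸ Ideal.subset_span ⟨i, rfl⟩)
    (hkr _) (by simpa only [algebraMap_eq] using key)⟩

end Step

end
end LocalModule

namespace LocalModule
section

open IsLocalRing

/-! ### Lengths and the residue field. -/

section Length

variable {R : Type*} [CommRing R] {M : Type*} [AddCommGroup M] [Module R M]

lemma length_eq_of_ker_eq_range {A B C : Type*} [AddCommGroup A] [Module R A] [AddCommGroup B]
    [Module R B] [AddCommGroup C] [Module R C] {f : A →ₗ[R] B} {g : B →ₗ[R] C}
    (hf : Function.Injective f) (hg : Function.Surjective g) (h : ∀ x, g x = 0 ↔ ∃ y, f y = x) :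
    Module.length R B = Module.length R A + Module.length R C :=
  Module.length_eq_add_of_exact f g hf hg fun x => h x

variable [IsLocalRing R]

instance isSimpleModule_residueField : IsSimpleModule R (ResidueField R) :=
  isSimpleModule_iff_quot_maximal.2
    ⟨maximalIdeal R, inferInstance, ⟨LinearEquiv.refl R (R ⧸ maximalIdeal R)⟩⟩

lemma length_pi_residueField (n : ℕ) :
    Module.length R (Fin n → ResidueField R) = n := by
  simp

lemma smul_residueField {a : R} (ha : a ∈ maximalIdeal R) (x : ResidueField R) : a • x = 0 := by
  rw [Algebra.smul_def, show algebraMap R (ResidueField R) a = 0 from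
    Ideal.Quotient.eq_zero_iff_mem.2 ha, zero_mul]

end Length

/-! ### Minimal generators, minimal covers and modules of finite length. -/

section Mu

variable {R : Type u} [CommRing R] {M N : Type u} [AddCommGroup M] [Module R M]
  [AddCommGroup N] [Module R N]

lemma mu_eq_zero_iff [Module.Finite R M] : mu R M = 0 ↔ Subsingleton M := by
  rw [mu, Submodule.spanFinrank_eq_zero_iff_eq_bot Module.Finite.fg_top, eq_comm,
    subsingleton_iff_bot_eq_top, Submodule.subsingleton_iff]

lemma mem_smul_top_pi_ring {n : ℕ} (I : Ideal R) (x : Fin n → R) :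
    x ∈ (I • ⊤ : Submodule R (Fin n → R)) ↔ ∀ i, x i ∈ I := by
  rw [smul_top_pi]; simp

end Mu

section MuU

variable {R : Type u} [CommRing R] [IsLocalRing R] {M N : Type u} [AddCommGroup M] [Module R M]
  [AddCommGroup N] [Module R N]

variable (R M) in
/-- A minimal presentation of a finitely generated module. -/
lemma exists_minimal_cover [Module.Finite R M] :
    ∃ π : (Fin (mu R M) → R) →ₗ[R] M, Function.Surjective π ∧
      ∀ x, π x = 0 → ∀ i, x i ∈ maximalIdeal R := by
  classical
  have hfg : (⊤ : Submodule R M).FG := Module.Finite.fg_top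
  have hfin := hfg.finite_generators
  have hcard : Nat.card (⊤ : Submodule R M).generators = mu R M := hfg.generators_ncard
  have := hfin.to_subtype
  let e : Fin (mu R M) ≃ (⊤ : Submodule R M).generators :=
    (Finite.equivFinOfCardEq hcard).symm
  let g : Fin (mu R M) → M := fun i => e i
  have hg : Submodule.span R (Set.range g) = ⊤ := by
    have : Set.range g = (⊤ : Submodule R M).generators := by
      rw [show g = Subtype.val ∘ e from rfl, Set.range_comp, e.range_eq_univ, Set.image_univ,
        Subtype.range_coe]
    rw [this, Submodule.span_generators]
  refine ⟨Fintype.linearCombination R g, ?_, fun x hx i => ?_⟩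
  · rw [← LinearMap.range_eq_top, Fintype.range_linearCombination, hg]
  -- A unit coefficient in a relation makes the generator `g i` redundant, contradicting the
  -- minimality of their number.
  · by_contra hi
    rw [mem_maximalIdeal, mem_nonunits_iff, not_not] at hi
    rw [Fintype.linearCombination_apply, ← Finset.add_sum_erase _ _ (Finset.mem_univ i)] at hx
    have hmem : g i ∈ Submodule.span R (g '' {i}ᶜ) := by
      have h1 : x i • g i ∈ Submodule.span R (g '' {i}ᶜ) := by
        rw [eq_neg_of_add_eq_zero_left hx]
        refine neg_mem (Submodule.sum_mem _ fun j hj => Submodule.smul_mem _ _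
          (Submodule.subset_span ⟨j, ?_, rfl⟩))
        simpa using hj
      obtain ⟨r, hr⟩ := hi
      rw [← hr] at h1
      have h2 := Submodule.smul_mem _ ((r⁻¹ : Rˣ) : R) h1
      rwa [smul_smul, Units.inv_mul, one_smul] at h2
    have htop : Submodule.span R (g '' {i}ᶜ) = ⊤ := by
      rw [eq_top_iff, ← hg, Submodule.span_le]
      rintro _ ⟨j, rfl⟩
      by_cases hj : j = i
      · rw [hj]; exact hmem
      · exact Submodule.subset_span ⟨j, hj, rfl⟩
    have h1 : mu R M ≤ (g '' {i}ᶜ).ncard := by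
      change (⊤ : Submodule R M).spanFinrank ≤ _
      rw [← htop]
      exact Submodule.spanFinrank_span_le_ncard_of_finite (Set.toFinite _)
    have h2 : (g '' {i}ᶜ).ncard ≤ ({i}ᶜ : Set (Fin (mu R M))).ncard :=
      Set.ncard_image_le (Set.toFinite _)
    have h3 : ({i}ᶜ : Set (Fin (mu R M))).ncard + ({i} : Set (Fin (mu R M))).ncard =
        mu R M := by
      rw [add_comm, Set.ncard_add_ncard_compl, Nat.card_eq_fintype_card, Fintype.card_fin]
    rw [Set.ncard_singleton] at h3
    omega

variable (R M) in
/-- The number of generators is the dimension of `M / 𝔪 M`. -/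
lemma nonempty_quotient_equiv [Module.Finite R M] :
    Nonempty ((M ⧸ (maximalIdeal R • ⊤ : Submodule R M)) ≃ₗ[R]
      (Fin (mu R M) → ResidueField R)) := by
  obtain ⟨π, hπ, hker⟩ := exists_minimal_cover R M
  let q : (Fin (mu R M) → R) →ₗ[R] (Fin (mu R M) → ResidueField R) :=
    LinearMap.pi fun i => (Algebra.linearMap R (ResidueField R)) ∘ₗ LinearMap.proj i
  have hq : Function.Surjective q := fun y =>
    ⟨fun i => (residue_surjective (y i)).choose, funext fun i => (residue_surjective (y i)).choose_spec⟩
  have hq0 : ∀ x, q x = 0 ↔ ∀ i, x i ∈ maximalIdeal R := by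
    intro x
    rw [funext_iff]
    exact forall_congr' fun i => Ideal.Quotient.eq_zero_iff_mem
  let p : (Fin (mu R M) → R) →ₗ[R] (M ⧸ (maximalIdeal R • ⊤ : Submodule R M)) :=
    (Submodule.mkQ _) ∘ₗ π
  have hp : Function.Surjective p := (Submodule.mkQ_surjective _).comp hπ
  have hp0 : LinearMap.ker p = LinearMap.ker q := by
    ext x
    rw [LinearMap.mem_ker, LinearMap.mem_ker, hq0, LinearMap.comp_apply, Submodule.mkQ_apply,
      Submodule.Quotient.mk_eq_zero]
    have hmap : (maximalIdeal R • ⊤ : Submodule R M) =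
        (maximalIdeal R • ⊤ : Submodule R (Fin (mu R M) → R)).map π := by
      rw [Submodule.map_smul'', Submodule.map_top, LinearMap.range_eq_top.2 hπ]
    rw [hmap]
    constructor
    · rintro ⟨y, hy, hyx⟩ i
      have h1 := hker (x - y) (by rw [map_sub, hyx, sub_self]) i
      have h2 := (mem_smul_top_pi_ring _ _).1 hy i
      simpa using add_mem h1 h2
    · intro h
      exact ⟨x, (mem_smul_top_pi_ring _ _).2 h, rfl⟩
  exact ⟨(p.quotKerEquivOfSurjective hp).symm ≪≫ₗ Submodule.quotEquivOfEq _ _ hp0 ≪≫ₗ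
    q.quotKerEquivOfSurjective hq⟩

variable (R M) in
lemma length_quotient_maximalIdeal_smul [Module.Finite R M] :
    Module.length R (M ⧸ (maximalIdeal R • ⊤ : Submodule R M)) = mu R M := by
  obtain ⟨e⟩ := nonempty_quotient_equiv R M
  rw [e.length_eq, length_pi_residueField]

variable (R M) in
lemma exists_surjective_pi_residueField [Module.Finite R M] :
    ∃ q : M →ₗ[R] (Fin (mu R M) → ResidueField R), Function.Surjective q ∧
      LinearMap.ker q = maximalIdeal R • ⊤ := by
  obtain ⟨e⟩ := nonempty_quotient_equiv R M
  refine ⟨e.toLinearMap ∘ₗ Submodule.mkQ _, e.surjective.comp (Submodule.mkQ_surjective _), ?_⟩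
  rw [LinearMap.ker_comp, LinearEquiv.ker, Submodule.comap_bot, Submodule.ker_mkQ]

/-- A finitely generated module killed by the maximal ideal is a residue field vector space. -/
lemma nonempty_equiv_pi_residueField [Module.Finite R M]
    (h : ∀ a ∈ maximalIdeal R, ∀ x : M, a • x = 0) :
    Nonempty (M ≃ₗ[R] (Fin (mu R M) → ResidueField R)) := by
  obtain ⟨e⟩ := nonempty_quotient_equiv R M
  have : (maximalIdeal R • ⊤ : Submodule R M) = ⊥ := by
    rw [eq_bot_iff, Submodule.smul_le]
    exact fun a ha x _ => h a ha x
  exact ⟨(Submodule.quotEquivOfEqBot _ this).symm ≪≫ₗ e⟩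

lemma length_eq_mu [Module.Finite R M] (h : ∀ a ∈ maximalIdeal R, ∀ x : M, a • x = 0) :
    Module.length R M = mu R M := by
  obtain ⟨e⟩ := nonempty_equiv_pi_residueField h
  rw [e.length_eq, length_pi_residueField]

lemma isFiniteLength_of_pow_smul_eq_bot [IsNoetherianRing R] [Module.Finite R M] {t : ℕ}
    (ht : (maximalIdeal R ^ t • ⊤ : Submodule R M) = ⊥) : IsFiniteLength R M := by
  induction t generalizing M with
  | zero =>
    have : Subsingleton M := by
      rw [← Submodule.subsingleton_iff R]
      exact subsingleton_of_bot_eq_top (by simpa using ht.symm)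
    exact .of_subsingleton
  | succ t ih =>
    let W : Submodule R M := maximalIdeal R ^ t • ⊤
    have h1 : IsFiniteLength R W := by
      rw [← Module.length_ne_top_iff, length_eq_mu (M := W)]
      · exact ENat.natCast_ne_top _
      · intro a ha x
        apply Subtype.ext
        have : a • (x : M) ∈ (maximalIdeal R ^ (t + 1) • ⊤ : Submodule R M) := by
          rw [pow_succ', mul_smul]
          exact Submodule.smul_mem_smul ha x.2
        rwa [ht, Submodule.mem_bot] at this
    have h2 : IsFiniteLength R (M ⧸ W) := by
      refine ih ?_
      have : (maximalIdeal R ^ t • ⊤ : Submodule R (M ⧸ W)) =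
          (maximalIdeal R ^ t • ⊤ : Submodule R M).map W.mkQ := by
        rw [Submodule.map_smul'', Submodule.map_top, Submodule.range_mkQ]
      rw [this, Submodule.mkQ_map_self]
    rw [← Module.length_ne_top_iff] at h1 h2 ⊢
    rw [Module.length_eq_add_of_exact W.subtype W.mkQ W.subtype_injective W.mkQ_surjective
      (LinearMap.exact_subtype_mkQ W)]
    exact WithTop.add_ne_top.2 ⟨h1, h2⟩

variable (R M) in
lemma isFiniteLength_quotient_pow [IsNoetherianRing R] [Module.Finite R M] (n : ℕ) :
    IsFiniteLength R (M ⧸ (maximalIdeal R ^ n • ⊤ : Submodule R M)) := by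
  refine isFiniteLength_of_pow_smul_eq_bot (t := n) ?_
  have : (maximalIdeal R ^ n • ⊤ : Submodule R (M ⧸ (maximalIdeal R ^ n • ⊤ : Submodule R M))) =
      (maximalIdeal R ^ n • ⊤ : Submodule R M).map (Submodule.mkQ _) := by
    rw [Submodule.map_smul'', Submodule.map_top, Submodule.range_mkQ]
  rw [this, Submodule.mkQ_map_self]

/-- The radical of the annihilator contains `𝔪`, which is finitely generated. The form with primes
serves both modules of dimension zero and localizations at minimal primes of the support. -/
lemma exists_pow_smul_eq_bot_of_forall_prime [IsNoetherianRing R]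
    (h : ∀ q : Ideal R, q.IsPrime → Module.annihilator R M ≤ q → maximalIdeal R ≤ q) :
    ∃ t, (maximalIdeal R ^ t • ⊤ : Submodule R M) = ⊥ := by
  have hle : maximalIdeal R ≤ (Module.annihilator R M).radical := by
    rw [Ideal.radical_eq_sInf]
    exact le_sInf fun p hp => h p hp.2 hp.1
  obtain ⟨t, ht⟩ := Ideal.exists_pow_le_of_le_radical_of_fg hle
    ((isNoetherianRing_iff_ideal_fg R).1 ‹_› _)
  refine ⟨t, ?_⟩
  rw [eq_bot_iff, Submodule.smul_le]
  intro r hr x _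
  exact Module.mem_annihilator.1 (ht hr) x

lemma exists_pow_smul_eq_bot_of_supportDim_le [IsNoetherianRing R] [Module.Finite R M]
    (h : Module.supportDim R M ≤ 0) : ∃ t, (maximalIdeal R ^ t • ⊤ : Submodule R M) = ⊥ := by
  refine exists_pow_smul_eq_bot_of_forall_prime fun p hp2 hp1 => ?_
  rw [Module.supportDim, Order.krullDim_nonpos_iff_forall_isMax] at h
  have hpm : (⟨p, hp2⟩ : PrimeSpectrum R) ∈ Module.support R M := by
    rw [Module.support_eq_zeroLocus]; exact hp1
  have hmm : (closedPoint R) ∈ Module.support R M := by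
    rw [Module.support_eq_zeroLocus]; exact hp1.trans (le_maximalIdeal hp2.ne_top)
  exact h ⟨_, hpm⟩ (b := ⟨_, hmm⟩) (le_maximalIdeal hp2.ne_top)

end MuU

end
end LocalModule

namespace LocalModule
section

open IsLocalRing CategoryTheory Abelian

/-! ### Long exact sequences of `Ext` in terms of linear maps. -/

section Ext

variable {R : Type u} [CommRing R]

/-- `0 → A → B → C → 0` is exact. -/
structure SES {A B C : Type*} [AddCommGroup A] [Module R A] [AddCommGroup B] [Module R B]
    [AddCommGroup C] [Module R C] (f : A →ₗ[R] B) (g : B →ₗ[R] C) : Prop where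
  inj : Function.Injective f
  surj : Function.Surjective g
  exact : ∀ x, g x = 0 ↔ ∃ y, f y = x

lemma SES.of_surjective {B C : Type*} [AddCommGroup B] [Module R B] [AddCommGroup C] [Module R C]
    {g : B →ₗ[R] C} (hg : Function.Surjective g) : SES (LinearMap.ker g).subtype g :=
  ⟨Submodule.subtype_injective _, hg, fun x =>
    ⟨fun h => ⟨⟨x, h⟩, rfl⟩, fun ⟨y, hy⟩ => hy ▸ y.2⟩⟩

lemma SES.of_injective {A B : Type*} [AddCommGroup A] [Module R A] [AddCommGroup B] [Module R B]
    {f : A →ₗ[R] B} (hf : Function.Injective f) : SES f (LinearMap.range f).mkQ :=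
  ⟨hf, Submodule.mkQ_surjective _, fun x => by
    rw [Submodule.mkQ_apply, Submodule.Quotient.mk_eq_zero, LinearMap.mem_range]⟩

lemma SES.of_submodule {B : Type*} [AddCommGroup B] [Module R B] (W : Submodule R B) :
    SES W.subtype W.mkQ :=
  ⟨W.subtype_injective, W.mkQ_surjective, fun x => by
    rw [Submodule.mkQ_apply, Submodule.Quotient.mk_eq_zero]
    exact ⟨fun h => ⟨⟨x, h⟩, rfl⟩, fun ⟨y, hy⟩ => hy ▸ y.2⟩⟩

lemma SES.length_eq {A B C : Type*} [AddCommGroup A] [Module R A] [AddCommGroup B] [Module R B]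
    [AddCommGroup C] [Module R C] {f : A →ₗ[R] B} {g : B →ₗ[R] C} (h : SES f g) :
    Module.length R B = Module.length R A + Module.length R C :=
  length_eq_of_ker_eq_range h.inj h.surj h.exact

variable {A B C A' B' C' X Y N : Type u} [AddCommGroup A] [Module R A] [AddCommGroup B] [Module R B]
  [AddCommGroup C] [Module R C] [AddCommGroup A'] [Module R A'] [AddCommGroup B'] [Module R B']
  [AddCommGroup C'] [Module R C'] [AddCommGroup X] [Module R X] [AddCommGroup Y] [Module R Y]
  [AddCommGroup N] [Module R N]

variable (R X N) in
/-- `Ext^n_R(X, N)`. -/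
abbrev ExtModule (n : ℕ) : Type u := Ext (ModuleCat.of R X) (ModuleCat.of R N) n

/-- Functoriality of `Ext` in the first variable. -/
noncomputable def extPre (N : Type u) [AddCommGroup N] [Module R N] (n : ℕ) (f : A →ₗ[R] B) :
    ExtModule R B N n →ₗ[R] ExtModule R A N n :=
  (Ext.mk₀ (ModuleCat.ofHom f)).precompOfLinear R (ModuleCat.of R N) (zero_add n)

/-- Functoriality of `Ext` in the second variable. -/
noncomputable def extPost (X : Type u) [AddCommGroup X] [Module R X] (n : ℕ) (f : A →ₗ[R] B) :
    ExtModule R X A n →ₗ[R] ExtModule R X B n :=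
  (Ext.mk₀ (ModuleCat.ofHom f)).postcompOfLinear R (ModuleCat.of R X) (add_zero n)

lemma extPre_apply (n : ℕ) (f : A →ₗ[R] B) (x : ExtModule R B N n) :
    extPre N n f x = (Ext.mk₀ (ModuleCat.ofHom f)).comp x (zero_add n) := rfl

lemma extPost_apply (n : ℕ) (f : A →ₗ[R] B) (x : ExtModule R X A n) :
    extPost X n f x = x.comp (Ext.mk₀ (ModuleCat.ofHom f)) (add_zero n) := rfl

@[simp]
lemma extPre_id (n : ℕ) (x : ExtModule R B N n) : extPre N n LinearMap.id x = x :=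
  Ext.mk₀_id_comp x

lemma extPre_extPre (n : ℕ) (f : A →ₗ[R] B) (g : B →ₗ[R] C) (x : ExtModule R C N n) :
    extPre N n f (extPre N n g x) = extPre N n (g ∘ₗ f) x := by
  rw [extPre_apply, extPre_apply, Ext.mk₀_comp_mk₀_assoc]
  rfl

lemma extPre_add (n : ℕ) (f g : A →ₗ[R] B) (x : ExtModule R B N n) :
    extPre N n (f + g) x = extPre N n f x + extPre N n g x := by
  rw [extPre_apply, ModuleCat.ofHom_add, Ext.mk₀_add, Ext.add_comp]; rfl

@[simp]
lemma extPre_zero (n : ℕ) (x : ExtModule R B N n) : extPre N n (0 : A →ₗ[R] B) x = 0 := by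
  have := extPre_add n (0 : A →ₗ[R] B) 0 x
  rwa [add_zero, left_eq_add] at this

lemma extPre_smul (n : ℕ) (r : R) (f : A →ₗ[R] B) (x : ExtModule R B N n) :
    extPre N n (r • f) x = r • extPre N n f x := by
  rw [extPre_apply, show ModuleCat.ofHom (r • f) = r • ModuleCat.ofHom f from rfl,
    Ext.mk₀_smul, Ext.smul_comp]; rfl

lemma extPre_sum {ι : Type*} (s : Finset ι) (n : ℕ) (f : ι → A →ₗ[R] B) (x : ExtModule R B N n) :
    extPre N n (∑ i ∈ s, f i) x = ∑ i ∈ s, extPre N n (f i) x := by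
  classical
  induction s using Finset.induction_on with
  | empty => simp
  | insert a s ha ih => rw [Finset.sum_insert ha, Finset.sum_insert ha, extPre_add, ih]

@[simp]
lemma extPost_id (n : ℕ) (x : ExtModule R X B n) : extPost X n LinearMap.id x = x :=
  Ext.comp_mk₀_id x

lemma extPost_extPost (n : ℕ) (f : A →ₗ[R] B) (g : B →ₗ[R] C) (x : ExtModule R X A n) :
    extPost X n g (extPost X n f x) = extPost X n (g ∘ₗ f) x := by
  rw [extPost_apply, extPost_apply, Ext.comp_assoc_of_third_deg_zero, Ext.mk₀_comp_mk₀]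
  rfl

lemma extPost_add (n : ℕ) (f g : A →ₗ[R] B) (x : ExtModule R X A n) :
    extPost X n (f + g) x = extPost X n f x + extPost X n g x := by
  rw [extPost_apply, ModuleCat.ofHom_add, Ext.mk₀_add, Ext.comp_add]; rfl

@[simp]
lemma extPost_zero (n : ℕ) (x : ExtModule R X A n) : extPost X n (0 : A →ₗ[R] B) x = 0 := by
  have := extPost_add n (0 : A →ₗ[R] B) 0 x
  rwa [add_zero, left_eq_add] at this

lemma extPost_smul (n : ℕ) (r : R) (f : A →ₗ[R] B) (x : ExtModule R X A n) :
    extPost X n (r • f) x = r • extPost X n f x := by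
  rw [extPost_apply, show ModuleCat.ofHom (r • f) = r • ModuleCat.ofHom f from rfl,
    Ext.mk₀_smul, Ext.comp_smul]; rfl

lemma extPost_sum {ι : Type*} (s : Finset ι) (n : ℕ) (f : ι → A →ₗ[R] B)
    (x : ExtModule R X A n) :
    extPost X n (∑ i ∈ s, f i) x = ∑ i ∈ s, extPost X n (f i) x := by
  classical
  induction s using Finset.induction_on with
  | empty => simp
  | insert a s ha ih => rw [Finset.sum_insert ha, Finset.sum_insert ha, extPost_add, ih]

/-- `Ext` turns finite powers in the first variable into powers. -/
noncomputable def extPiPre (X N : Type u) [AddCommGroup X] [Module R X] [AddCommGroup N]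
    [Module R N] (n D : ℕ) :
    ExtModule R (Fin D → X) N n ≃ₗ[R] (Fin D → ExtModule R X N n) :=
  LinearEquiv.ofLinearMap
    (LinearMap.pi fun i => extPre N n (LinearMap.single R (fun _ : Fin D => X) i))
    (∑ i, extPre N n (LinearMap.proj (R := R) (φ := fun _ : Fin D => X) i) ∘ₗ LinearMap.proj i)
    (by
      refine LinearMap.ext fun x => funext fun i => ?_
      simp only [LinearMap.comp_apply, LinearMap.pi_apply, LinearMap.sum_apply, map_sum,
        extPre_extPre, LinearMap.proj_apply, LinearMap.id_apply]
      rw [Finset.sum_eq_single i]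
      · rw [show LinearMap.proj i ∘ₗ LinearMap.single R (fun _ : Fin D => X) i = LinearMap.id from
          LinearMap.ext fun y => by simp, extPre_id]
      · intro j _ hj
        rw [show LinearMap.proj j ∘ₗ LinearMap.single R (fun _ : Fin D => X) i = 0 from
          LinearMap.ext fun y => by simp [Pi.single_eq_of_ne hj], extPre_zero]
      · simp)
    (by
      refine LinearMap.ext fun x => ?_
      simp only [LinearMap.comp_apply, LinearMap.pi_apply, LinearMap.sum_apply,
        extPre_extPre, LinearMap.proj_apply, LinearMap.id_apply]
      rw [← extPre_sum]
      convert extPre_id n x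
      refine LinearMap.ext fun y => ?_
      simp [LinearMap.sum_apply, Finset.univ_sum_single])

/-- `Ext` turns finite powers in the second variable into powers. -/
noncomputable def extPiPost (X N : Type u) [AddCommGroup X] [Module R X] [AddCommGroup N]
    [Module R N] (n D : ℕ) :
    ExtModule R X (Fin D → N) n ≃ₗ[R] (Fin D → ExtModule R X N n) :=
  LinearEquiv.ofLinearMap
    (LinearMap.pi fun i => extPost X n (LinearMap.proj (R := R) (φ := fun _ : Fin D => N) i))
    (∑ i, extPost X n (LinearMap.single R (fun _ : Fin D => N) i) ∘ₗ LinearMap.proj i)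
    (by
      refine LinearMap.ext fun x => funext fun i => ?_
      simp only [LinearMap.comp_apply, LinearMap.pi_apply, LinearMap.sum_apply, map_sum,
        extPost_extPost, LinearMap.proj_apply, LinearMap.id_apply]
      rw [Finset.sum_eq_single i]
      · rw [show LinearMap.proj i ∘ₗ LinearMap.single R (fun _ : Fin D => N) i = LinearMap.id from
          LinearMap.ext fun y => by simp, extPost_id]
      · intro j _ hj
        rw [show LinearMap.proj i ∘ₗ LinearMap.single R (fun _ : Fin D => N) j = 0 from
          LinearMap.ext fun y => by simp [Pi.single_eq_of_ne hj.symm], extPost_zero]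
      · simp)
    (by
      refine LinearMap.ext fun x => ?_
      simp only [LinearMap.comp_apply, LinearMap.pi_apply, LinearMap.sum_apply,
        extPost_extPost, LinearMap.proj_apply, LinearMap.id_apply]
      rw [← extPost_sum]
      convert extPost_id n x
      refine LinearMap.ext fun y => ?_
      simp [LinearMap.sum_apply, Finset.univ_sum_single])

variable {f : A →ₗ[R] B} {g : B →ₗ[R] C} {f' : A' →ₗ[R] B'} {g' : B' →ₗ[R] C'}

lemma SES.comp_eq_zero (h : SES f g) : g.comp f = 0 :=
  LinearMap.ext fun x => (h.exact _).2 ⟨x, rfl⟩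

lemma SES.shortExact (h : SES f g) :
    (ModuleCat.shortComplexOfCompEqZero f g h.comp_eq_zero).ShortExact :=
  ModuleCat.shortComplex_shortExact _ (fun x => h.exact x) h.inj h.surj

/-- The connecting map in the first variable. -/
noncomputable def SES.deltaPre (h : SES f g) (N : Type u) [AddCommGroup N] [Module R N] (n : ℕ) :
    ExtModule R A N n →ₗ[R] ExtModule R C N (n + 1) :=
  Ext.precompOfLinear (X := ModuleCat.of R C) (Y := ModuleCat.of R A)
    h.shortExact.extClass R (ModuleCat.of R N) (add_comm 1 n)

/-- The connecting map in the second variable. -/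
noncomputable def SES.deltaPost (h : SES f g) (X : Type u) [AddCommGroup X] [Module R X] (n : ℕ) :
    ExtModule R X C n →ₗ[R] ExtModule R X A (n + 1) :=
  Ext.postcompOfLinear (Y := ModuleCat.of R C) (Z := ModuleCat.of R A)
    h.shortExact.extClass R (ModuleCat.of R X) rfl

lemma SES.pre_exact₁ (h : SES f g) {n : ℕ} (x : ExtModule R A N n) :
    h.deltaPre N n x = 0 ↔ ∃ y, extPre N n f y = x :=
  ⟨fun hx => Ext.contravariant_sequence_exact₁ h.shortExact (ModuleCat.of R N) x (add_comm 1 n) hx,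
    fun ⟨y, hy⟩ => hy ▸ h.shortExact.extClass_comp_assoc (h := add_comm 1 n) y⟩

lemma SES.pre_exact₂ (h : SES f g) {n : ℕ} (x : ExtModule R B N n) :
    extPre N n f x = 0 ↔ ∃ y, extPre N n g y = x :=
  ⟨fun hx => Ext.contravariant_sequence_exact₂ h.shortExact (ModuleCat.of R N) x hx,
    fun ⟨y, hy⟩ => by rw [← hy, extPre_extPre, h.comp_eq_zero, extPre_zero]⟩

lemma SES.pre_exact₃ (h : SES f g) {n : ℕ} (x : ExtModule R C N (n + 1)) :
    extPre N (n + 1) g x = 0 ↔ ∃ y, h.deltaPre N n y = x :=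
  ⟨fun hx => Ext.contravariant_sequence_exact₃ h.shortExact (ModuleCat.of R N) x hx (add_comm 1 n),
    fun ⟨y, hy⟩ => hy ▸ h.shortExact.comp_extClass_assoc y (add_comm 1 n)⟩

lemma SES.pre_injective (h : SES f g) : Function.Injective (extPre N 0 g) := by
  have : Epi (ModuleCat.ofHom g) := (ModuleCat.epi_iff_surjective _).2 h.surj
  exact Ext.precomp_mk₀_injective_of_epi (ModuleCat.of R N) (ModuleCat.ofHom g)

lemma SES.post_exact₁ (h : SES f g) {n : ℕ} (x : ExtModule R X A (n + 1)) :
    extPost X (n + 1) f x = 0 ↔ ∃ y, h.deltaPost X n y = x :=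
  ⟨fun hx => Ext.covariant_sequence_exact₁ (ModuleCat.of R X) h.shortExact x hx rfl,
    fun ⟨y, hy⟩ => by
      rw [← hy]
      change Ext.comp (Ext.comp y h.shortExact.extClass rfl) (Ext.mk₀ (ModuleCat.ofHom f))
        (add_zero _) = 0
      rw [Ext.comp_assoc_of_third_deg_zero]
      erw [h.shortExact.extClass_comp]
      exact Ext.comp_zero _ _ _ _ _⟩

lemma SES.post_exact₂ (h : SES f g) {n : ℕ} (x : ExtModule R X B n) :
    extPost X n g x = 0 ↔ ∃ y, extPost X n f y = x :=
  ⟨fun hx => Ext.covariant_sequence_exact₂ (ModuleCat.of R X) h.shortExact x hx,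
    fun ⟨y, hy⟩ => by rw [← hy, extPost_extPost, h.comp_eq_zero, extPost_zero]⟩

lemma SES.post_exact₃ (h : SES f g) {n : ℕ} (x : ExtModule R X C n) :
    h.deltaPost X n x = 0 ↔ ∃ y, extPost X n g y = x :=
  ⟨fun hx => Ext.covariant_sequence_exact₃ (ModuleCat.of R X) h.shortExact x rfl hx,
    fun ⟨y, hy⟩ => by
      rw [← hy]
      change Ext.comp (Ext.comp y (Ext.mk₀ (ModuleCat.ofHom g)) (add_zero _))
        h.shortExact.extClass rfl = 0
      rw [Ext.comp_assoc_of_second_deg_zero]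
      erw [h.shortExact.comp_extClass]
      exact Ext.comp_zero _ _ _ _ _⟩

lemma SES.post_injective (h : SES f g) : Function.Injective (extPost X 0 f) := by
  have : Mono (ModuleCat.ofHom f) := (ModuleCat.mono_iff_injective _).2 h.inj
  exact Ext.postcomp_mk₀_injective_of_mono (ModuleCat.of R X) (ModuleCat.ofHom f)

lemma SES.deltaPre_naturality (h : SES f g) (h' : SES f' g') (α : A →ₗ[R] A') (β : B →ₗ[R] B')
    (γ : C →ₗ[R] C') (h1 : β ∘ₗ f = f' ∘ₗ α) (h2 : γ ∘ₗ g = g' ∘ₗ β) {n : ℕ}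
    (x : ExtModule R A' N n) :
    h.deltaPre N n (extPre N n α x) = extPre N (n + 1) γ (h'.deltaPre N n x) := by
  have key := ShortComplex.ShortExact.extClass_naturality h.shortExact h'.shortExact
    (ShortComplex.Hom.mk (ModuleCat.ofHom α) (ModuleCat.ofHom β) (ModuleCat.ofHom γ)
      (by rw [← ModuleCat.ofHom_comp, ← ModuleCat.ofHom_comp, h1])
      (by rw [← ModuleCat.ofHom_comp, ← ModuleCat.ofHom_comp, h2]))
  change h.shortExact.extClass.comp ((Ext.mk₀ (ModuleCat.ofHom α)).comp x (zero_add n))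
    (add_comm 1 n) = (Ext.mk₀ (ModuleCat.ofHom γ)).comp
      (h'.shortExact.extClass.comp x (add_comm 1 n)) (zero_add (n + 1))
  rw [← Ext.comp_assoc (a₁₂ := 1) _ _ _ (by lia) (by lia) (by lia),
    ← Ext.comp_assoc (a₁₂ := 1) _ _ _ (by lia) (by lia) (by lia)]
  exact congrArg (fun z => Ext.comp z x (add_comm 1 n)) key

lemma extVanishes_iff {n : ℕ} : ExtVanishes R X N n ↔ ∀ x : ExtModule R X N n, x = 0 :=
  ⟨fun h _ => h.elim _ _, fun h => ⟨fun x y => (h x).trans (h y).symm⟩⟩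

lemma extVanishes_pi_left {n : ℕ} (D : ℕ) (h : ExtVanishes R X N n) :
    ExtVanishes R (Fin D → X) N n :=
  have : Subsingleton (ExtModule R X N n) := h
  (extPiPre X N n D).toEquiv.subsingleton

lemma extVanishes_pi_right {n : ℕ} (D : ℕ) (h : ExtVanishes R X N n) :
    ExtVanishes R X (Fin D → N) n :=
  have : Subsingleton (ExtModule R X N n) := h
  (extPiPost X N n D).toEquiv.subsingleton

lemma extVanishes_projective [Module.Projective R X] (n : ℕ) : ExtVanishes R X N (n + 1) := by
  have : Projective (ModuleCat.of R X) := (IsProjective.iff_projective _).1 inferInstance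
  exact extVanishes_iff.2 fun x => Ext.eq_zero_of_projective x

lemma extVanishes_subsingleton_left [Subsingleton X] (n : ℕ) : ExtVanishes R X N n := by
  refine extVanishes_iff.2 fun x => ?_
  rw [← extPre_id n x, show (LinearMap.id : X →ₗ[R] X) = 0 from LinearMap.ext fun y =>
    Subsingleton.elim _ _, extPre_zero]

lemma SES.extVanishes_left₁ (h : SES f g) {n : ℕ} (h2 : ExtVanishes R B N n)
    (h3 : ExtVanishes R C N (n + 1)) : ExtVanishes R A N n := by
  rw [extVanishes_iff] at *
  intro x
  obtain ⟨y, rfl⟩ := (h.pre_exact₁ x).1 (h3 _)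
  rw [h2 y, map_zero]

lemma SES.extVanishes_left₂ (h : SES f g) {n : ℕ} (h1 : ExtVanishes R A N n)
    (h3 : ExtVanishes R C N n) : ExtVanishes R B N n := by
  rw [extVanishes_iff] at *
  intro x
  obtain ⟨y, rfl⟩ := (h.pre_exact₂ x).1 (h1 _)
  rw [h3 y, map_zero]

lemma SES.extVanishes_left₃ (h : SES f g) {n : ℕ} (h1 : ExtVanishes R A N n)
    (h2 : ExtVanishes R B N (n + 1)) : ExtVanishes R C N (n + 1) := by
  rw [extVanishes_iff] at *
  intro x
  obtain ⟨y, rfl⟩ := (h.pre_exact₃ x).1 (h2 _)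
  rw [h1 y, map_zero]

/-- Left exactness of `Hom`. The degree zero case is separate because a window may start at `0`,
where no lower `Ext` is available. -/
lemma SES.extVanishes_left₃_zero (h : SES f g) (h2 : ExtVanishes R B N 0) :
    ExtVanishes R C N 0 := by
  rw [extVanishes_iff] at *
  exact fun x => h.pre_injective (by rw [h2 (extPre N 0 g x), map_zero])

lemma SES.extVanishes_right₃ (h : SES f g) {n : ℕ} (h2 : ExtVanishes R X B n)
    (h1 : ExtVanishes R X A (n + 1)) : ExtVanishes R X C n := by
  rw [extVanishes_iff] at *
  intro x
  obtain ⟨y, rfl⟩ := (h.post_exact₃ x).1 (h1 _)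
  rw [h2 y, map_zero]

lemma smul_ext_eq_zero_left {a : R} (ha : ∀ x : X, a • x = 0) {n : ℕ} (e : ExtModule R X N n) :
    a • e = 0 := by
  rw [← extPre_id n e, ← extPre_smul, show a • (LinearMap.id : X →ₗ[R] X) = 0 from
    LinearMap.ext ha, extPre_zero]

variable [IsLocalRing R]

lemma smul_ext_residueField_left {a : R} (ha : a ∈ maximalIdeal R) {n : ℕ}
    (e : ExtModule R (ResidueField R) N n) : a • e = 0 :=
  smul_ext_eq_zero_left (smul_residueField ha) e

lemma smul_ext_residueField_right {a : R} (ha : a ∈ maximalIdeal R) {n : ℕ}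
    (e : ExtModule R X (ResidueField R) n) : a • e = 0 := by
  rw [← extPost_id n e, ← extPost_smul, show a • (LinearMap.id : ResidueField R →ₗ[R] _) = 0 from
    LinearMap.ext (smul_residueField ha), extPost_zero]

variable [IsNoetherianRing R]

instance finite_extModule [Module.Finite R X] [Module.Finite R N] (n : ℕ) :
    Module.Finite R (ExtModule R X N n) :=
  ModuleCat.finite_ext R _ _ n

instance finite_residueField : Module.Finite R (ResidueField R) :=
  Module.Finite.of_surjective (Algebra.linearMap R (ResidueField R)) residue_surjective

lemma length_ext_residueField_left [Module.Finite R N] (n : ℕ) :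
    Module.length R (ExtModule R (ResidueField R) N n) = bass R N n :=
  length_eq_mu fun _ ha x => smul_ext_residueField_left ha x

lemma length_ext_residueField_right [Module.Finite R N] (n : ℕ) :
    Module.length R (ExtModule R N (ResidueField R) n) = betti R N n :=
  length_eq_mu fun _ ha x => smul_ext_residueField_right ha x

lemma bass_eq_zero_iff [Module.Finite R N] (n : ℕ) :
    bass R N n = 0 ↔ ExtVanishes R (ResidueField R) N n :=
  mu_eq_zero_iff (M := ExtModule R (ResidueField R) N n)

end Ext

end
end LocalModule

namespace LocalModule
section

open IsLocalRing CategoryTheory Abelian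

/-! ### Injective dimension from the vanishing of `Ext` on cyclic modules. -/

section InjectiveDimension

variable {R : Type u} [CommRing R] {A B C N X : Type u} [AddCommGroup A] [Module R A]
  [AddCommGroup B] [Module R B] [AddCommGroup C] [Module R C] [AddCommGroup N] [Module R N]
  [AddCommGroup X] [Module R X]

/-- The obstruction to extending a map `I → N` to `R` is its image under the connecting map to
`Ext^1(R/I, N)`. -/
lemma baer_of_extVanishes (h : ∀ I : Ideal R, ExtVanishes R (R ⧸ I) N 1) : Module.Baer R N := by
  intro I g
  obtain ⟨y, hy⟩ := ((SES.of_submodule I).pre_exact₁ (N := N) (n := 0)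
    (Ext.mk₀ (ModuleCat.ofHom g))).1 (extVanishes_iff.1 (h I) _)
  obtain ⟨f, rfl⟩ := Ext.homEquiv₀.symm.surjective y
  refine ⟨f.hom, fun x hx => ?_⟩
  rw [Ext.homEquiv₀_symm_apply, extPre_apply, Ext.mk₀_comp_mk₀] at hy
  have h2 := Ext.homEquiv₀.symm.injective hy
  exact congrArg (fun z : ModuleCat.of R I ⟶ ModuleCat.of R N => z.hom (⟨x, hx⟩ : I)) h2

/-- Dimension shifting along an embedding of `N` in an injective module, ending with Baer's
criterion for the last cosyzygy. -/
lemma hasInjectiveDimensionLT_of_extVanishes {l : ℕ}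
    (h : ∀ I : Ideal R, ExtVanishes R (R ⧸ I) N (l + 1)) :
    HasInjectiveDimensionLT (ModuleCat.of R N) (l + 1) := by
  induction l generalizing N with
  | zero =>
    rw [zero_add, ← injective_iff_hasInjectiveDimensionLT_one,
      ← Module.injective_iff_injective_object R, ← Module.Baer.iff_injective]
    exact baer_of_extVanishes h
  | succ l ih =>
    let ⟨I, _, f, _⟩ := EnoughInjectives.presentation (ModuleCat.of R N)
    have hf : Function.Injective f.hom := (ModuleCat.mono_iff_injective f).mp ‹_›
    have hS := SES.of_injective (R := R) (A := N) (B := I) (f := f.hom) hf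
    rw [← hS.shortExact.hasInjectiveDimensionLT_X₃_iff l (inferInstanceAs (Injective I))]
    refine ih fun J => hS.extVanishes_right₃ ?_ (h J)
    exact extVanishes_iff.2 fun x => Ext.eq_zero_of_injective (I := I) x

lemma finiteId_of_extVanishes {l : ℕ} (h : ∀ I : Ideal R, ExtVanishes R (R ⧸ I) N (l + 1)) :
    FiniteId R N :=
  (injectiveDimension_lt_iff.2 (hasInjectiveDimensionLT_of_extVanishes h)).trans_le le_top

lemma finitePd_of_hasProjectiveDimensionLT {l : ℕ}
    (h : HasProjectiveDimensionLT (ModuleCat.of R N) l) : FinitePd R N :=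
  ((projectiveDimension_lt_iff (n := l)).2 h).trans_le le_top

end InjectiveDimension

section Exact

variable {R : Type u} [CommRing R] {A B C : Type u} [AddCommGroup A]
  [Module R A] [AddCommGroup B] [Module R B] [AddCommGroup C] [Module R C]

lemma length_le_add_of_exact {f : A →ₗ[R] B} {g : B →ₗ[R] C} (h : ∀ x, g x = 0 → ∃ y, f y = x) :
    Module.length R B ≤ Module.length R A + Module.length R C := by
  have h1 := (SES.of_surjective (g := g.rangeRestrict) g.surjective_rangeRestrict).length_eq
  rw [h1]
  refine add_le_add ?_ (Module.length_le_of_injective _ (LinearMap.range g).subtype_injective)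
  have h2 : LinearMap.ker g.rangeRestrict ≤ LinearMap.range f := fun x hx =>
    h x (congrArg Subtype.val (LinearMap.mem_ker.1 hx))
  exact (Module.length_le_of_injective _ (Submodule.inclusion_injective h2)).trans
    (Module.length_le_of_surjective _ f.surjective_rangeRestrict)

end Exact

/-! ### `Ext` from modules of finite length and the growth of Bass numbers. -/

section FiniteLength

variable {R : Type u} [CommRing R] [IsLocalRing R] {A B C N X : Type u} [AddCommGroup A]
  [Module R A] [AddCommGroup B] [Module R B] [AddCommGroup C] [Module R C] [AddCommGroup N]
  [Module R N] [AddCommGroup X] [Module R X]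

lemma exists_ses_residueField (W : Submodule R X) [hW : IsSimpleModule R (X ⧸ W)] :
    ∃ g : X →ₗ[R] ResidueField R, SES W.subtype g := by
  obtain ⟨I, hI, ⟨e⟩⟩ := isSimpleModule_iff_quot_maximal.1 hW
  obtain rfl := IsLocalRing.eq_maximalIdeal hI
  refine ⟨e.toLinearMap ∘ₗ W.mkQ,
    ⟨W.subtype_injective, e.surjective.comp W.mkQ_surjective, fun x => ?_⟩⟩
  rw [← (SES.of_submodule W).exact]
  exact e.map_eq_zero_iff

lemma extVanishes_of_isFiniteLength {n : ℕ} (h : ExtVanishes R (ResidueField R) N n)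
    (hX : IsFiniteLength R X) : ExtVanishes R X N n := by
  induction hX with
  | of_subsingleton => exact extVanishes_subsingleton_left n
  | @of_simple_quotient X _ _ W hW _ ih =>
    obtain ⟨g, hS⟩ := exists_ses_residueField W
    exact hS.extVanishes_left₂ ih h

lemma extPre_subtype_eq_zero_of_pow_smul_eq_bot {t : ℕ}
    (ht : (maximalIdeal R ^ t • ⊤ : Submodule R N) = ⊥) (e : ExtModule R X N 0) :
    extPre N 0 (maximalIdeal R ^ t • ⊤ : Submodule R X).subtype e = 0 := by
  obtain ⟨f, rfl⟩ := Ext.homEquiv₀.symm.surjective e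
  rw [Ext.homEquiv₀_symm_apply, extPre_apply, Ext.mk₀_comp_mk₀]
  have : ModuleCat.ofHom (maximalIdeal R ^ t • ⊤ : Submodule R X).subtype ≫ f = 0 := by
    refine ModuleCat.hom_ext (LinearMap.ext fun x => ?_)
    have h1 : f.hom x.1 ∈ (maximalIdeal R ^ t • ⊤ : Submodule R X).map f.hom := ⟨x, x.2, rfl⟩
    rw [Submodule.map_smul''] at h1
    have h2 := Submodule.smul_mono (le_refl (maximalIdeal R ^ t)) le_top h1
    rw [ht] at h2
    exact h2
  rw [this, Ext.mk₀_zero]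

variable [IsNoetherianRing R]

/-- Each factor of a composition series of `X` is the residue field and contributes at most `bass R
N n`. -/
lemma length_ext_le [Module.Finite R N] (n : ℕ) (hX : IsFiniteLength R X) :
    Module.length R (ExtModule R X N n) ≤ Module.length R X * bass R N n := by
  induction hX with
  | @of_subsingleton X =>
    have : Subsingleton (ExtModule R X N n) := extVanishes_subsingleton_left n
    exact (Module.length_eq_zero (R := R) (M := ExtModule R X N n)).trans_le zero_le
  | @of_simple_quotient B _ _ A hW _ hA =>
    obtain ⟨g, hS⟩ := exists_ses_residueField A
    have h1 : Module.length R B = Module.length R A + 1 := by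
      rw [hS.length_eq, Module.length_eq_one R (ResidueField R)]
    have h2 : Module.length R (ExtModule R B N n) ≤ Module.length R (ExtModule R (ResidueField R) N n)
        + Module.length R (ExtModule R A N n) :=
      length_le_add_of_exact (f := extPre N n g) (g := extPre N n A.subtype) fun x => (hS.pre_exact₂ x).1
    rw [length_ext_residueField_left] at h2
    rw [h1, add_mul, one_mul, add_comm]
    exact h2.trans (add_le_add le_rfl hA)

/-- The vanishing of `Ext^{n+1}(L, N)`, for `L` of finite length, bounds the growth of the Bass
numbers of `N` in terms of the length and the number of generators of `L`. -/
lemma mu_mul_bass_succ_le [Module.Finite R N] {L : Type u} [AddCommGroup L] [Module R L]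
    [Module.Finite R L] {n : ℕ} (hL : IsFiniteLength R L) (h : ExtVanishes R L N (n + 1)) :
    mu R L * bass R N (n + 1) + mu R L * bass R N n ≤
      (Module.length R L).toNat * bass R N n := by
  obtain ⟨q, hq, -⟩ := exists_surjective_pi_residueField R L
  have hS := SES.of_surjective hq
  have hK : IsFiniteLength R (LinearMap.ker q) :=
    hL.of_injective (LinearMap.ker q).subtype_injective
  have hlen := hS.length_eq
  rw [length_pi_residueField] at hlen
  -- The kernel of `q` is `𝔪L`, of length `λ(L) - μ(L)`. Since `Ext^{n+1}(L, N) = 0`, the connecting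
  -- map from `Ext^n(𝔪L, N)` onto `Ext^{n+1}(L/𝔪L, N)` is surjective.
  have h1 : Module.length R (ExtModule R (Fin (mu R L) → ResidueField R) N (n + 1)) ≤
      Module.length R (LinearMap.ker q) * bass R N n := by
    refine le_trans (Module.length_le_of_surjective (hS.deltaPre N n) fun x => ?_)
      (length_ext_le n hK)
    exact (hS.pre_exact₃ x).1 (extVanishes_iff.1 h _)
  rw [(extPiPre _ N (n + 1) _).length_eq, Module.length_pi, length_ext_residueField_left,
    ENat.card_eq_coe_fintype_card, Fintype.card_fin] at h1
  rw [← Module.length_ne_top_iff] at hK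
  lift Module.length R (LinearMap.ker q) to ℕ using hK with a ha
  rw [hlen, ← Nat.cast_add, ENat.toNat_natCast]
  rw [← Nat.cast_mul, ← Nat.cast_mul, Nat.cast_le] at h1
  nlinarith

end FiniteLength

/-! ### Sequences forced down to zero. -/

section Decreasing

/-- A sequence that decreases strictly until it vanishes. -/
lemma eq_zero_of_lt_or_eq_zero (b : ℕ → ℕ) (j : ℕ)
    (h : ∀ n, j ≤ n → n < j + b j → b (n + 1) < b n ∨ b (n + 1) = 0) : b (j + b j) = 0 := by
  have key : ∀ i ≤ b j, b (j + i) ≤ b j - i := by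
    intro i hi
    induction i with
    | zero => simp
    | succ i ih =>
      have h1 := ih (by omega)
      have h2 := h (j + i) (by omega) (by omega)
      rw [← add_assoc]
      omega
  have := key (b j) le_rfl
  omega

/-- The inequality says `a b (n+1) ≤ (l - a) b n` with `l - a < a`, so a nonzero term is followed by
a smaller one, and a zero term by zero because `a > 0`. The additive form avoids truncated
subtraction. -/
lemma eq_zero_of_growth (b : ℕ → ℕ) {a l j : ℕ} (hlt : l < 2 * a)
    (h : ∀ n, j ≤ n → n < j + b j → a * b (n + 1) + a * b n ≤ l * b n) : b (j + b j) = 0 := by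
  refine eq_zero_of_lt_or_eq_zero b j fun n h1 h2 => ?_
  have h3 := h n h1 h2
  rcases Nat.eq_zero_or_pos (b n) with h0 | h0
  · right
    rw [h0, mul_zero, mul_zero, add_zero, Nat.le_zero, mul_eq_zero] at h3
    omega
  · left
    by_contra hcon
    push Not at hcon
    have : a * b n ≤ a * b (n + 1) := Nat.mul_le_mul_left _ hcon
    nlinarith

end Decreasing

section Induction

variable {R : Type u} [CommRing R] [IsLocalRing R] [IsNoetherianRing R] {N X : Type u}
  [AddCommGroup N] [Module R N] [Module.Finite R N] [AddCommGroup X] [Module R X]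
  [Module.Finite R X]

lemma bass_eq_zero_of_extVanishes {L : Type u} [AddCommGroup L] [Module R L]
    [Module.Finite R L] {j : ℕ} (hL : IsFiniteLength R L)
    (hlt : (Module.length R L).toNat < 2 * mu R L)
    (h : ∀ n, j + 1 ≤ n → n ≤ j + bass R N j → ExtVanishes R L N n) :
    bass R N (j + bass R N j) = 0 :=
  eq_zero_of_growth (bass R N) hlt fun n h1 h2 =>
    mu_mul_bass_succ_le hL (h (n + 1) (by omega) (by omega))

end Induction
end
end LocalModule

namespace LocalModule
section

open IsLocalRing CategoryTheory Abelian RingTheory.Sequence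
open scoped Pointwise

/-! ### `Ext` into a module killed by a power of the maximal ideal. -/

section FiniteLengthTarget

variable {R : Type u} [CommRing R] [IsLocalRing R] [IsNoetherianRing R] {N : Type u}
  [AddCommGroup N] [Module R N]

/-- For `N` killed by a power of `𝔪`, every class in `Ext^n(X, N)` restricts to zero on `𝔪^b X` for
large `b`. -/
lemma exists_extPre_pow_smul_eq_zero {t : ℕ} (ht : (maximalIdeal R ^ t • ⊤ : Submodule R N) = ⊥)
    {n : ℕ} {X : Type u} [AddCommGroup X] [Module R X] [Module.Finite R X]
    (e : ExtModule R X N n) :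
    ∃ b, extPre N n (maximalIdeal R ^ b • ⊤ : Submodule R X).subtype e = 0 := by
  induction n generalizing X with
  | zero => exact ⟨t, extPre_subtype_eq_zero_of_pow_smul_eq_bot ht e⟩
  | succ n ih =>
    obtain ⟨π, hπ, -⟩ := exists_minimal_cover R X
    have hS := SES.of_surjective hπ
    obtain ⟨y, rfl⟩ := (hS.pre_exact₃ e).1 (extVanishes_iff.1 (extVanishes_projective n) _)
    obtain ⟨b, hb⟩ := ih y
    -- The class comes from `y` on the syzygy `ker π`, and `y` dies on `𝔪 ^ b • ker π`. By
    -- Artin-Rees, `𝔪 ^ (b + c) F` meets `ker π` inside that submodule, so naturality of the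
    -- connecting map kills the restriction to `𝔪 ^ (b + c) X`.
    obtain ⟨c, hc⟩ := (maximalIdeal R).exists_pow_inf_eq_pow_smul (LinearMap.ker π)
    have hc := hc (b + c) (Nat.le_add_left c b)
    rw [Nat.add_sub_cancel] at hc
    refine ⟨b + c, ?_⟩
    set F' : Submodule R (Fin (mu R X) → R) := maximalIdeal R ^ (b + c) • ⊤ with hF'
    set X' : Submodule R X := maximalIdeal R ^ (b + c) • ⊤ with hX'
    have hmap : F'.map π = X' := by
      rw [hF', Submodule.map_smul'', Submodule.map_top, LinearMap.range_eq_top.2 hπ]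
    let g : F' →ₗ[R] X' := (π.comp F'.subtype).codRestrict X' fun x =>
      hmap ▸ ⟨x, x.2, rfl⟩
    have hg : Function.Surjective g := by
      rintro ⟨x, hx⟩
      rw [← hmap] at hx
      obtain ⟨z, hz, rfl⟩ := hx
      exact ⟨⟨z, hz⟩, rfl⟩
    have hS' := SES.of_surjective hg
    let W : Submodule R (LinearMap.ker π) := maximalIdeal R ^ b • ⊤
    have hW : ∀ z : LinearMap.ker g, (⟨z.1.1, congrArg Subtype.val z.2⟩ : LinearMap.ker π) ∈ W := by
      intro z
      have h1 : (z.1.1 : Fin (mu R X) → R) ∈ maximalIdeal R ^ (b + c) • ⊤ ⊓ LinearMap.ker π :=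
        ⟨z.1.2, congrArg Subtype.val z.2⟩
      rw [hc] at h1
      have h2 := Submodule.smul_mono (le_refl (maximalIdeal R ^ b)) inf_le_right h1
      rw [← Submodule.range_subtype (LinearMap.ker π), ← Submodule.map_top,
        ← Submodule.map_smul''] at h2
      obtain ⟨w, hw, hwz⟩ := h2
      have h3 : (⟨z.1.1, congrArg Subtype.val z.2⟩ : LinearMap.ker π) = w :=
        Subtype.ext hwz.symm
      rw [h3]
      exact hw
    let α : LinearMap.ker g →ₗ[R] W :=
      LinearMap.codRestrict W (LinearMap.codRestrict (LinearMap.ker π)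
        (F'.subtype.comp (LinearMap.ker g).subtype) fun z => congrArg Subtype.val z.2) hW
    have hα : extPre (A := LinearMap.ker g) N n (W.subtype.comp α) y = 0 := by
      rw [← extPre_extPre (A := LinearMap.ker g) (B := W) n α W.subtype y, hb, map_zero]
    rw [← hS'.deltaPre_naturality hS (W.subtype.comp α) F'.subtype X'.subtype rfl rfl, hα,
      map_zero]

/-- A class that restricts to zero on `𝔪 ^ b X` comes from `X / 𝔪 ^ b X`. This has finite length,
and its `Ext^n` into `N` vanishes because that of the residue field does. Thus a single zero Bass
number controls all finitely generated `X`. -/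
lemma extVanishes_of_bass_eq_zero [Module.Finite R N] {t : ℕ}
    (ht : (maximalIdeal R ^ t • ⊤ : Submodule R N) = ⊥) {n : ℕ} (h : bass R N n = 0)
    (X : Type u) [AddCommGroup X] [Module R X] [Module.Finite R X] : ExtVanishes R X N n := by
  refine extVanishes_iff.2 fun e => ?_
  obtain ⟨b, hb⟩ := exists_extPre_pow_smul_eq_zero ht e
  obtain ⟨y, rfl⟩ := ((SES.of_submodule _).pre_exact₂ e).1 hb
  rw [extVanishes_iff.1 (extVanishes_of_isFiniteLength ((bass_eq_zero_iff n).1 h)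
    (isFiniteLength_quotient_pow R X b)) y, map_zero]

end FiniteLengthTarget

/-! ### Division by regular elements. -/

section Regular

variable {R : Type u} [CommRing R] {N X : Type u} [AddCommGroup N] [Module R N]
  [AddCommGroup X] [Module R X]

lemma ses_quotSMulTop {x : R} (hx : IsSMulRegular N x) :
    SES (x • LinearMap.id : N →ₗ[R] N) (x • ⊤ : Submodule R N).mkQ :=
  ⟨hx, Submodule.mkQ_surjective _, fun y => by
    rw [Submodule.mkQ_apply, Submodule.Quotient.mk_eq_zero,
      Submodule.mem_smul_pointwise_iff_exists]
    simp⟩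

lemma extPost_smul_id (x : R) {n : ℕ} (e : ExtModule R X N n) :
    extPost X n (x • LinearMap.id : N →ₗ[R] N) e = x • e := by
  rw [extPost_smul, extPost_id]

lemma extPre_smul_id (x : R) {n : ℕ} (e : ExtModule R X N n) :
    extPre N n (x • LinearMap.id : X →ₗ[R] X) e = x • e := by
  rw [extPre_smul, extPre_id]

/-- The sequence `0 → R/(I : x) → R/I → R/(I + xR) → 0`, for Noetherian induction on `I`. The colon
ideal is a variable `K` so that when `(I : x) = I` the first map is literally multiplication by `x`
on `R/I`. -/
lemma ses_colon {x : R} {I K : Ideal R} (hK : K = Submodule.comap (LinearMap.mulLeft R x) I) :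
    SES (Submodule.mapQ K I (LinearMap.mulLeft R x) hK.le)
      (Submodule.mapQ I (I ⊔ Ideal.span {x}) LinearMap.id fun _ hr =>
        Submodule.mem_sup_left hr) := by
  refine ⟨(injective_iff_map_eq_zero _).2 fun r => ?_, fun y => ?_, fun y => ?_⟩
  · obtain ⟨r, rfl⟩ := Submodule.mkQ_surjective _ r
    rw [Submodule.mkQ_apply, Submodule.mapQ_apply, Submodule.Quotient.mk_eq_zero,
      Submodule.Quotient.mk_eq_zero, hK]
    exact fun h => h
  · obtain ⟨y, rfl⟩ := Submodule.mkQ_surjective _ y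
    exact ⟨Submodule.Quotient.mk y, rfl⟩
  · obtain ⟨y, rfl⟩ := Submodule.mkQ_surjective _ y
    rw [Submodule.mkQ_apply, Submodule.mapQ_apply, Submodule.Quotient.mk_eq_zero,
      LinearMap.id_apply]
    constructor
    · intro hy
      obtain ⟨a, ha, b, hb, rfl⟩ := Submodule.mem_sup.1 hy
      obtain ⟨r, rfl⟩ := Ideal.mem_span_singleton.1 hb
      refine ⟨Submodule.Quotient.mk r, ?_⟩
      rw [Submodule.mapQ_apply, Submodule.Quotient.eq]
      simpa using ha
    · rintro ⟨r, hr⟩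
      obtain ⟨r, rfl⟩ := Submodule.mkQ_surjective _ r
      rw [Submodule.mkQ_apply, Submodule.mapQ_apply, Submodule.Quotient.eq] at hr
      have h2 : x * r ∈ I ⊔ Ideal.span {x} :=
        Submodule.mem_sup_right (Ideal.mem_span_singleton.2 ⟨r, rfl⟩)
      have h3 := sub_mem h2 (Submodule.mem_sup_left (T := Ideal.span {x}) hr)
      simpa using h3

variable [IsLocalRing R]

lemma subsingleton_of_forall_exists_smul {E : Type*} [AddCommGroup E] [Module R E]
    [Module.Finite R E] {x : R} (hx : x ∈ maximalIdeal R) (h : ∀ e : E, ∃ e', e = x • e') :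
    Subsingleton E := by
  rw [← Submodule.subsingleton_iff R]
  refine subsingleton_of_bot_eq_top (Submodule.eq_bot_of_le_smul_of_le_jacobson_bot
    (maximalIdeal R) ⊤ Module.Finite.fg_top ?_ (maximalIdeal_le_jacobson _)).symm
  intro e _
  obtain ⟨e', rfl⟩ := h e
  exact Submodule.smul_mem_smul hx trivial

lemma bass_le_bassSum (s j : ℕ) : bass R N j ≤ bassSum R N s j := by
  rw [bassSum, Finset.sum_range_succ']
  simp

lemma bassSum_zero (j : ℕ) : bassSum R N 0 j = bass R N j := by simp [bassSum]

variable [IsNoetherianRing R]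

lemma extVanishes_of_quotSMulTop [Module.Finite R N] [Module.Finite R X] {x : R}
    (hx : x ∈ maximalIdeal R) (hreg : IsSMulRegular N x) {n : ℕ}
    (h : ExtVanishes R X (QuotSMulTop x N) n) : ExtVanishes R X N n := by
  refine subsingleton_of_forall_exists_smul hx fun e => ?_
  obtain ⟨y, hy⟩ := ((ses_quotSMulTop hreg).post_exact₂ e).1 (extVanishes_iff.1 h _)
  exact ⟨y, by rw [← hy, extPost_smul_id]⟩

/-- Multiplication by `x` is zero on `Ext(k, N)`, so the long exact sequence breaks into short ones.
-/
lemma bass_quotSMulTop [Module.Finite R N] {x : R} (hx : x ∈ maximalIdeal R)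
    (hreg : IsSMulRegular N x) (n : ℕ) :
    bass R (QuotSMulTop x N) n = bass R N n + bass R N (n + 1) := by
  have hS := ses_quotSMulTop hreg
  have h0 : ∀ (n : ℕ) (e : ExtModule R (ResidueField R) N n),
      extPost (ResidueField R) n (x • LinearMap.id : N →ₗ[R] N) e = 0 := fun n e => by
    rw [extPost_smul_id, smul_ext_residueField_left hx]
  have h : SES (extPost (ResidueField R) n (x • ⊤ : Submodule R N).mkQ)
      (hS.deltaPost (ResidueField R) n) := by
    refine ⟨(injective_iff_map_eq_zero _).2 fun e he => ?_,
      fun e => (hS.post_exact₁ e).1 (h0 _ e), fun e => hS.post_exact₃ e⟩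
    obtain ⟨y, rfl⟩ := (hS.post_exact₂ e).1 he
    exact h0 n y
  have := h.length_eq
  rw [length_ext_residueField_left, length_ext_residueField_left,
    length_ext_residueField_left] at this
  exact_mod_cast this

lemma sum_choose_succ (b : ℕ → ℕ) (s : ℕ) :
    ∑ i ∈ Finset.range (s + 2), (s + 1).choose i * b i =
      ∑ i ∈ Finset.range (s + 1), s.choose i * (b i + b (i + 1)) := by
  rw [Finset.sum_range_succ']
  simp only [Nat.choose_succ_succ, add_mul, mul_add, Finset.sum_add_distrib, Nat.choose_zero_right]
  rw [Finset.sum_range_succ (fun i => s.choose (i + 1) * b (i + 1)),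
    Finset.sum_range_succ' (fun i => s.choose i * b i)]
  simp only [Nat.choose_succ_self, Nat.choose_zero_right]
  ring

/-- Pascal's rule. Hence the binomial sum for `s` is the `j`-th Bass number of `N` modulo a regular
sequence of length `s`. -/
lemma bassSum_quotSMulTop [Module.Finite R N] {x : R} (hx : x ∈ maximalIdeal R)
    (hreg : IsSMulRegular N x) (s j : ℕ) :
    bassSum R (QuotSMulTop x N) s j = bassSum R N (s + 1) j := by
  rw [bassSum, bassSum, sum_choose_succ (fun i => bass R N (j + i))]
  exact Finset.sum_congr rfl fun i _ => by rw [bass_quotSMulTop hx hreg, add_assoc]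

/-- Vanishing of `Ext(L, N)` against a finite length module `L` with few relations forces the
vanishing of `Ext^l(-, N)`, if `N` has a regular sequence of length `dim N`. -/
lemma extVanishes_of_window {L : Type u} [AddCommGroup L] [Module R L] [Module.Finite R L]
    (hL : IsFiniteLength R L) (hlt : (Module.length R L).toNat < 2 * mu R L)
    (rs : List R) (hrs : ∀ x ∈ rs, x ∈ maximalIdeal R) {N : Type u} [AddCommGroup N] [Module R N]
    [Module.Finite R N] (hreg : IsWeaklyRegular N rs)
    (hdim : Module.supportDim R N ≤ (rs.length : ℕ)) {j : ℕ}
    (h : ∀ n, j + 1 ≤ n → n ≤ j + rs.length + bassSum R N rs.length j → ExtVanishes R L N n)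
    (X : Type u) [AddCommGroup X] [Module R X] [Module.Finite R X] :
    ExtVanishes R X N (j + bassSum R N rs.length j) := by
  induction rs generalizing N with
  | nil =>
    obtain ⟨t, ht⟩ := exists_pow_smul_eq_bot_of_supportDim_le (by simpa using hdim)
    simp only [List.length_nil, bassSum_zero, add_zero] at h ⊢
    exact extVanishes_of_bass_eq_zero ht (bass_eq_zero_of_extVanishes hL hlt h) X
  | cons x rs ih =>
    rw [isWeaklyRegular_cons_iff] at hreg
    have hx := hrs x List.mem_cons_self
    rw [List.length_cons] at h ⊢
    rw [← bassSum_quotSMulTop hx hreg.1] at h ⊢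
    refine extVanishes_of_quotSMulTop hx hreg.1 (ih (fun y hy => hrs y (List.mem_cons_of_mem _ hy))
      hreg.2 ?_ fun n h1 h2 => ?_)
    · rw [← Module.supportDim_quotSMulTop_succ_eq_supportDim hreg.1 hx, List.length_cons,
        Nat.cast_add, Nat.cast_one] at hdim
      exact ENat.WithBot.add_le_add_one_right_iff.1 hdim
    -- Each regular element uses up one degree at the upper end of the window, which is why the
    -- window contains the summand `rs.length`.
    · exact (ses_quotSMulTop hreg.1).extVanishes_right₃ (h n h1 (by omega))
        (h (n + 1) (by omega) (by omega))

/-- Dividing `X` by a regular sequence of length `dim X` gives a nonzero module of finite length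
that inherits the eventual vanishing of `Ext(X, N)`. -/
lemma exists_isFiniteLength_extVanishes (rs : List R) (hrs : ∀ x ∈ rs, x ∈ maximalIdeal R) {c : ℕ}
    {X : Type u} [AddCommGroup X] [Module R X] [Module.Finite R X] [Nontrivial X]
    (hreg : IsWeaklyRegular X rs) (hdim : Module.supportDim R X ≤ (rs.length : ℕ))
    (h : ∀ n, c < n → ExtVanishes R X N n) :
    ∃ (Y : Type u) (_ : AddCommGroup Y) (_ : Module R Y), Module.Finite R Y ∧ Nontrivial Y ∧
      IsFiniteLength R Y ∧ ∀ n, c + rs.length < n → ExtVanishes R Y N n := by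
  induction rs generalizing X c with
  | nil =>
    obtain ⟨t, ht⟩ := exists_pow_smul_eq_bot_of_supportDim_le (by simpa using hdim)
    exact ⟨X, _, _, ‹_›, ‹_›, isFiniteLength_of_pow_smul_eq_bot ht, h⟩
  | cons x rs ih =>
    rw [isWeaklyRegular_cons_iff] at hreg
    have hx := hrs x List.mem_cons_self
    have : Nontrivial (QuotSMulTop x X) := by
      by_contra hcon
      rw [not_nontrivial_iff_subsingleton, Submodule.Quotient.subsingleton_iff] at hcon
      refine not_subsingleton X (subsingleton_of_forall_exists_smul hx fun e => ?_)
      have he : e ∈ (x • ⊤ : Submodule R X) := by rw [hcon]; trivial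
      obtain ⟨e', -, h'⟩ := (Submodule.mem_smul_pointwise_iff_exists _ _ _).1 he
      exact ⟨e', h'.symm⟩
    have h1 : ∀ n, c + 1 < n → ExtVanishes R (QuotSMulTop x X) N n := by
      rintro (_ | n) hn
      · omega
      · exact (ses_quotSMulTop hreg.1).extVanishes_left₃ (h n (by omega)) (h (n + 1) (by omega))
    rw [← Module.supportDim_quotSMulTop_succ_eq_supportDim hreg.1 hx, List.length_cons,
        Nat.cast_add, Nat.cast_one] at hdim
    obtain ⟨Y, i1, i2, h3, h4, h5, h6⟩ := ih (fun y hy => hrs y (List.mem_cons_of_mem _ hy)) hreg.2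
      (ENat.WithBot.add_le_add_one_right_iff.1 hdim) h1
    exact ⟨Y, i1, i2, h3, h4, h5, fun n hn => h6 n (by rw [List.length_cons] at hn; omega)⟩

/-- Growth inequality with right-hand side zero; only `μ(Y) ≠ 0` is needed, with no bound on the
length of `Y`. -/
lemma bass_succ_eq_zero [Module.Finite R N] {Y : Type u} [AddCommGroup Y] [Module R Y]
    [Module.Finite R Y] [Nontrivial Y] (hY : IsFiniteLength R Y) {n : ℕ}
    (h : ExtVanishes R Y N (n + 1)) (hn : bass R N n = 0) : bass R N (n + 1) = 0 := by
  have h1 := mu_mul_bass_succ_le hY h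
  rw [hn, mul_zero, mul_zero, add_zero, Nat.le_zero, mul_eq_zero, mu_eq_zero_iff] at h1
  exact h1.resolve_left (not_subsingleton Y)

/-- If the Bass numbers vanish from some point on, so does `Ext(-, N)`. -/
lemma extVanishes_of_forall_bass_eq_zero [Module.Finite R N] {l : ℕ}
    (h : ∀ n, l ≤ n → bass R N n = 0) (I : Ideal R) :
    ∀ n, l ≤ n → ExtVanishes R (R ⧸ I) N n := by
  induction I using IsNoetherian.induction with
  | hgt I ih =>
    intro n hn
    by_cases hI : maximalIdeal R ≤ I
    · by_cases htop : I = ⊤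
      · subst htop
        have : Subsingleton (R ⧸ (⊤ : Ideal R)) := Ideal.Quotient.subsingleton_iff.2 rfl
        exact extVanishes_subsingleton_left n
      · obtain rfl := (IsLocalRing.maximalIdeal.isMaximal R).eq_of_le htop hI
        exact (bass_eq_zero_iff n).1 (h n hn)
    · obtain ⟨x, hxm, hxI⟩ := Set.not_subset.1 hI
      have hlt : I < I ⊔ Ideal.span {x} := by
        refine lt_of_le_of_ne le_sup_left fun heq => hxI ?_
        rw [heq]
        exact Submodule.mem_sup_right (Ideal.mem_span_singleton_self x)
      have hJ := ih _ hlt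
      by_cases hK : I = Submodule.comap (LinearMap.mulLeft R x) I
      · refine subsingleton_of_forall_exists_smul hxm fun e => ?_
        obtain ⟨y, hy⟩ := ((ses_colon hK).pre_exact₁ e).1
          (extVanishes_iff.1 (hJ (n + 1) (by omega)) _)
        refine ⟨y, ?_⟩
        rw [← hy, ← extPre_smul_id]
        congr 1
      -- Otherwise both outer terms of `ses_colon` belong to strictly larger ideals.
      · have hKI : I < Submodule.comap (LinearMap.mulLeft R x) I :=
          lt_of_le_of_ne (fun r hr => Ideal.mul_mem_left I x hr) hK
        exact (ses_colon rfl).extVanishes_left₂ (ih _ hKI n hn) (hJ n hn)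

end Regular

/-! ### Dimension and maximal regular sequences of Cohen-Macaulay modules. -/

section CohenMacaulay

variable {R : Type u} [CommRing R] [IsLocalRing R] [IsNoetherianRing R] {M : Type u}
  [AddCommGroup M] [Module R M]

lemma supportDim_eq_dim [Nontrivial M] : Module.supportDim R M = (dim R M : ℕ) := by
  have h1 : Module.supportDim R M ≠ ⊥ := Module.supportDim_ne_bot_of_nontrivial R M
  have h2 : Module.supportDim R M < ⊤ :=
    (Module.supportDim_le_ringKrullDim R M).trans_lt ringKrullDim_lt_top
  rw [dim]
  generalize Module.supportDim R M = d at *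
  induction d with
  | bot => exact absurd rfl h1
  | coe d =>
    induction d with
    | top => exact absurd rfl h2.ne
    | coe d => rfl

lemma dim_le_ringDim : dim R M ≤ ringDim R := by
  rcases subsingleton_or_nontrivial M with h | h
  · simp [dim, Module.supportDim_eq_bot_of_subsingleton]
  · have h1 := Module.supportDim_le_ringKrullDim R M
    have h2 : ringDim R = dim R R := by rw [ringDim, dim, Module.supportDim_self_eq_ringKrullDim]
    rw [← Module.supportDim_self_eq_ringKrullDim, supportDim_eq_dim, supportDim_eq_dim,
      ← h2] at h1
    exact_mod_cast h1

/-- A Cohen-Macaulay module has a regular sequence of length its dimension. -/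
lemma IsCM.exists_isRegular [Nontrivial M] (h : IsCM R M) :
    ∃ rs : List R, (∀ x ∈ rs, x ∈ maximalIdeal R) ∧ IsRegular M rs ∧ rs.length = dim R M ∧
      (depth R M).toNat = dim R M := by
  have h1 := h.resolve_left (not_subsingleton M)
  rw [supportDim_eq_dim] at h1
  have h2 : depth R M = (dim R M : ℕ) := by exact_mod_cast h1
  have hnil : (∀ x ∈ ([] : List R), x ∈ maximalIdeal R) ∧ IsRegular M ([] : List R) :=
    ⟨by simp, IsRegular.nil R M⟩
  have h3 : ∃ rs : List R, ((∀ x ∈ rs, x ∈ maximalIdeal R) ∧ IsRegular M rs) ∧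
      rs.length = dim R M := by
    -- The supremum defining the depth is attained: otherwise all lengths are at most `dim R M - 1`.
    -- In dimension zero the empty sequence serves.
    by_contra! hcon
    have h4 : depth R M < (dim R M : ℕ) := by
      rcases Nat.eq_zero_or_pos (dim R M) with h0 | h0
      · exact absurd h0.symm (hcon [] hnil)
      · refine lt_of_le_of_lt (b := ((dim R M - 1 : ℕ) : ℕ∞)) ?_ (by exact_mod_cast (by omega))
        refine iSup₂_le fun rs hrs => ?_
        have h5 : (rs.length : ℕ∞) ≤ depth R M :=
          le_iSup₂ (f := fun (rs : List R) (_ : (∀ x ∈ rs, x ∈ maximalIdeal R) ∧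
            IsRegular M rs) => (rs.length : ℕ∞)) rs hrs
        rw [h2] at h5
        have h6 := hcon rs hrs
        norm_cast at h5 ⊢
        omega
    exact h4.ne h2
  obtain ⟨rs, ⟨h4, h5⟩, h6⟩ := h3
  exact ⟨rs, h4, h5, h6, by rw [h2, ENat.toNat_natCast]⟩

end CohenMacaulay
end
end LocalModule

namespace LocalModule
section

open IsLocalRing CategoryTheory Abelian TensorProduct

/-! ### `Tor` through a free resolution cut into short exact sequences. -/

section Resolution

variable {R : Type u} [CommRing R]

/-- A free resolution, cut into short exact sequences
`0 → K (n + 1) → (Fin (b n) → R) → K n → 0`. -/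
structure FreeResolution (R : Type u) [CommRing R] where
  /-- The syzygies. -/
  K : ℕ → ModuleCat.{u} R
  /-- The ranks of the free modules. -/
  b : ℕ → ℕ
  /-- The inclusions of the syzygies. -/
  ι : ∀ n, K (n + 1) →ₗ[R] (Fin (b n) → R)
  /-- The projections onto the syzygies. -/
  π : ∀ n, (Fin (b n) → R) →ₗ[R] K n
  ses : ∀ n, SES (ι n) (π n)

variable (S : FreeResolution R)

/-- The differential of the resolution. -/
def FreeResolution.d (n : ℕ) :
    ModuleCat.of R (Fin (S.b (n + 1)) → R) ⟶ ModuleCat.of R (Fin (S.b n) → R) :=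
  ModuleCat.ofHom (S.ι n ∘ₗ S.π (n + 1))

lemma FreeResolution.d_comp_d (n : ℕ) : S.d (n + 1) ≫ S.d n = 0 := by
  refine ModuleCat.hom_ext (LinearMap.ext fun x => ?_)
  change S.ι n (S.π (n + 1) (S.ι (n + 1) (S.π (n + 2) x))) = 0
  rw [((S.ses (n + 1)).exact _).2 ⟨_, rfl⟩, map_zero]

/-- The chain complex of the resolution. -/
noncomputable def FreeResolution.complex : ChainComplex (ModuleCat.{u} R) ℕ :=
  ChainComplex.of (fun n => ModuleCat.of R (Fin (S.b n) → R)) S.d S.d_comp_d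

lemma FreeResolution.complex_d (n : ℕ) : S.complex.d (n + 1) n = S.d n :=
  by simp [FreeResolution.complex]

lemma FreeResolution.complex_exactAt_succ (n : ℕ) : S.complex.ExactAt (n + 1) := by
  rw [HomologicalComplex.exactAt_iff' _ (n + 2) (n + 1) n (by simp) (by simp),
    ShortComplex.moduleCat_exact_iff]
  intro x hx
  change S.complex.d (n + 1) n x = 0 at hx
  change ∃ y, S.complex.d (n + 2) (n + 1) y = x
  rw [S.complex_d] at hx ⊢
  change S.ι n (S.π (n + 1) x) = 0 at hx
  have h1 : S.π (n + 1) x = 0 := (S.ses n).inj (by rw [hx, map_zero])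
  obtain ⟨y, rfl⟩ := ((S.ses (n + 1)).exact x).1 h1
  obtain ⟨z, rfl⟩ := (S.ses (n + 2)).surj y
  exact ⟨z, rfl⟩

lemma FreeResolution.d_zero_comp_π : S.d 0 ≫ ModuleCat.ofHom (S.π 0) = 0 :=
  ModuleCat.hom_ext (LinearMap.ext fun x => ((S.ses 0).exact _).2 ⟨S.π 1 x, rfl⟩)

lemma quasiIsoAt_zero_toSingle₀ {C : ChainComplex (ModuleCat.{u} R) ℕ} {Z : ModuleCat.{u} R}
    {f : C.X 0 ⟶ Z} (w : C.d 1 0 ≫ f = 0)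
    (h : (ShortComplex.mk (C.d 1 0) f w).Exact ∧ Epi f) :
    QuasiIsoAt ((ChainComplex.toSingle₀Equiv C Z).symm ⟨f, w⟩) 0 := by
  rw [ChainComplex.quasiIsoAt₀_iff, ShortComplex.quasiIso_iff_of_zeros']
  · refine (ShortComplex.exact_and_epi_g_iff_of_iso ?_).2 h
    refine ShortComplex.isoMk (Iso.refl _) (Iso.refl _) (Iso.refl _) ?_ ?_
    · exact (Category.id_comp _).trans (Category.comp_id _).symm
    · refine (Category.id_comp _).trans (Eq.trans ?_ (Category.comp_id _).symm)
      exact (ChainComplex.toSingle₀Equiv_symm_apply_f_zero f w).symm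
  · exact C.shape 0 0 (by simp)
  · rfl
  · rfl

/-- The augmentation of the complex of a free resolution. -/
noncomputable def FreeResolution.augmentation : S.complex.X 0 ⟶ S.K 0 := ModuleCat.ofHom (S.π 0)

lemma FreeResolution.complex_d_comp_augmentation : S.complex.d 1 0 ≫ S.augmentation = 0 := by
  rw [S.complex_d]; exact S.d_zero_comp_π

lemma FreeResolution.exact_augmentation :
    (ShortComplex.mk (S.complex.d 1 0) S.augmentation S.complex_d_comp_augmentation).Exact ∧
      Epi S.augmentation := by
  refine ⟨?_, (ModuleCat.epi_iff_surjective _).2 (S.ses 0).surj⟩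
  rw [ShortComplex.moduleCat_exact_iff]
  intro x hx
  obtain ⟨y, rfl⟩ := ((S.ses 0).exact x).1 hx
  obtain ⟨z, rfl⟩ := (S.ses 1).surj y
  refine ⟨z, ?_⟩
  change (S.complex.d 1 0).hom z = _
  rw [S.complex_d]
  rfl

/-- The associated projective resolution. -/
noncomputable def FreeResolution.projectiveResolution : ProjectiveResolution (S.K 0) where
  complex := S.complex
  projective n := inferInstanceAs (Projective (ModuleCat.of R (Fin (S.b n) → R)))
  π := (ChainComplex.toSingle₀Equiv _ _).symm ⟨S.augmentation, S.complex_d_comp_augmentation⟩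
  quasiIso := ⟨fun n => by
    cases n
    · exact quasiIsoAt_zero_toSingle₀ S.complex_d_comp_augmentation
        S.exact_augmentation
    · rw [quasiIsoAt_iff_exactAt']
      · apply S.complex_exactAt_succ
      · apply ChainComplex.exactAt_succ_single_obj⟩

variable {M : Type u} [AddCommGroup M] [Module R M]

lemma FreeResolution.exactAt_of_torVanishes {n : ℕ} (h : TorVanishes R M (S.K 0) n) :
    ((((MonoidalCategory.tensoringLeft (ModuleCat.{u} R)).obj
      (ModuleCat.of R M)).mapHomologicalComplex _).obj S.complex).ExactAt n := by
  rw [HomologicalComplex.exactAt_iff_isZero_homology]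
  exact Limits.IsZero.of_iso h (S.projectiveResolution.isoLeftDerivedObj _ n).symm

/-- Lift an element of the kernel to `M ⊗ F_{n+1}`. The lift is a cycle, hence a boundary, and
boundaries vanish in `M ⊗ K (n + 1)`. -/
lemma FreeResolution.injective_of_torVanishes {n : ℕ} (h : TorVanishes R M (S.K 0) (n + 1)) :
    Function.Injective ((S.ι n).lTensor M) := by
  have h1 := S.exactAt_of_torVanishes h
  rw [HomologicalComplex.exactAt_iff' _ (n + 2) (n + 1) n (by simp) (by simp),
    ShortComplex.moduleCat_exact_iff] at h1
  have h2 : ∀ x : M ⊗[R] (Fin (S.b (n + 1)) → R), (S.ι n ∘ₗ S.π (n + 1)).lTensor M x = 0 →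
      ∃ y, (S.ι (n + 1) ∘ₗ S.π (n + 2)).lTensor M y = x := by
    intro x hx
    have h3 := h1 x
    change (((MonoidalCategory.tensoringLeft (ModuleCat.{u} R)).obj
      (ModuleCat.of R M)).map (S.complex.d (n + 1) n)) x = 0 → ∃ y,
      (((MonoidalCategory.tensoringLeft (ModuleCat.{u} R)).obj
      (ModuleCat.of R M)).map (S.complex.d (n + 2) (n + 1))) y = x at h3
    rw [S.complex_d, S.complex_d] at h3
    exact h3 hx
  refine (injective_iff_map_eq_zero _).2 fun u hu => ?_
  obtain ⟨x, rfl⟩ := LinearMap.lTensor_surjective M (S.ses (n + 1)).surj u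
  obtain ⟨y, rfl⟩ := h2 x (by rw [LinearMap.lTensor_comp, LinearMap.comp_apply, hu])
  rw [← LinearMap.comp_apply, ← LinearMap.lTensor_comp, ← LinearMap.comp_assoc,
    (S.ses (n + 1)).comp_eq_zero, LinearMap.zero_comp, LinearMap.lTensor_zero,
    LinearMap.zero_apply]

lemma FreeResolution.subsingleton_of_torVanishes (h : TorVanishes R M (S.K 0) 0) :
    Subsingleton (M ⊗[R] S.K 0) := by
  have h1 := S.exactAt_of_torVanishes h
  rw [HomologicalComplex.exactAt_iff' _ 1 0 0 (by simp) (by simp),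
    ShortComplex.moduleCat_exact_iff] at h1
  have h2 : ∀ x : M ⊗[R] (Fin (S.b 0) → R), ∃ y, (S.ι 0 ∘ₗ S.π 1).lTensor M y = x := by
    intro x
    have h3 := h1 x
    change (((MonoidalCategory.tensoringLeft (ModuleCat.{u} R)).obj
      (ModuleCat.of R M)).map (S.complex.d 0 0)) x = 0 → ∃ y,
      (((MonoidalCategory.tensoringLeft (ModuleCat.{u} R)).obj
      (ModuleCat.of R M)).map (S.complex.d 1 0)) y = x at h3
    rw [S.complex_d, S.complex.shape 0 0 (by simp), Functor.map_zero] at h3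
    exact h3 rfl
  refine subsingleton_of_forall_eq 0 fun u => ?_
  obtain ⟨x, rfl⟩ := LinearMap.lTensor_surjective M (S.ses 0).surj u
  obtain ⟨y, rfl⟩ := h2 x
  rw [← LinearMap.comp_apply, ← LinearMap.lTensor_comp, ← LinearMap.comp_assoc,
    (S.ses 0).comp_eq_zero, LinearMap.zero_comp, LinearMap.lTensor_zero,
    LinearMap.zero_apply]

/-- The vanishing of `Tor_n(M, K 0)`, expressed through the resolution. -/
def FreeResolution.TensorExact (M : Type u) [AddCommGroup M] [Module R M] : ℕ → Prop
  | 0 => Subsingleton (M ⊗[R] S.K 0)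
  | n + 1 => Function.Injective ((S.ι n).lTensor M)

lemma FreeResolution.tensorExact_of_torVanishes {n : ℕ} (h : TorVanishes R M (S.K 0) n) :
    S.TensorExact M n := by
  cases n with
  | zero => exact S.subsingleton_of_torVanishes h
  | succ n => exact S.injective_of_torVanishes h

variable {A B C : Type u} [AddCommGroup A] [Module R A] [AddCommGroup B] [Module R B]
  [AddCommGroup C] [Module R C] {f : A →ₗ[R] B} {g : B →ₗ[R] C}

lemma FreeResolution.TensorExact.of_surjective (hg : Function.Surjective g)
    (h : S.TensorExact B 0) : S.TensorExact C 0 := by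
  have : Subsingleton (B ⊗[R] S.K 0) := h
  exact (LinearMap.rTensor_surjective (S.K 0) hg).subsingleton

/-- For positive `n`, `A ⊗ K n` embeds in `A ⊗ F_{n-1}`, and tensoring with a free module preserves
the injectivity of `f`. -/
lemma FreeResolution.TensorExact.rTensor_injective (hf : Function.Injective f) {n : ℕ}
    (h : S.TensorExact A n) : Function.Injective (f.rTensor (S.K n)) := by
  cases n with
  | zero =>
    have : Subsingleton (A ⊗[R] S.K 0) := h
    exact Function.injective_of_subsingleton _
  | succ n =>
    have h1 : Function.Injective (f.rTensor (Fin (S.b n) → R) ∘ₗ (S.ι n).lTensor A) :=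
      (Module.Flat.rTensor_preserves_injective_linearMap f hf).comp h
    rw [LinearMap.rTensor_comp_lTensor, ← LinearMap.lTensor_comp_rTensor] at h1
    exact Function.Injective.of_comp h1

/-- The step of the long exact sequence of `Tor` that passes to a cokernel. -/
lemma FreeResolution.TensorExact.coker (h : SES f g) {n : ℕ} (hA : S.TensorExact A n)
    (hB : S.TensorExact B (n + 1)) : S.TensorExact C (n + 1) := by
  refine (injective_iff_map_eq_zero ((S.ι n).lTensor C)).2 fun z hz => ?_
  obtain ⟨z, rfl⟩ := LinearMap.rTensor_surjective (S.K (n + 1)) h.surj z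
  have hfg : Function.Exact f g := fun x => h.exact x
  have hιπ : Function.Exact (S.ι n) (S.π n) := fun x => (S.ses n).exact x
  rw [← LinearMap.comp_apply, LinearMap.lTensor_comp_rTensor, ← LinearMap.rTensor_comp_lTensor,
    LinearMap.comp_apply] at hz
  -- A snake chase: `w` in `A ⊗ F_n` dies in `A ⊗ K n`, because `A ⊗ K n → B ⊗ K n` is injective, so
  -- it comes from some `v` in `A ⊗ K (n + 1)`. By `hB`, `v` maps to `z`, which then vanishes in `C
  -- ⊗ K (n + 1)`.
  obtain ⟨w, hw⟩ := (rTensor_exact (Fin (S.b n) → R) hfg h.surj _).1 hz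
  have h1 : (S.π n).lTensor A w = 0 := by
    refine (injective_iff_map_eq_zero _).1 (hA.rTensor_injective S h.inj) _ ?_
    rw [← LinearMap.comp_apply, LinearMap.rTensor_comp_lTensor, ← LinearMap.lTensor_comp_rTensor,
      LinearMap.comp_apply, hw, ← LinearMap.comp_apply, ← LinearMap.lTensor_comp,
      (S.ses n).comp_eq_zero, LinearMap.lTensor_zero, LinearMap.zero_apply]
  obtain ⟨v, rfl⟩ := (lTensor_exact A hιπ (S.ses n).surj _).1 h1
  rw [← LinearMap.comp_apply, LinearMap.rTensor_comp_lTensor, ← LinearMap.lTensor_comp_rTensor,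
    LinearMap.comp_apply] at hw
  rw [← hB hw, ← LinearMap.comp_apply, ← LinearMap.rTensor_comp, h.comp_eq_zero,
    LinearMap.rTensor_zero, LinearMap.zero_apply]

lemma FreeResolution.TensorExact.pi {n : ℕ} (h : S.TensorExact A n) (D : ℕ) :
    S.TensorExact (Fin D → A) n := by
  cases n with
  | zero =>
    have : Subsingleton (A ⊗[R] S.K 0) := h
    exact (TensorProduct.piLeft R (S.K 0) (fun _ : Fin D => A)).toEquiv.subsingleton
  | succ n =>
    refine (injective_iff_map_eq_zero ((S.ι n).lTensor (Fin D → A))).2 fun z hz => ?_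
    refine (TensorProduct.piLeft R (S.K (n + 1)) (fun _ : Fin D => A)).map_eq_zero_iff.1 ?_
    have key : ∀ (z : (Fin D → A) ⊗[R] S.K (n + 1)) (i : Fin D),
        TensorProduct.piLeft R (Fin (S.b n) → R) (fun _ : Fin D => A)
          ((S.ι n).lTensor (Fin D → A) z) i = (S.ι n).lTensor A
          (TensorProduct.piLeft R (S.K (n + 1)) (fun _ : Fin D => A) z i) := by
      intro z i
      induction z with
      | zero => simp
      | add x y hx hy => simp only [map_add, Pi.add_apply, hx, hy]
      | tmul x y => simp
    refine funext fun i => (injective_iff_map_eq_zero _).1 h _ ?_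
    rw [← key, hz, map_zero, Pi.zero_apply]

end Resolution
end
end LocalModule

namespace LocalModule
section

open IsLocalRing CategoryTheory Abelian TensorProduct

/-! ### Lengths of `Hom` modules. -/

section ExtZero

variable {R : Type u} [CommRing R] {L : Type u} [AddCommGroup L] [Module R L]

variable (R L) in
/-- `Hom_R(R, L) = L`, as an `Ext` group. -/
noncomputable def extRingEquiv : L ≃ₗ[R] ExtModule R R L 0 :=
  LinearEquiv.ofBijective
    { toFun := fun x => Ext.mk₀ (ModuleCat.ofHom (LinearMap.toSpanSingleton R L x))
      map_add' := fun x y => by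
        rw [← Ext.mk₀_add, ← ModuleCat.ofHom_add]
        congr 2
        exact LinearMap.toSpanSingleton_add x y
      map_smul' := fun r x => by
        rw [RingHom.id_apply, ← Ext.mk₀_smul]
        congr 1
        refine ModuleCat.hom_ext (LinearMap.ext fun a => ?_)
        exact smul_comm a r x }
    ⟨fun x y hxy => by
      have h := Ext.homEquiv₀.symm.injective hxy
      have h1 := congrArg (fun z : ModuleCat.of R R ⟶ ModuleCat.of R L => z.hom (1 : R)) h
      simpa using h1,
    fun e => by
      obtain ⟨f, rfl⟩ := Ext.homEquiv₀.symm.surjective e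
      refine ⟨f.hom (1 : R), ?_⟩
      change Ext.mk₀ _ = Ext.mk₀ f
      congr 1
      refine ModuleCat.hom_ext (LinearMap.ext fun a => ?_)
      change a • f.hom (1 : R) = f.hom a
      rw [← map_smul, smul_eq_mul, mul_one]⟩

lemma length_ext_free_zero (b : ℕ) :
    Module.length R (ExtModule R (Fin b → R) L 0) = b * Module.length R L := by
  rw [(extPiPre R L 0 b).length_eq, Module.length_pi, ← (extRingEquiv R L).length_eq,
    ENat.card_eq_coe_fintype_card, Fintype.card_fin]

lemma length_add_le_of_comp_eq_zero {A B C : Type*} [AddCommGroup A] [Module R A] [AddCommGroup B]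
    [Module R B] [AddCommGroup C] [Module R C] {f : A →ₗ[R] B} {g : B →ₗ[R] C}
    (hf : Function.Injective f) (hg : Function.Surjective g) (h : ∀ x, g (f x) = 0) :
    Module.length R A + Module.length R C ≤ Module.length R B := by
  rw [(SES.of_surjective hg).length_eq]
  gcongr
  exact Module.length_le_of_injective (f.codRestrict (LinearMap.ker g) h) fun x y hxy =>
    hf (congrArg Subtype.val hxy)

end ExtZero

/-! ### Minimal syzygies and the growth of Betti numbers. -/

section Betti

variable {R : Type u} [CommRing R] [IsLocalRing R] {N K L : Type u}
  [AddCommGroup N] [Module R N] [AddCommGroup K] [Module R K] [AddCommGroup L] [Module R L]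
  {b : ℕ} {ι : K →ₗ[R] (Fin b → R)} {π : (Fin b → R) →ₗ[R] N}

/-- A map from the free module to the residue field kills vectors with entries in `𝔪`; higher `Ext`
of a free module is zero. -/
lemma extPre_eq_zero_of_minimal (hmin : ∀ x i, ι x i ∈ maximalIdeal R) (n : ℕ)
    (e : ExtModule R (Fin b → R) (ResidueField R) n) : extPre (ResidueField R) n ι e = 0 := by
  cases n with
  | zero =>
    obtain ⟨f, rfl⟩ := Ext.homEquiv₀.symm.surjective e
    rw [Ext.homEquiv₀_symm_apply, extPre_apply, Ext.mk₀_comp_mk₀]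
    have : ModuleCat.ofHom ι ≫ f = 0 := by
      refine ModuleCat.hom_ext (LinearMap.ext fun x => ?_)
      change f.hom (ι x) = 0
      rw [pi_eq_sum_univ' (ι x), map_sum]
      exact Finset.sum_eq_zero fun i _ => by rw [map_smul]; exact smul_residueField (hmin x i) _
    rw [this, Ext.mk₀_zero]
  | succ n => rw [extVanishes_iff.1 (extVanishes_projective n) e, map_zero]

variable (R N) in
/-- A minimal cover by a free module. -/
noncomputable def minimalCover [Module.Finite R N] : (Fin (mu R N) → R) →ₗ[R] N :=
  (exists_minimal_cover R N).choose

lemma minimalCover_ses [Module.Finite R N] :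
    SES (LinearMap.ker (minimalCover R N)).subtype (minimalCover R N) :=
  SES.of_surjective (exists_minimal_cover R N).choose_spec.1

lemma minimalCover_minimal [Module.Finite R N] (x : LinearMap.ker (minimalCover R N))
    (i : Fin (mu R N)) : x.1 i ∈ maximalIdeal R :=
  (exists_minimal_cover R N).choose_spec.2 x x.2 i

lemma extVanishes_ker_minimalCover [Module.Finite R N] {n : ℕ} (h : ExtVanishes R N L (n + 2)) :
    ExtVanishes R (LinearMap.ker (minimalCover R N)) L (n + 1) :=
  (minimalCover_ses (R := R) (N := N)).extVanishes_left₁ (extVanishes_projective n) h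

/-- The inequality of ranks given by the vanishing of `Tor_1(L, N)`. -/
lemma mu_mul_mu_le [Module.Finite R L] [Module.Finite R K] (hL : IsFiniteLength R L)
    (hmin : ∀ x i, ι x i ∈ maximalIdeal R) (h : Function.Injective (ι.lTensor L)) :
    mu R L * mu R K + mu R L * b ≤ (Module.length R L).toNat * b := by
  obtain ⟨p, hp, hpk⟩ := exists_surjective_pi_residueField R L
  obtain ⟨q, hq, -⟩ := exists_surjective_pi_residueField R K
  let W : Submodule R L := LinearMap.ker p
  let e := TensorProduct.piScalarRight R R L (Fin b)
  have hmem : ∀ (z : L ⊗[R] K) (i : Fin b), e (ι.lTensor L z) i ∈ W := by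
    intro z i
    induction z with
    | zero => simp
    | add x y hx hy =>
      rw [map_add, map_add]
      exact add_mem hx hy
    | tmul l x =>
      have : e (ι.lTensor L (l ⊗ₜ x)) i = ι x i • l := by simp [e]
      rw [this]
      change _ ∈ LinearMap.ker p
      rw [hpk]
      exact Submodule.smul_mem_smul (hmin x i) trivial
  -- Since the entries of `ι` are in `𝔪`, the embedding of `L ⊗ K` in `L^b` lands in `(𝔪L)^b`.
  let ψ : L ⊗[R] K →ₗ[R] (Fin b → W) := LinearMap.pi fun i =>
    LinearMap.codRestrict W (LinearMap.proj i ∘ₗ e.toLinearMap ∘ₗ ι.lTensor L) fun z => hmem z i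
  have hψ : Function.Injective ψ := fun x y hxy => h <| e.injective <| funext fun i =>
    congrArg Subtype.val (congrFun hxy i)
  -- The surjection onto `(L/𝔪L) ⊗ (K/𝔪K)`, of length `μ(L) μ(K)`, bounds the length of `L ⊗ K` from
  -- below.
  let χ : L ⊗[R] K →ₗ[R] (Fin (mu R L) → Fin (mu R K) → ResidueField R) :=
    TensorProduct.lift (LinearMap.mk₂ R (fun l x i j => p l i * q x j)
      (fun _ _ _ => by ext; simp [add_mul]) (fun _ _ _ => by ext; simp)
      (fun _ _ _ => by ext; simp [mul_add]) (fun _ _ _ => by ext; simp))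
  have hχ : Function.Surjective χ := by
    intro y
    choose l hl using fun i => hp (Pi.single i 1)
    choose x hx using fun i => hq (y i)
    refine ⟨∑ i, l i ⊗ₜ x i, ?_⟩
    ext i j
    simp [χ, hl, hx, Pi.single_apply]
  have h1 := (Module.length_le_of_surjective χ hχ).trans (Module.length_le_of_injective ψ hψ)
  have hlen := (SES.of_surjective hp).length_eq
  have hW : IsFiniteLength R W := hL.of_injective W.subtype_injective
  rw [length_pi_residueField] at hlen
  rw [Module.length_pi, Module.length_pi, Module.length_pi, Module.length_eq_one, 
    ENat.card_eq_coe_fintype_card, ENat.card_eq_coe_fintype_card, ENat.card_eq_coe_fintype_card,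
    Fintype.card_fin, Fintype.card_fin, Fintype.card_fin, mul_one] at h1
  rw [← Module.length_ne_top_iff] at hW
  change _ = Module.length R W + _ at hlen
  lift Module.length R W to ℕ using hW with w
  rw [hlen, ← Nat.cast_add, ENat.toNat_natCast]
  norm_cast at h1
  linarith

variable [IsNoetherianRing R]

lemma betti_succ_of_minimal [Module.Finite R N] [Module.Finite R K] (hS : SES ι π)
    (hmin : ∀ x i, ι x i ∈ maximalIdeal R) (n : ℕ) : betti R N (n + 1) = betti R K n := by
  have hbij : Function.Bijective (hS.deltaPre (ResidueField R) n) := by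
    refine ⟨(injective_iff_map_eq_zero _).2 fun x hx => ?_, fun x => ?_⟩
    · obtain ⟨y, rfl⟩ := (hS.pre_exact₁ x).1 hx
      exact extPre_eq_zero_of_minimal hmin n y
    · exact (hS.pre_exact₃ x).1 (extVanishes_iff.1 (extVanishes_projective n) _)
  have := (LinearEquiv.ofBijective _ hbij).length_eq
  rw [length_ext_residueField_right, length_ext_residueField_right] at this
  exact_mod_cast this.symm

lemma betti_zero_of_minimal [Module.Finite R N] (hS : SES ι π)
    (hmin : ∀ x i, ι x i ∈ maximalIdeal R) : betti R N 0 = b := by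
  have hbij : Function.Bijective (extPre (ResidueField R) 0 π) :=
    ⟨hS.pre_injective, fun x => (hS.pre_exact₂ x).1 (extPre_eq_zero_of_minimal hmin 0 x)⟩
  have := (LinearEquiv.ofBijective _ hbij).length_eq
  rw [length_ext_residueField_right, length_ext_free_zero, Module.length_eq_one, mul_one] at this
  exact_mod_cast this

lemma betti_zero [Module.Finite R N] : betti R N 0 = mu R N :=
  betti_zero_of_minimal minimalCover_ses minimalCover_minimal

lemma betti_succ [Module.Finite R N] (n : ℕ) :
    betti R N (n + 1) = betti R (LinearMap.ker (minimalCover R N)) n :=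
  betti_succ_of_minimal minimalCover_ses minimalCover_minimal n

/-- The `n`-th minimal syzygy is generated by `betti R N n` elements, so it is zero. -/
lemma hasProjectiveDimensionLT_of_betti_eq_zero {N : Type u} [AddCommGroup N] [Module R N]
    [Module.Finite R N] {n : ℕ} (h : betti R N n = 0) :
    HasProjectiveDimensionLT (ModuleCat.of R N) n := by
  induction n generalizing N with
  | zero =>
    rw [betti_zero, mu_eq_zero_iff] at h
    exact (ModuleCat.isZero_of_subsingleton (ModuleCat.of R N)).hasProjectiveDimensionLT_zero
  | succ n ih =>
    rw [betti_succ] at h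
    have : HasProjectiveDimensionLT (ModuleCat.of R (Fin (mu R N) → R)) 1 := inferInstance
    exact (minimalCover_ses (R := R) (N := N)).shortExact.hasProjectiveDimensionLT_X₃ n (ih h)
      (hasProjectiveDimensionLT_of_ge _ 1 _ (by omega))

lemma finitePd_of_betti_eq_zero [Module.Finite R N] {n : ℕ} (h : betti R N n = 0) :
    FinitePd R N :=
  finitePd_of_hasProjectiveDimensionLT (hasProjectiveDimensionLT_of_betti_eq_zero h)

/-- Let `K` be the first syzygy in `F`. As `Ext^1(N, L) = 0`, the map `Hom(F, L) → Hom(K, L)` is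
onto. It kills `Hom(F/𝔪F, L)`, which is `β_0` copies of the socle of `L`, while `Hom(K, L)` contains
`Hom(K/𝔪K, L)`, which is `β_1` copies. -/
lemma bass_mul_betti_one_le [Module.Finite R N] [Module.Finite R L] (hL : IsFiniteLength R L)
    (h : ExtVanishes R N L 1) :
    bass R L 0 * betti R N 1 + bass R L 0 * betti R N 0 ≤
      (Module.length R L).toNat * betti R N 0 := by
  have hS := minimalCover_ses (R := R) (N := N)
  obtain ⟨q, hq, -⟩ := exists_surjective_pi_residueField R (LinearMap.ker (minimalCover R N))
  have h1 := Module.length_le_of_injective (extPre L 0 q) (SES.of_surjective hq).pre_injective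
  let p : (Fin (mu R N) → R) →ₗ[R] (Fin (mu R N) → ResidueField R) :=
    LinearMap.pi fun i => (Algebra.linearMap R (ResidueField R)) ∘ₗ LinearMap.proj i
  have hp : Function.Surjective p := fun y =>
    ⟨fun i => (residue_surjective (y i)).choose,
      funext fun i => (residue_surjective (y i)).choose_spec⟩
  have hpK : p ∘ₗ (LinearMap.ker (minimalCover R N)).subtype = 0 := LinearMap.ext fun x =>
    funext fun i => Ideal.Quotient.eq_zero_iff_mem.2 (minimalCover_minimal x i)
  have h2 := length_add_le_of_comp_eq_zero (f := extPre L 0 p)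
    (g := extPre L 0 (LinearMap.ker (minimalCover R N)).subtype)
    (SES.of_surjective hp).pre_injective
    (fun x => (hS.pre_exact₁ x).1 (extVanishes_iff.1 h _))
    (fun x => by rw [extPre_extPre, hpK, extPre_zero])
  have h3 := (add_le_add le_rfl h1).trans h2
  rw [length_ext_free_zero, (extPiPre _ L 0 _).length_eq, (extPiPre _ L 0 _).length_eq,
    Module.length_pi, Module.length_pi, length_ext_residueField_left, ENat.card_eq_coe_fintype_card,
    ENat.card_eq_coe_fintype_card, Fintype.card_fin, Fintype.card_fin] at h3
  rw [← betti_zero (N := LinearMap.ker (minimalCover R N)), ← betti_succ] at h3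
  rw [betti_zero]
  rw [← Module.length_ne_top_iff] at hL
  lift Module.length R L to ℕ using hL with l
  rw [ENat.toNat_natCast]
  norm_cast at h3
  linarith

lemma bass_mul_betti_succ_le {N : Type u} [AddCommGroup N] [Module R N] [Module.Finite R N]
    [Module.Finite R L] (hL : IsFiniteLength R L) {n : ℕ} (h : ExtVanishes R N L (n + 1)) :
    bass R L 0 * betti R N (n + 1) + bass R L 0 * betti R N n ≤
      (Module.length R L).toNat * betti R N n := by
  induction n generalizing N with
  | zero => exact bass_mul_betti_one_le hL h
  | succ n ih =>
    have := ih (N := LinearMap.ker (minimalCover R N)) (extVanishes_ker_minimalCover h)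
    rwa [← betti_succ, ← betti_succ] at this

variable (R N) in
/-- The minimal syzygies, with their finiteness. -/
noncomputable def syzygy [Module.Finite R N] : ℕ → {X : ModuleCat.{u} R // Module.Finite R X}
  | 0 => ⟨ModuleCat.of R N, ‹_›⟩
  | n + 1 =>
    have := (syzygy n).2
    ⟨ModuleCat.of R (LinearMap.ker (minimalCover R (syzygy n).1)), inferInstance⟩

instance finite_syzygy [Module.Finite R N] (n : ℕ) : Module.Finite R (syzygy R N n).1 :=
  (syzygy R N n).2

lemma betti_syzygy [Module.Finite R N] (n i : ℕ) :
    betti R (syzygy R N n).1 i = betti R N (n + i) := by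
  induction n generalizing i with
  | zero => rw [zero_add]; rfl
  | succ n ih =>
    rw [show n + 1 + i = n + (i + 1) by omega, ← ih, betti_succ]
    rfl

lemma mu_syzygy [Module.Finite R N] (n : ℕ) : mu R (syzygy R N n).1 = betti R N n := by
  rw [← betti_zero, betti_syzygy, add_zero]

variable (R N) in
/-- The minimal free resolution. -/
noncomputable def minimalResolution [Module.Finite R N] : FreeResolution R where
  K n := (syzygy R N n).1
  b n := mu R (syzygy R N n).1
  ι n := (LinearMap.ker (minimalCover R (syzygy R N n).1)).subtype
  π n := minimalCover R (syzygy R N n).1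
  ses _ := minimalCover_ses

/-- The growth of the Betti numbers of `N` is bounded by the vanishing of `Tor_{n+1}(L, N)`. -/
lemma mu_mul_betti_succ_le [Module.Finite R N] [Module.Finite R L] (hL : IsFiniteLength R L) {n : ℕ}
    (h : (minimalResolution R N).TensorExact L (n + 1)) :
    mu R L * betti R N (n + 1) + mu R L * betti R N n ≤
      (Module.length R L).toNat * betti R N n := by
  rw [← mu_syzygy, ← mu_syzygy]
  exact mu_mul_mu_le (ι := (minimalResolution R N).ι n) hL
    (fun x i => minimalCover_minimal (N := (syzygy R N n).1) x i) h

end Betti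
end
end LocalModule

namespace LocalModule
section

open IsLocalRing CategoryTheory Abelian Filter Topology Asymptotics

/-! ### The cokernel of an injective endomorphism has smaller dimension. -/

section Dimension

variable {R : Type u} [CommRing R] [IsNoetherianRing R] {P : Type u} [AddCommGroup P] [Module R P]
  [Module.Finite R P] {φ : P →ₗ[R] P}

/-- At a minimal prime of its support, a finitely generated module has finite length. -/
lemma isFiniteLength_localizedModule (p : PrimeSpectrum R)
    (hp : p.asIdeal ∈ (Module.annihilator R P).minimalPrimes) :
    IsFiniteLength (Localization.AtPrime p.asIdeal) (LocalizedModule p.asIdeal.primeCompl P) := by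
  refine exists_imp.2 (fun t ht => isFiniteLength_of_pow_smul_eq_bot (t := t) ht)
    (exists_pow_smul_eq_bot_of_forall_prime fun q hq hann => ?_)
  have hqp : q.comap (algebraMap R (Localization.AtPrime p.asIdeal)) ≤ p.asIdeal := by
    intro a ha
    by_contra hap
    exact hq.ne_top (Ideal.eq_top_of_isUnit_mem q ha
      (IsLocalization.map_units (M := p.asIdeal.primeCompl) _ ⟨a, hap⟩))
  have hle : Module.annihilator R P ≤
      q.comap (algebraMap R (Localization.AtPrime p.asIdeal)) := by
    intro a ha
    refine hann (Module.mem_annihilator.2 fun z => ?_)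
    induction z with
    | h x s =>
      rw [algebraMap_smul, LocalizedModule.smul'_mk, Module.mem_annihilator.1 ha x,
        LocalizedModule.zero_mk]
  have := hp.2 ⟨Ideal.IsPrime.comap _, hle⟩ hqp
  rw [← Localization.AtPrime.map_eq_maximalIdeal]
  exact Ideal.map_le_iff_le_comap.2 this

/-- The cokernel of an injective endomorphism is not supported at minimal primes. -/
lemma notMem_support_coker (hφ : Function.Injective φ) (p : PrimeSpectrum R)
    (hp : p.asIdeal ∈ (Module.annihilator R P).minimalPrimes) :
    p ∉ Module.support R (P ⧸ LinearMap.range φ) := by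
  rw [Module.notMem_support_iff']
  intro c
  obtain ⟨x, rfl⟩ := Submodule.mkQ_surjective _ c
  have hfin := isFiniteLength_iff_isNoetherian_isArtinian.1 (isFiniteLength_localizedModule p hp)
  have := hfin.2
  -- After localization at `p` the module has finite length, where an injective endomorphism is
  -- surjective; so the cokernel vanishes at `p`.
  have hsurj := IsArtinian.surjective_of_injective_endomorphism
    (LocalizedModule.map p.asIdeal.primeCompl φ) (LocalizedModule.map_injective _ φ hφ)
  obtain ⟨z, hz⟩ := hsurj (LocalizedModule.mk x 1)
  induction z with
  | h y s =>
    rw [LocalizedModule.map_mk, LocalizedModule.mk_eq] at hz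
    obtain ⟨v, hv⟩ := hz
    refine ⟨(v * s : p.asIdeal.primeCompl), (v * s).2, ?_⟩
    rw [← map_smul, Submodule.mkQ_apply, Submodule.Quotient.mk_eq_zero]
    refine ⟨v • y, ?_⟩
    rw [one_smul] at hv
    rw [Submonoid.coe_mul, mul_smul]
    exact (φ.map_smul (v : R) y).trans hv

/-- A chain of primes in the support of the cokernel starts at a prime that is not minimal over the
annihilator of `P`, so in the support of `P` it extends downwards by one. -/
lemma supportDim_coker_le (hφ : Function.Injective φ) {r : ℕ}
    (h : Module.supportDim R P ≤ (r + 1 : ℕ)) :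
    Module.supportDim R (P ⧸ LinearMap.range φ) ≤ r := by
  refine iSup_le fun p => ?_
  have le : Module.support R (P ⧸ LinearMap.range φ) ⊆ Module.support R P :=
    Module.support_subset_of_surjective (LinearMap.range φ).mkQ (Submodule.mkQ_surjective _)
  let q : LTSeries (Module.support R P) :=
    p.map (Set.MapsTo.restrict id _ (Module.support R P) le) (fun _ _ h ↦ h)
  obtain ⟨a, ham, ha⟩ :=
    Ideal.exists_minimalPrimes_le (Module.mem_support_iff_of_finite.mp q.head.2)
  let a' : Module.support R P := ⟨⟨a, ham.isPrime⟩, Module.mem_support_iff_of_finite.mpr ham.1.2⟩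
  have hlt : a' < q.head := lt_of_le_of_ne ha fun heq =>
    notMem_support_coker hφ q.head.1 (heq ▸ ham) p.head.2
  have hlen : (q.cons a' hlt).length = p.length + 1 := by
    rw [RelSeries.cons_length]; rfl
  have h1 : (((q.cons a' hlt).length : ℕ) : WithBot ℕ∞) ≤ (r + 1 : ℕ) :=
    (le_iSup (fun s : LTSeries (Module.support R P) => ((s.length : ℕ) : WithBot ℕ∞))
      (q.cons a' hlt)).trans h
  rw [hlen] at h1
  have h2 : p.length + 1 ≤ r + 1 := by exact_mod_cast h1
  exact_mod_cast (by omega : p.length ≤ r)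

end Dimension

/-! ### Hilbert functions of cokernels and powers. -/

section Hilbert

variable {R : Type u} [CommRing R] {I : Ideal R} {M P : Type u} [AddCommGroup M] [Module R M]
  [AddCommGroup P] [Module R P] {φ : P →ₗ[R] P}

lemma mem_pow_smul_of_mem_smul_end (hφ : φ ∈ (I • ⊤ : Submodule R (P →ₗ[R] P))) {n : ℕ} {x : P}
    (hx : x ∈ (I ^ n • ⊤ : Submodule R P)) : φ x ∈ (I ^ (n + 1) • ⊤ : Submodule R P) := by
  induction hφ using Submodule.smul_induction_on' with
  | smul a ha f _ =>
    rw [LinearMap.smul_apply, pow_succ', mul_smul]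
    refine Submodule.smul_mem_smul ha ?_
    have h1 : f x ∈ (I ^ n • ⊤ : Submodule R P).map f := ⟨x, hx, rfl⟩
    rw [Submodule.map_smul''] at h1
    exact Submodule.smul_mono le_rfl le_top h1
  | add f _ g _ hf hg => exact add_mem hf hg

lemma mem_pow_smul_coker_iff (n : ℕ) (x : P) :
    (LinearMap.range φ).mkQ x ∈ (I ^ n • ⊤ : Submodule R (P ⧸ LinearMap.range φ)) ↔
      ∃ y, x - φ y ∈ (I ^ n • ⊤ : Submodule R P) := by
  have : (I ^ n • ⊤ : Submodule R (P ⧸ LinearMap.range φ)) =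
      (I ^ n • ⊤ : Submodule R P).map (LinearMap.range φ).mkQ := by
    rw [Submodule.map_smul'', Submodule.map_top, Submodule.range_mkQ]
  rw [this]
  constructor
  · rintro ⟨z, hz, hzx⟩
    rw [Submodule.mkQ_apply, Submodule.mkQ_apply, Submodule.Quotient.eq] at hzx
    obtain ⟨y, hy⟩ := hzx
    exact ⟨-y, by rw [map_neg, hy]; simpa using hz⟩
  · rintro ⟨y, hy⟩
    refine ⟨_, hy, ?_⟩
    rw [Submodule.mkQ_apply, Submodule.mkQ_apply, Submodule.Quotient.eq]
    exact ⟨-y, by simp⟩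

/-- The sequence `0 → P/I^n P → P/I^{n+1} P → C/I^{n+1} C → 0` with `C` the cokernel: the first map
exists because `φ` lies in `I • End`, and is injective by `hsup`. -/
lemma length_coker (hφ : φ ∈ (I • ⊤ : Submodule R (P →ₗ[R] P))) {n : ℕ}
    (hsup : ∀ u, φ u ∈ (I ^ (n + 1) • ⊤ : Submodule R P) → u ∈ (I ^ n • ⊤ : Submodule R P)) :
    Module.length R (P ⧸ (I ^ (n + 1) • ⊤ : Submodule R P)) =
      Module.length R (P ⧸ (I ^ n • ⊤ : Submodule R P)) + Module.length R
        ((P ⧸ LinearMap.range φ) ⧸ (I ^ (n + 1) • ⊤ : Submodule R (P ⧸ LinearMap.range φ))) := by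
  let f : (P ⧸ (I ^ n • ⊤ : Submodule R P)) →ₗ[R] (P ⧸ (I ^ (n + 1) • ⊤ : Submodule R P)) :=
    Submodule.mapQ _ _ φ fun x hx => mem_pow_smul_of_mem_smul_end hφ hx
  let g : (P ⧸ (I ^ (n + 1) • ⊤ : Submodule R P)) →ₗ[R]
      ((P ⧸ LinearMap.range φ) ⧸ (I ^ (n + 1) • ⊤ : Submodule R (P ⧸ LinearMap.range φ))) :=
    Submodule.mapQ _ _ (LinearMap.range φ).mkQ fun x hx =>
      (mem_pow_smul_coker_iff _ x).2 ⟨0, by simpa using hx⟩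
  refine SES.length_eq (f := f) (g := g) ⟨(injective_iff_map_eq_zero _).2 fun x hx => ?_,
    fun x => ?_, fun x => ?_⟩
  · obtain ⟨x, rfl⟩ := Submodule.mkQ_surjective _ x
    exact (Submodule.Quotient.mk_eq_zero _).2 (hsup x ((Submodule.Quotient.mk_eq_zero _).1 hx))
  · obtain ⟨x, rfl⟩ := Submodule.mkQ_surjective _ x
    obtain ⟨x, rfl⟩ := Submodule.mkQ_surjective _ x
    exact ⟨Submodule.Quotient.mk x, rfl⟩
  · obtain ⟨x, rfl⟩ := Submodule.mkQ_surjective _ x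
    refine ((Submodule.Quotient.mk_eq_zero _).trans (mem_pow_smul_coker_iff _ x)).trans ?_
    constructor
    · rintro ⟨y, hy⟩
      exact ⟨Submodule.Quotient.mk y, ((Submodule.Quotient.eq _).2 hy).symm⟩
    · rintro ⟨y, hy⟩
      obtain ⟨y, rfl⟩ := Submodule.mkQ_surjective _ y
      exact ⟨y, (Submodule.Quotient.eq _).1 hy.symm⟩

lemma length_pi_quotient (D : ℕ) :
    Module.length R ((Fin D → M) ⧸ (I • ⊤ : Submodule R (Fin D → M))) =
      D * Module.length R (M ⧸ (I • ⊤ : Submodule R M)) := by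
  have : (I • ⊤ : Submodule R (Fin D → M)) =
      Submodule.pi Set.univ fun _ => (I • ⊤ : Submodule R M) := by
    ext x
    rw [smul_top_pi, Submodule.mem_pi]
    simp
  rw [this, (Submodule.quotientPi _).length_eq, Module.length_pi, ENat.card_eq_coe_fintype_card,
    Fintype.card_fin]

end Hilbert

/-! ### Summation of polynomial growth. -/

section Asymptotics

open scoped Nat

/-- A sequence whose increments grow like `λ n ^ r / r!` grows like `λ n ^ (r + 1) / (r + 1)!`. -/
lemma tendsto_of_tendsto_sub {a b : ℕ → ℝ} {c r : ℕ} {l : ℝ}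
    (h : ∀ n ≥ c, a (n + 1) - a n = b (n + 1))
    (hb : Tendsto (fun n : ℕ => (r ! : ℝ) * b n / (n : ℝ) ^ r) atTop (𝓝 l)) :
    Tendsto (fun n : ℕ => ((r + 1)! : ℝ) * a n / (n : ℝ) ^ (r + 1)) atTop (𝓝 l) := by
  have hpos : ∀ s : ℕ, ∀ᶠ n : ℕ in atTop, ((n : ℝ) ^ s / s !) ≠ 0 := fun s => by
    filter_upwards [eventually_gt_atTop 0] with n hn
    positivity
  have hchoose : ∀ s : ℕ, Tendsto (fun n : ℕ => (n.choose s : ℝ) / ((n : ℝ) ^ s / s !)) atTop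
      (𝓝 1) := fun s => (isEquivalent_iff_tendsto_one (hpos s)).1 (isEquivalent_choose s)
  have hb' : Tendsto (fun n : ℕ => b (n + 1) / ((n : ℝ) ^ r / r !)) atTop (𝓝 l) := by
    have h1 : Tendsto (fun n : ℕ => (r ! : ℝ) * b (n + 1) / ((n + 1 : ℕ) : ℝ) ^ r) atTop (𝓝 l) :=
      hb.comp (tendsto_add_atTop_nat 1)
    have h2 : Tendsto (fun n : ℕ => (((n + 1 : ℕ) : ℝ) / n) ^ r) atTop (𝓝 1) := by
      have h3 : Tendsto (fun n : ℕ => ((n + 1 : ℕ) : ℝ) / n) atTop (𝓝 1) := by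
        have h4 := tendsto_const_nhds (x := (1 : ℝ)).add tendsto_one_div_atTop_nhds_zero_nat
        rw [add_zero] at h4
        refine h4.congr' ?_
        filter_upwards [eventually_gt_atTop 0] with n hn
        have : (n : ℝ) ≠ 0 := by positivity
        push_cast
        field_simp
      simpa using h3.pow r
    have h5 := h1.mul h2
    rw [mul_one] at h5
    refine h5.congr' ?_
    filter_upwards [eventually_gt_atTop 0] with n hn
    have : (n : ℝ) ≠ 0 := by positivity
    have : (((n + 1 : ℕ) : ℝ)) ≠ 0 := by positivity
    rw [div_pow]
    field_simp
  -- Powers are traded for binomial coefficients, whose partial sums are again binomial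
  -- coefficients.
  have hd : (fun n : ℕ => a (n + 1) - a n - l * n.choose r) =o[atTop]
      fun n : ℕ => ((n : ℝ) ^ r / r !) := by
    refine (isLittleO_iff_tendsto' ((hpos r).mono fun n hn h0 => absurd h0 hn)).2 ?_
    have h1 := hb'.sub ((hchoose r).const_mul l)
    rw [mul_one, sub_self] at h1
    refine h1.congr' ?_
    filter_upwards [eventually_ge_atTop c] with n hn
    rw [h n hn]
    ring
  have hd2 : (fun n : ℕ => a (n + 1) - a n - l * n.choose r) =o[atTop]
      fun n : ℕ => (n.choose r : ℝ) := hd.trans_isTheta (isEquivalent_choose r).symm.isTheta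
  have hsum : ∀ n : ℕ, ∑ i ∈ Finset.range n, (i.choose r : ℝ) = n.choose (r + 1) := fun n => by
    induction n with
    | zero => simp
    | succ n ih => rw [Finset.sum_range_succ, ih, Nat.choose_succ_succ, Nat.cast_add, add_comm]
  have htop : Tendsto (fun n : ℕ => (n.choose (r + 1) : ℝ)) atTop atTop := by
    refine (isEquivalent_choose (r + 1)).symm.tendsto_atTop ?_
    exact ((tendsto_pow_atTop (Nat.succ_ne_zero r)).comp
      tendsto_natCast_atTop_atTop).atTop_div_const (by positivity)
  -- Little-o estimates may be summed because the comparison sums `n.choose (r + 1)` diverge.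
  have h1 := hd2.sum_range (fun n => Nat.cast_nonneg _) (by simpa only [hsum] using htop)
  have h2 : ∀ n : ℕ, ∑ i ∈ Finset.range n, (a (i + 1) - a i - l * i.choose r) =
      a n - a 0 - l * n.choose (r + 1) := fun n => by
    rw [Finset.sum_sub_distrib, Finset.sum_range_sub, ← Finset.mul_sum, hsum]
  simp only [h2, hsum] at h1
  have h3 := (h1.trans_isTheta (isEquivalent_choose (r + 1)).isTheta).tendsto_div_nhds_zero
  have h4 : Tendsto (fun n : ℕ => a 0 / ((n : ℝ) ^ (r + 1) / (r + 1)!)) atTop (𝓝 0) :=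
    tendsto_const_nhds.div_atTop (((tendsto_pow_atTop (Nat.succ_ne_zero r)).comp
      tendsto_natCast_atTop_atTop).atTop_div_const (by positivity))
  have h5 := (h3.add h4).add ((hchoose (r + 1)).const_mul l)
  rw [zero_add, zero_add, mul_one] at h5
  refine h5.congr fun n => ?_
  simp only [div_eq_mul_inv, mul_inv, inv_inv]
  ring

end Asymptotics
end
end LocalModule

namespace LocalModule
section

open IsLocalRing CategoryTheory Abelian Filter Topology RingTheory.Sequence

/-! ### Bass numbers of powers and cokernels. -/

section BassShift

variable {R : Type u} [CommRing R] [IsLocalRing R] {M P : Type u}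
  [AddCommGroup M] [Module R M] [AddCommGroup P] [Module R P] {φ : P →ₗ[R] P}

lemma extPost_residueField_eq_zero (hφ : φ ∈ (maximalIdeal R • ⊤ : Submodule R (P →ₗ[R] P)))
    {n : ℕ} (e : ExtModule R (ResidueField R) P n) : extPost (ResidueField R) n φ e = 0 := by
  induction hφ using Submodule.smul_induction_on' with
  | smul a ha f _ => rw [extPost_smul, smul_ext_residueField_left ha]
  | add f _ g _ hf hg => rw [extPost_add, hf, hg, add_zero]

variable [IsNoetherianRing R]

lemma bass_pi [Module.Finite R M] (D n : ℕ) : bass R (Fin D → M) n = D * bass R M n := by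
  have h := (extPiPost (R := R) (ResidueField R) M n D).length_eq
  rw [Module.length_pi, length_ext_residueField_left, length_ext_residueField_left,
    ENat.card_eq_coe_fintype_card, Fintype.card_fin] at h
  exact_mod_cast h

/-- `φ` induces zero on `Ext(k, P)`, so the connecting map is onto `Ext^{n+1}(k, P)`; it is
injective because `Ext^n(k, P) = 0`. -/
lemma bass_coker [Module.Finite R P] (hinj : Function.Injective φ)
    (hφ : φ ∈ (maximalIdeal R • ⊤ : Submodule R (P →ₗ[R] P))) {n : ℕ} (h : bass R P n = 0) :
    bass R (P ⧸ LinearMap.range φ) n = bass R P (n + 1) := by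
  have hS := SES.of_injective hinj
  have hbij : Function.Bijective (hS.deltaPost (ResidueField R) n) := by
    refine ⟨(injective_iff_map_eq_zero _).2 fun x hx => ?_, fun x =>
      (hS.post_exact₁ x).1 (extPost_residueField_eq_zero hφ x)⟩
    obtain ⟨y, rfl⟩ := (hS.post_exact₃ x).1 hx
    rw [extVanishes_iff.1 ((bass_eq_zero_iff n).1 h) y, map_zero]
  have := (LinearEquiv.ofBijective _ hbij).length_eq
  rw [length_ext_residueField_left, length_ext_residueField_left] at this
  exact_mod_cast this

lemma eq_zero_of_bass_zero_eq_zero [Module.Finite R M] (h : bass R M 0 = 0) {x : M}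
    (hx : ∀ a ∈ maximalIdeal R, a • x = 0) : x = 0 := by
  let f : ResidueField R →ₗ[R] M :=
    Submodule.liftQ (maximalIdeal R) (LinearMap.toSpanSingleton R M x) hx
  have h1 := extVanishes_iff.1 ((bass_eq_zero_iff 0).1 h) (Ext.mk₀ (ModuleCat.ofHom f))
  rw [← Ext.mk₀_zero] at h1
  have h2 := Ext.homEquiv₀.symm.injective h1
  have h3 := congrArg (fun z : ModuleCat.of R (ResidueField R) ⟶ ModuleCat.of R M =>
    z.hom (Submodule.Quotient.mk (1 : R) : R ⧸ maximalIdeal R)) h2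
  exact (one_smul R x).symm.trans h3

lemma bass_eq_zero_of_isWeaklyRegular (rs : List R) (hrs : ∀ x ∈ rs, x ∈ maximalIdeal R)
    {M : Type u} [AddCommGroup M] [Module R M] [Module.Finite R M] (hreg : IsWeaklyRegular M rs)
    {i : ℕ} (hi : i < rs.length) : bass R M i = 0 := by
  induction rs generalizing M i with
  | nil => simp at hi
  | cons x rs ih =>
    rw [isWeaklyRegular_cons_iff] at hreg
    have hx := hrs x List.mem_cons_self
    cases i with
    | zero =>
      refine (bass_eq_zero_iff 0).2 (extVanishes_iff.2 fun e => ?_)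
      refine (injective_iff_map_eq_zero _).1 (ses_quotSMulTop hreg.1).post_injective e ?_
      rw [extPost_smul_id, smul_ext_residueField_left hx]
    | succ i =>
      have h1 := ih (fun y hy => hrs y (List.mem_cons_of_mem _ hy)) hreg.2
        (i := i) (by simpa using hi)
      rw [bass_quotSMulTop hx hreg.1] at h1
      omega

end BassShift

/-! ### Dimension of powers. -/

section SupportDim

variable {R : Type u} [CommRing R]

lemma supportDim_pi_le {M : Type u} [AddCommGroup M] [Module R M] [Module.Finite R M] (d : ℕ) :
    Module.supportDim R (Fin d → M) ≤ Module.supportDim R M := by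
  have hann : Module.annihilator R M ≤ Module.annihilator R (Fin d → M) := fun a ha =>
    Module.mem_annihilator.2 fun x => funext fun i => Module.mem_annihilator.1 ha (x i)
  have : Module.support R (Fin d → M) ⊆ Module.support R M := by
    rw [Module.support_eq_zeroLocus, Module.support_eq_zeroLocus]
    exact PrimeSpectrum.zeroLocus_anti_mono hann
  exact Order.krullDim_le_of_strictMono (Set.inclusion this) fun _ _ h => h

end SupportDim

/-! ### Reduction to finite length by iterated cokernels. -/

section Reduction

variable {R : Type u} [CommRing R] [IsLocalRing R]

variable (R) in
/-- The Hilbert-Samuel function of `M`. -/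
noncomputable def hilbert (M : Type u) [AddCommGroup M] [Module R M] (n : ℕ) : ℝ :=
  (Module.length R (M ⧸ ((maximalIdeal R) ^ n • (⊤ : Submodule R M)))).toNat

lemma mu_pi {M : Type u} [AddCommGroup M] [Module R M] [Module.Finite R M] (D : ℕ) :
    mu R (Fin D → M) = D * mu R M := by
  have h := length_pi_quotient (M := M) (I := maximalIdeal R) D
  rw [length_quotient_maximalIdeal_smul, length_quotient_maximalIdeal_smul] at h
  exact_mod_cast h

lemma hilbert_pi {M : Type u} [AddCommGroup M] [Module R M] (D n : ℕ) :
    hilbert R (Fin D → M) n = D * hilbert R M n := by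
  rw [hilbert, length_pi_quotient, hilbert]
  simp

variable {P : Type u} [AddCommGroup P] [Module R P] [Module.Finite R P] {φ : P →ₗ[R] P}

/-- The image of `φ` lies in `𝔪P`; this is the case `n = 0` of `length_coker`. -/
lemma mu_coker (hφ : φ ∈ (maximalIdeal R • ⊤ : Submodule R (P →ₗ[R] P))) :
    mu R (P ⧸ LinearMap.range φ) = mu R P := by
  have h := length_coker hφ (n := 0) fun u _ => by simp
  have h0 : Subsingleton (P ⧸ (maximalIdeal R ^ 0 • ⊤ : Submodule R P)) := by
    rw [Submodule.Quotient.subsingleton_iff]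
    simp
  rw [Module.length_eq_zero (M := P ⧸ (maximalIdeal R ^ 0 • ⊤ : Submodule R P)), zero_add, zero_add,
    pow_one, length_quotient_maximalIdeal_smul, length_quotient_maximalIdeal_smul] at h
  exact_mod_cast h.symm

variable [IsNoetherianRing R]

lemma hilbert_coker (hφ : φ ∈ (maximalIdeal R • ⊤ : Submodule R (P →ₗ[R] P))) {n : ℕ}
    (hsup : ∀ u, φ u ∈ (maximalIdeal R ^ (n + 1) • ⊤ : Submodule R P) →
      u ∈ (maximalIdeal R ^ n • ⊤ : Submodule R P)) :
    hilbert R P (n + 1) - hilbert R P n = hilbert R (P ⧸ LinearMap.range φ) (n + 1) := by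
  have h := length_coker hφ hsup
  have h1 := Module.length_ne_top_iff.2 (isFiniteLength_quotient_pow R P n)
  have h2 := Module.length_ne_top_iff.2
    (isFiniteLength_quotient_pow R (P ⧸ LinearMap.range φ) (n + 1))
  rw [hilbert, h, ENat.toNat_add h1 h2, hilbert, hilbert]
  push_cast
  ring

variable (R) in
/-- The finite length module `L` is obtained from `D` copies of `M` by `r` successive cokernels of
superficial endomorphisms. The fields list what is inherited. -/
structure IsReduction (r D : ℕ) (M L : Type u) [AddCommGroup M] [Module R M] [AddCommGroup L]
    [Module R L] : Prop where
  finite : Module.Finite R L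
  isFiniteLength : IsFiniteLength R L
  pos : 0 < D
  mu_eq : mu R L = D * mu R M
  bass_eq : bass R L 0 = D * bass R M r
  tendsto : Tendsto (fun n : ℕ => (r.factorial : ℝ) * hilbert R M n / (n : ℝ) ^ r) atTop
    (𝓝 ((Module.length R L).toNat / D))
  -- Each of the `r` cokernels needs one more degree: below `n` for `Tor` and for `Ext` out of `M`,
  -- above `n` for `Ext` into `M`. The additive lower bound ignores negative degrees.
  tensorExact : ∀ (S : FreeResolution R) (n : ℕ),
    (∀ i, i ≤ n → n ≤ i + r → S.TensorExact M i) → S.TensorExact L n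
  extVanishes_left : ∀ (N : Type u) [AddCommGroup N] [Module R N] (n : ℕ),
    (∀ i, i ≤ n → n ≤ i + r → ExtVanishes R M N i) → ExtVanishes R L N n
  extVanishes_right : ∀ (N : Type u) [AddCommGroup N] [Module R N] (n : ℕ),
    (∀ i, n ≤ i → i ≤ n + r → ExtVanishes R N M i) → ExtVanishes R N L n

lemma isReduction_zero {M : Type u} [AddCommGroup M] [Module R M] [Module.Finite R M]
    (h : Module.supportDim R M ≤ 0) : IsReduction R 0 1 M M where
  finite := ‹_›
  isFiniteLength := by
    obtain ⟨t, ht⟩ := exists_pow_smul_eq_bot_of_supportDim_le h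
    exact isFiniteLength_of_pow_smul_eq_bot ht
  pos := one_pos
  mu_eq := (one_mul _).symm
  bass_eq := (one_mul _).symm
  tendsto := by
    obtain ⟨t, ht⟩ := exists_pow_smul_eq_bot_of_supportDim_le h
    refine tendsto_const_nhds.congr' ?_
    filter_upwards [eventually_ge_atTop t] with n hn
    have hbot : (maximalIdeal R ^ n • ⊤ : Submodule R M) = ⊥ := by
      rw [eq_bot_iff, ← ht]
      exact Submodule.smul_mono (Ideal.pow_le_pow_right hn) le_rfl
    rw [hilbert, (Submodule.quotEquivOfEqBot _ hbot).length_eq]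
    simp
  tensorExact _ _ h := h _ le_rfl le_rfl
  extVanishes_left _ _ _ _ h := h _ le_rfl le_rfl
  extVanishes_right _ _ _ _ h := h _ le_rfl le_rfl

/-- The vanishing `bass R M r = 0` lets the socle of `L` be traced one step further, to degree `r +
1` of `M`. The limit passes from the cokernel to `M^d` by summation and to `M` by division by `d`.
-/
lemma IsReduction.succ {M L : Type u} [AddCommGroup M] [Module R M] [Module.Finite R M]
    [AddCommGroup L] [Module R L] {r D d c : ℕ} (hd : 0 < d)
    {φ : (Fin d → M) →ₗ[R] (Fin d → M)} (hinj : Function.Injective φ)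
    (hφ : φ ∈ (maximalIdeal R • ⊤ : Submodule R ((Fin d → M) →ₗ[R] (Fin d → M))))
    (hsup : ∀ n ≥ c, ∀ u, φ u ∈ (maximalIdeal R ^ (n + 1) • ⊤ : Submodule R (Fin d → M)) →
      u ∈ (maximalIdeal R ^ n • ⊤ : Submodule R (Fin d → M)))
    (hbass : bass R M r = 0) (h : IsReduction R r D ((Fin d → M) ⧸ LinearMap.range φ) L) :
    IsReduction R (r + 1) (D * d) M L where
  finite := h.finite
  isFiniteLength := h.isFiniteLength
  pos := Nat.mul_pos h.pos hd
  mu_eq := by rw [h.mu_eq, mu_coker hφ, mu_pi, mul_assoc]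
  bass_eq := by
    rw [h.bass_eq, bass_coker hinj hφ (by rw [bass_pi, hbass, mul_zero]), bass_pi, mul_assoc]
  tendsto := by
    have h1 := tendsto_of_tendsto_sub (a := hilbert R (Fin d → M)) (c := c)
      (fun n hn => hilbert_coker hφ (hsup n hn)) h.tendsto
    have h2 := h1.div_const (d : ℝ)
    rw [Nat.cast_mul, ← div_div]
    refine h2.congr fun n => ?_
    have : (d : ℝ) ≠ 0 := by positivity
    rw [hilbert_pi]
    field_simp
  tensorExact S n hn := h.tensorExact S n fun i h1 h2 => by
    have hS := SES.of_injective hinj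
    cases i with
    | zero => exact ((hn 0 h1 (by omega)).pi S d).of_surjective S hS.surj
    | succ i =>
      exact FreeResolution.TensorExact.coker S hS ((hn i (by omega) (by omega)).pi S d)
        ((hn (i + 1) h1 (by omega)).pi S d)
  extVanishes_left N _ _ n hn := h.extVanishes_left N n fun i h1 h2 => by
    have hS := SES.of_injective hinj
    cases i with
    | zero => exact hS.extVanishes_left₃_zero (extVanishes_pi_left d (hn 0 h1 (by omega)))
    | succ i =>
      exact hS.extVanishes_left₃ (extVanishes_pi_left d (hn i (by omega) (by omega)))
        (extVanishes_pi_left d (hn (i + 1) h1 (by omega)))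
  extVanishes_right N _ _ n hn := h.extVanishes_right N n fun i h1 h2 =>
    (SES.of_injective hinj).extVanishes_right₃ (extVanishes_pi_right d (hn i h1 (by omega)))
      (extVanishes_pi_right d (hn (i + 1) (by omega) (by omega)))

/-- Every module of depth at least `r` and dimension at most `r` has a reduction. -/
lemma exists_isReduction {r : ℕ} {M : Type u} [AddCommGroup M] [Module R M] [Module.Finite R M]
    (hbass : ∀ i < r, bass R M i = 0) (hdim : Module.supportDim R M ≤ r) :
    ∃ (D : ℕ) (L : Type u) (_ : AddCommGroup L) (_ : Module R L), IsReduction R r D M L := by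
  induction r generalizing M with
  | zero => exact ⟨1, M, _, _, isReduction_zero hdim⟩
  | succ r ih =>
    -- Depth is encoded by vanishing Bass numbers because these simply shift for the cokernel, so
    -- the induction needs no regular sequence on it.
    obtain ⟨d, hd, φ, hinj, hφ, c, hsup⟩ := exists_superficial_endomorphism (M := M)
      (maximalIdeal R) (fun D => Ideal.iInf_pow_smul_eq_bot_of_isLocalRing _
        (maximalIdeal.isMaximal R).ne_top) fun u hu =>
        eq_zero_of_bass_zero_eq_zero (hbass 0 (by omega)) hu
    obtain ⟨D, L, i1, i2, h⟩ := ih (M := (Fin d → M) ⧸ LinearMap.range φ) (fun i hi => by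
      rw [bass_coker hinj hφ (by rw [bass_pi, hbass i (by omega), mul_zero]), bass_pi,
        hbass (i + 1) (by omega), mul_zero])
      (supportDim_coker_le hinj ((supportDim_pi_le d).trans hdim))
    exact ⟨D * d, L, i1, i2, h.succ hd hinj hφ hsup (hbass r (by omega))⟩

end Reduction
end
end LocalModule

namespace LocalModule
section

open IsLocalRing CategoryTheory Abelian Filter RingTheory.Sequence

/-! ### The vanishing theorems. -/

section Main

lemma finiteId_of_subsingleton {R : Type u} [CommRing R] {N : Type u} [AddCommGroup N]
    [Module R N] [Subsingleton N] : FiniteId R N :=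
  (injectiveDimension_lt_iff (n := 0).2
    (ModuleCat.isZero_of_subsingleton (ModuleCat.of R N)).hasInjectiveDimensionLT_zero).trans_le
      le_top

variable {R : Type u} [CommRing R] [IsLocalRing R] {M N : Type u} [AddCommGroup M] [Module R M]
  [AddCommGroup N] [Module R N]

/-- Rules out `M = 0` under `e(M) < 2 μ(M)`, since both sides are then zero. -/
lemma mult_eq_zero_of_subsingleton [Subsingleton M] : mult R M = 0 := by
  have : ∀ n : ℕ, Module.length R (M ⧸ ((maximalIdeal R) ^ n • (⊤ : Submodule R M))) = 0 :=
    fun n => Module.length_eq_zero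
  simp only [mult, this, ENat.toNat_zero, Nat.cast_zero, mul_zero, zero_div]
  exact tendsto_const_nhds.limUnder_eq

lemma bassSum_mono {s t : ℕ} (h : s ≤ t) (j : ℕ) : bassSum R N s j ≤ bassSum R N t j := by
  refine (Finset.sum_le_sum fun i _ => Nat.mul_le_mul_right _ (Nat.choose_le_choose i h)).trans
    (Finset.sum_le_sum_of_subset (Finset.range_mono (by omega)))

/-- Shift to the first syzygy, which is again finitely generated. This reaches a positive degree, as
`finiteId_of_extVanishes` requires. -/
lemma extVanishes_succ_of_forall [Module.Finite R M] {l : ℕ}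
    (h : ∀ (X : Type u) [AddCommGroup X] [Module R X] [Module.Finite R X], ExtVanishes R X N l)
    [IsNoetherianRing R] : ExtVanishes R M N (l + 1) :=
  (minimalCover_ses (R := R) (N := M)).extVanishes_left₃ (h _) (extVanishes_projective l)

variable [IsNoetherianRing R] [Module.Finite R M] [Module.Finite R N]

/-- The reduction of a Cohen-Macaulay module computes its multiplicity. -/
lemma IsCM.exists_isReduction [Nontrivial M] (h : IsCM R M) :
    ∃ (D : ℕ) (L : Type u) (_ : AddCommGroup L) (_ : Module R L),
      IsReduction R (dim R M) D M L ∧ ((Module.length R L).toNat : ℝ) = D * mult R M := by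
  obtain ⟨rs, hrs, hreg, hlen, -⟩ := h.exists_isRegular
  obtain ⟨D, L, i1, i2, hL⟩ := LocalModule.exists_isReduction (r := dim R M) (M := M)
    (fun i hi => bass_eq_zero_of_isWeaklyRegular rs hrs hreg.toIsWeaklyRegular (hlen ▸ hi))
    supportDim_eq_dim.le
  refine ⟨D, L, i1, i2, hL, ?_⟩
  have hD : (D : ℝ) ≠ 0 := Nat.cast_ne_zero.2 hL.pos.ne'
  have : mult R M = (Module.length R L).toNat / D := hL.tendsto.limUnder_eq
  rw [this]
  field_simp

/-- A Cohen-Macaulay module with `e(M) < 2 μ(M)` has a reduction with `λ(L) < 2 μ(L)`. -/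
lemma IsCM.exists_isReduction_of_mult_lt_mu (h : IsCM R M) (hlt : mult R M < 2 * (mu R M : ℝ)) :
    ∃ (D : ℕ) (L : Type u) (_ : AddCommGroup L) (_ : Module R L),
      IsReduction R (dim R M) D M L ∧ (Module.length R L).toNat < 2 * mu R L := by
  rcases subsingleton_or_nontrivial M with hM | hM
  · rw [mult_eq_zero_of_subsingleton, mu_eq_zero_iff.2 hM] at hlt
    simp at hlt
  · obtain ⟨D, L, i1, i2, hL, hlen⟩ := h.exists_isReduction
    refine ⟨D, L, i1, i2, hL, ?_⟩
    have hD : (0 : ℝ) < D := Nat.cast_pos.2 hL.pos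
    have : ((Module.length R L).toNat : ℝ) < (2 * mu R L : ℕ) := by
      rw [hlen, hL.mu_eq]
      push_cast
      nlinarith
    exact_mod_cast this

/-- A nonzero Cohen-Macaulay module with `e(M) < 2 type(M)` has a reduction `L` whose length is
less than twice the dimension of its socle. -/
lemma IsCM.exists_isReduction_of_mult_lt_type [Nontrivial M] (h : IsCM R M)
    (hlt : mult R M < 2 * (type R M : ℝ)) :
    ∃ (D : ℕ) (L : Type u) (_ : AddCommGroup L) (_ : Module R L),
      IsReduction R (dim R M) D M L ∧ (Module.length R L).toNat < 2 * bass R L 0 := by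
  obtain ⟨-, -, -, -, hdepth⟩ := h.exists_isRegular
  obtain ⟨D, L, i1, i2, hL, hlen⟩ := h.exists_isReduction
  refine ⟨D, L, i1, i2, hL, ?_⟩
  have hD : (0 : ℝ) < D := Nat.cast_pos.2 hL.pos
  rw [type, hdepth] at hlt
  have : ((Module.length R L).toNat : ℝ) < (2 * bass R L 0 : ℕ) := by
    rw [hlen, hL.bass_eq]
    push_cast
    nlinarith
  exact_mod_cast this

lemma finitePd_of_torVanishes (hM : IsCM R M) (hlt : mult R M < 2 * (mu R M : ℝ)) {j : ℕ}
    (h : ∀ n : ℕ, j + 1 ≤ n + dim R M → n ≤ j + betti R N j → TorVanishes R M N n) :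
    FinitePd R N := by
  obtain ⟨D, L, _, _, hL, hlen⟩ := hM.exists_isReduction_of_mult_lt_mu hlt
  have := hL.finite
  refine finitePd_of_betti_eq_zero (n := j + betti R N j)
    (eq_zero_of_growth (betti R N) hlen fun n h1 h2 => ?_)
  refine mu_mul_betti_succ_le hL.isFiniteLength (hL.tensorExact _ _ fun i h3 h4 => ?_)
  exact (minimalResolution R N).tensorExact_of_torVanishes (h i (by omega) (by omega))

lemma finitePd_of_extVanishes [Nontrivial M] (hM : IsCM R M) (hlt : mult R M < 2 * (type R M : ℝ))
    {j : ℕ} (h : ∀ n : ℕ, j + 1 ≤ n → n ≤ j + betti R N j + dim R M → ExtVanishes R N M n) :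
    FinitePd R N := by
  obtain ⟨D, L, _, _, hL, hlen⟩ := hM.exists_isReduction_of_mult_lt_type hlt
  have := hL.finite
  refine finitePd_of_betti_eq_zero (n := j + betti R N j)
    (eq_zero_of_growth (betti R N) hlen fun n h1 h2 => ?_)
  exact bass_mul_betti_succ_le hL.isFiniteLength
    (hL.extVanishes_right _ _ fun i h3 h4 => h i (by omega) (by omega))

lemma finiteId_of_extVanishes_of_isCM_right (hM : IsCM R M) (hlt : mult R M < 2 * (mu R M : ℝ))
    (hN : IsCM R N) {j : ℕ}
    (h : ∀ n : ℕ, j + 1 ≤ n + dim R M → n ≤ j + dim R N + bassSum R N (dim R N) j →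
      ExtVanishes R M N n) : FiniteId R N := by
  rcases subsingleton_or_nontrivial N with h0 | h0
  · exact finiteId_of_subsingleton
  · obtain ⟨D, L, _, _, hL, hlen⟩ := hM.exists_isReduction_of_mult_lt_mu hlt
    have := hL.finite
    obtain ⟨rs, hrs, hreg, hdim, -⟩ := hN.exists_isRegular
    rw [← hdim] at h
    have key := extVanishes_of_window hL.isFiniteLength hlen rs hrs hreg.toIsWeaklyRegular
      (hdim ▸ supportDim_eq_dim.le) (j := j) fun n h1 h2 =>
        hL.extVanishes_left N n fun i h3 h4 => h i (by omega) (by omega)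
    exact finiteId_of_extVanishes fun I => extVanishes_succ_of_forall key

/-- The window produces one zero Bass number. Dividing `R` by a maximal regular sequence gives a
nonzero `Y` of finite length with `Ext^n(Y, N) = 0` for `n > dim R`; since `j ≥ dim R`,
`bass_succ_eq_zero` applies from that point on. -/
lemma finiteId_of_extVanishes_of_isCM_ring (hM : IsCM R M) (hlt : mult R M < 2 * (mu R M : ℝ))
    (hR : IsCM R R) {j : ℕ} (hj : ringDim R ≤ j)
    (h : ∀ n : ℕ, j + 1 ≤ n + dim R M → n ≤ j + bass R N j → ExtVanishes R M N n) :
    FiniteId R N := by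
  obtain ⟨D, L, _, _, hL, hlen⟩ := hM.exists_isReduction_of_mult_lt_mu hlt
  have := hL.finite
  have hbass := bass_eq_zero_of_extVanishes (N := N) (j := j) hL.isFiniteLength hlen fun n h1 h2 =>
    hL.extVanishes_left N n fun i h3 h4 => h i (by omega) (by omega)
  obtain ⟨rs, hrs, hreg, hdim, -⟩ := hR.exists_isRegular
  have hringDim : dim R R = ringDim R := by
    rw [ringDim, dim, Module.supportDim_self_eq_ringKrullDim]
  obtain ⟨Y, _, _, _, _, hY, hYN⟩ := exists_isFiniteLength_extVanishes (N := N) (c := 0) rs hrs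
    hreg.toIsWeaklyRegular (hdim ▸ supportDim_eq_dim.le) fun n hn => by
      obtain ⟨n, rfl⟩ := Nat.exists_eq_succ_of_ne_zero hn.ne'
      exact extVanishes_projective n
  have hall : ∀ n, j + bass R N j ≤ n → bass R N n = 0 := fun n hn => by
    induction n, hn using Nat.le_induction with
    | base => exact hbass
    | succ n hn ih => exact bass_succ_eq_zero hY (hYN _ (by omega)) ih
  exact finiteId_of_extVanishes fun I => extVanishes_of_forall_bass_eq_zero hall I _ (Nat.le_succ _)

end Main
end
end LocalModule

/-- The windows are written additively: `j + 1 ≤ n + dim R M` means `n ≥ j - dim M + 1`.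
`Tor_n` and `Ext^n` vanish for `n < 0`, so only natural numbers `n` are tested. -/
theorem theoremA (R : Type u) [CommRing R] [IsLocalRing R] [IsNoetherianRing R]
    (M : Type u) [AddCommGroup M] [Module R M] [Module.Finite R M]
    (N : Type u) [AddCommGroup N] [Module R N] [Module.Finite R N] :
    (IsCM R M → mult R M < 2 * (mu R M : ℝ) →
      -- vanishing of Tor
      ((∃ j : ℕ, ∀ n : ℕ, j + 1 ≤ n + dim R M → n ≤ j + betti R N j → TorVanishes R M N n) →
        FinitePd R N) ∧
      ((∃ n₀ : ℕ, ∀ n : ℕ, n₀ ≤ n → TorVanishes R M N n) → FinitePd R N) ∧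
      -- vanishing of Ext, when the ring or the second module is Cohen-Macaulay
      (IsCM R R ∨ IsCM R N →
        ((∃ j : ℕ, dim R M + ringDim R ≤ j ∧
            ∀ n : ℕ, j + 1 ≤ n + dim R M → n ≤ j + ringDim R + bassSum R N (ringDim R) j →
              ExtVanishes R M N n) →
          FiniteId R N) ∧
        ((∃ n₀ : ℕ, ∀ n : ℕ, n₀ ≤ n → ExtVanishes R M N n) → FiniteId R N)) ∧
      -- the sharper window, with arbitrary `j`, when the second module is Cohen-Macaulay
      (IsCM R N →
        (∃ j : ℕ, ∀ n : ℕ, j + 1 ≤ n + dim R M → n ≤ j + dim R N + bassSum R N (dim R N) j →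
            ExtVanishes R M N n) →
          FiniteId R N)) ∧
    (Nontrivial M → IsCM R M → mult R M < 2 * (type R M : ℝ) →
      ((∃ j : ℕ, ∀ n : ℕ, j + 1 ≤ n → n ≤ j + betti R N j + dim R M → ExtVanishes R N M n) →
        FinitePd R N) ∧
      ((∃ n₀ : ℕ, ∀ n : ℕ, n₀ ≤ n → ExtVanishes R N M n) → FinitePd R N)) := by
  refine ⟨fun hM hlt => ⟨fun ⟨j, h⟩ => finitePd_of_torVanishes hM hlt h, fun ⟨n₀, h⟩ => ?_,
    fun hRN => ?_, fun hN ⟨j, h⟩ => finiteId_of_extVanishes_of_isCM_right hM hlt hN h⟩,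
    fun _ hM hlt => ⟨fun ⟨j, h⟩ => finitePd_of_extVanishes hM hlt h, fun ⟨n₀, h⟩ =>
      finitePd_of_extVanishes hM hlt (j := n₀) fun n h1 _ => h n (by omega)⟩⟩
  -- The window starts at `j - dim M + 1`, so adding `dim M` places it beyond `n₀`.
  · exact finitePd_of_torVanishes hM hlt (j := n₀ + dim R M) fun n h1 _ => h n (by omega)
  · have key : ∀ j : ℕ, dim R M + ringDim R ≤ j →
        (∀ n : ℕ, j + 1 ≤ n + dim R M → n ≤ j + ringDim R + bassSum R N (ringDim R) j →
          ExtVanishes R M N n) → FiniteId R N := by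
      intro j hj h
      rcases hRN with hR | hN
      · refine finiteId_of_extVanishes_of_isCM_ring hM hlt hR (j := j) (by omega) fun n h1 h2 => ?_
        have := bass_le_bassSum (R := R) (N := N) (ringDim R) j
        exact h n h1 (by omega)
      · refine finiteId_of_extVanishes_of_isCM_right hM hlt hN (j := j) fun n h1 h2 => ?_
        -- The window for `dim N` lies inside the one for `dim R`, because the binomial sums
        -- increase with the dimension.
        have h3 : dim R N ≤ ringDim R := dim_le_ringDim
        have h4 := bassSum_mono (R := R) (N := N) h3 j
        exact h n h1 (by omega)
    exact ⟨fun ⟨j, hj, h⟩ => key j hj h, fun ⟨n₀, h⟩ => key (n₀ + dim R M + ringDim R) (by omega)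
      fun n h1 _ => h n (by omega)⟩
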